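/- Signature $(-,+,+,+)$, $G=c=1$, $T_{[ab]}=\tfrac12(T_{ab}-T_{ba})$. **Theory.** Let $S=\int \mathcal L(g,A)\,d^4x$ be an action for a Lorentzian metric $g_{ab}$ and a covector field $A_a$ in four dimensions. The Lagrangian density $\mathcal L$ is a smooth function of the fields and finitely many of their derivatives, is covariant under (orientation-preserving) diffeomorphisms as a scalar density, and is invariant under $A_a\to A_a+\nabla_a\chi$ for every smooth function $\chi$. Define the field equation operators by $$E^{[g]}_{ab}=(-g)^{-1/2}\,\frac{\delta S}{\delta g^{ab}},\qquad E^{[A]a}=-(-g)^{-1/2}\,\frac{\delta S}{\delta A_a}$$ (the independent variables being $g^{ab}$ and $A_a$; for $\mathcal L=\sqrt{-g}\,(R-F_{ab}F^{ab})$, $F_{ab}=2\nabla_{[a}A_{b]}$, this sign gives $E^{[A]b}=-4\nabla_aF^{ab}$, i.e. $16\pi$ times the current), and assume that they are smooth second-order local differential operators in $(g_{ab},A_a)$. **Family.** Let $(t,x^i)$ be coordinates on an open set $U\subset\mathbb R^4$, $r=|x|$, and let $\gamma=\{x^i=0\}\cap U$ be connected. Let $(g_{\mu\nu}(\lambda),A_\mu(\lambda))$,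 $0\le\lambda<\lambda_0$, be such that for some $\bar R>0$: (i) on $\{r>\lambda\bar R\}$ the components are jointly smooth in $(\lambda,t,x^i)$, $g(\lambda)$ is Lorentzian, and $E^{[g]}_{ab}=0$, $E^{[A]a}=0$; the background $(g^{(0)},A^{(0)})=(g(0),A(0))$ extends smoothly, with Lorentzian metric, to all of $U$, and $\gamma$ is timelike for $g^{(0)}$; (ii) for each $t_0$ with $(t_0,0)\in\gamma$ the components of $\lambda^{-2}g_{ab}(\lambda)$ and $\lambda^{-1}A_a(\lambda)$ in the coordinates $\bar t=(t-t_0)/\lambda$, $\bar x^i=x^i/\lambda$ extend to smooth functions of $(\lambda,\bar t,\bar x^i)$, including $\lambda=0$, on $\{|\bar x|>\bar R\}$; (iii) at fixed $t$ and direction $x^i/r$ the components $g_{\mu\nu},A_\mu$ are smooth functions of $(\alpha,\beta)=(r,\lambda/r)$ near $(0,0)$, $\alpha,\beta\ge0$, locally uniformly in $t$ and in the direction (on a common neighbourhood, with each derivative in $(\alpha,\beta)$ uniformly bounded). Let $(g^{(1)},A^{(1)})=\partial_\lambda(g,A)|_{\lambda=0}$ for $r>0$, and let $E^{[g](1)}_{ab}$,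 $E^{[A](1)a}$ be the linearizations of $E^{[g]}_{ab}$, $E^{[A]a}$ about $(g^{(0)},A^{(0)})$, applied to $(g^{(1)},A^{(1)})$ in the sense of distributions on $U$: $\langle L\varphi,f\rangle=\int\sqrt{-g^{(0)}}\,(L^\dagger f)\,\varphi\,d^4x$. Let $\tau$ and $u^a$ be the proper time and four-velocity of $\gamma$ in $g^{(0)}$ (with $u^a$ along $+\partial_t$), $\nabla$ the Levi-Civita connection of $g^{(0)}$, and $\delta_4$ the invariant delta function. **Claim.** These distributions are well defined and there are constants $M,q\in\mathbb R$ such that on $U$ $$E^{[g](1)}_{ab}=8\pi M\int_\gamma u_au_b\,\delta_4(x,z(\tau))\,d\tau,\qquad E^{[A](1)a}=16\pi q\int_\gamma u^a\,\delta_4(x,z(\tau))\,d\tau,$$ and along $\gamma$ $$M\,u^b\nabla_bu_a=2q\,u^b\,\nabla_{[a}A^{(0)}_{b]}.$$ -/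

import Mathlib

open scoped ContDiff
open Set MeasureTheory

noncomputable section

namespace SmallBody

/-! ### Fields on a four-dimensional coordinate domain -/

/-- Points of four-dimensional coordinate space, `x = (t, x¹, x², x³)`, with `t = x 0`. -/
abbrev Event : Type := Fin 4 → ℝ

/-- Symmetric rank-two component arrays, as functions of the unordered pair of indices; the component
with indices `μ, ν` of `m` is `m s(μ, ν)`. -/
abbrev SymTensor : Type := Sym2 (Fin 4) → ℝ

/-- Pairs of a symmetric rank-two array and a rank-one array.  For a field configuration these are
the components `(g_{μν}, A_μ)`; for the field equation operators they are `(E_{μν}, E^μ)`. -/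
abbrev FieldValue : Type := SymTensor × (Fin 4 → ℝ)

/-- A metric and a covector field, in components. -/
abbrev FieldConfig : Type := Event → FieldValue

/-- The components `g_{μν}` as a matrix. -/
def metric (v : FieldValue) : Matrix (Fin 4) (Fin 4) ℝ := Matrix.of fun μ ν => v.1 s(μ, ν)

/-- Signature `(-,+,+,+)`: the form is congruent to `diag(-1,1,1,1)`. -/
def IsLorentzian (v : FieldValue) : Prop :=
  ∃ P : Matrix (Fin 4) (Fin 4) ℝ, IsUnit P.det ∧
    P.transpose * metric v * P = Matrix.diagonal ![-1, 1, 1, 1]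

/-- `√(-det g)`. -/
def volDensity (v : FieldValue) : ℝ := Real.sqrt (-(metric v).det)

/-- The components `g^{μν}` of the inverse metric. -/
def invMetric (v : FieldValue) : Matrix (Fin 4) (Fin 4) ℝ := (metric v)⁻¹

/-- The coordinate vector `∂/∂x^μ`. -/
def coordVec (μ : Fin 4) : Event := Pi.single μ 1

/-- The partial derivative `∂f/∂x^μ` at `x`. -/
def partialDeriv (μ : Fin 4) (f : Event → ℝ) (x : Event) : ℝ := fderiv ℝ f x (coordVec μ)

/-- Pullback of the metric and of the covector field along a map `Φ`:
`(Φ^*g)_{μν} = ∂_μΦ^ρ ∂_νΦ^σ g_{ρσ}∘Φ` and `(Φ^*A)_μ = ∂_μΦ^ρ A_ρ∘Φ`. -/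
def pullback (Φ : Event → Event) (ψ : FieldConfig) : FieldConfig := fun x =>
  (Sym2.lift ⟨fun μ ν => ∑ ρ, ∑ σ, partialDeriv μ (fun y => Φ y ρ) x *
      partialDeriv ν (fun y => Φ y σ) x * (ψ (Φ x)).1 s(ρ, σ), by
    intro μ ν
    dsimp only
    rw [Finset.sum_comm]
    refine Finset.sum_congr rfl fun σ _ => Finset.sum_congr rfl fun ρ _ => ?_
    rw [Sym2.eq_swap (a := ρ)]
    ring⟩,
   fun μ => ∑ ρ, partialDeriv μ (fun y => Φ y ρ) x * (ψ (Φ x)).2 ρ)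

/-- The gauge transformation `(g, A) ↦ (g, A + dχ)`. -/
def gaugeTransform (χ : Event → ℝ) (ψ : FieldConfig) : FieldConfig := fun x =>
  ((ψ x).1, fun μ => (ψ x).2 μ + partialDeriv μ χ x)

/-! ### Jets, Lagrangians and field equations -/

/-- The values of a field and of its derivatives up to order `k` at one point. -/
abbrev Jet (k : ℕ) : Type :=
  ∀ i : Fin (k + 1), ContinuousMultilinearMap ℝ (fun _ : Fin (i : ℕ) => Event) FieldValue

/-- The jet of order `k` of the configuration `ψ` at `x`. -/
def jet (k : ℕ) (ψ : FieldConfig) (x : Event) : Jet k := fun i => iteratedFDeriv ℝ (i : ℕ) ψ x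

/-- The field value contained in a jet. -/
def jetValue {k : ℕ} (j : Jet k) : FieldValue := j 0 (fun _ => 0)

/-- The jets whose metric has Lorentzian signature. -/
def lorentzianJets (k : ℕ) : Set (Jet k) := {j | IsLorentzian (jetValue j)}

/-- `ψ` is a smooth configuration with Lorentzian metric on `V`. -/
def IsSmoothConfig (ψ : FieldConfig) (V : Set Event) : Prop :=
  ContDiffOn ℝ ∞ ψ V ∧ ∀ x ∈ V, IsLorentzian (ψ x)

/-- Diffeomorphism covariance of the Lagrangian density `x ↦ L (jet k ψ x)`: it is a scalar density
(the coefficient of `d⁴x`) built from `(g, A)` in the same way in all coordinate systems.  The maps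
are the diffeomorphisms `Φ : V → Φ(V)` between open sets, and only the orientation-preserving ones
are used, so that parity-violating Lagrangians are not excluded. -/
def IsDiffeoCovariant {k : ℕ} (L : Jet k → ℝ) : Prop :=
  ∀ (V : Set Event) (Φ : Event → Event), IsOpen V → ContDiffOn ℝ ∞ Φ V → InjOn Φ V →
    (∀ x ∈ V, 0 < (fderiv ℝ Φ x).det) →
    ∀ ψ : FieldConfig, IsSmoothConfig ψ (Φ '' V) →
      ∀ x ∈ V, L (jet k (pullback Φ ψ) x) = (fderiv ℝ Φ x).det * L (jet k ψ (Φ x))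

/-- Invariance of the Lagrangian under `A ↦ A + dχ`. -/
def IsMaxwellInvariant {k : ℕ} (L : Jet k → ℝ) : Prop :=
  ∀ (V : Set Event) (χ : Event → ℝ), IsOpen V → ContDiffOn ℝ ∞ χ V →
    ∀ ψ : FieldConfig, IsSmoothConfig ψ V →
      ∀ x ∈ V, L (jet k (gaugeTransform χ ψ) x) = L (jet k ψ x)

/-- The variation `δg^{μν} = - g^{μρ} g^{νσ} δg_{ρσ}` of the inverse metric of `v` produced by the
variation `w` of the fields. -/
def invMetricVariation (v w : FieldValue) (μ ν : Fin 4) : ℝ :=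
  -∑ ρ, ∑ σ, invMetric v μ ρ * invMetric v ν σ * w.1 s(ρ, σ)

/-- `E = (E_{μν}, E^μ)` are the field equation operators of the action `S = ∫ L d⁴x`, that is
`E_{μν} = (-g)^{-1/2} δS/δg^{μν}` and `E^μ = - (-g)^{-1/2} δS/δA_μ`: for every variation `δ` with
compact support,
`d/ds S[ψ + s δ] = ∫ √(-g) (E_{μν} δg^{μν} - E^μ δA_μ) d⁴x` at `s = 0`.
With this sign of `E^μ`, the Einstein-Maxwell Lagrangian `√(-g) (R - F_{ab} F^{ab})`,
`F = dA`, has `E^b = - 4 ∇_a F^{ab}`, which is `16 π` times the current. -/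
def IsFieldEquation {k : ℕ} (L : Jet k → ℝ) (E : Jet 2 → FieldValue) : Prop :=
  ∀ (V : Set Event) (ψ δ : FieldConfig), IsOpen V → IsSmoothConfig ψ V →
    ContDiff ℝ ∞ δ → HasCompactSupport δ → tsupport δ ⊆ V →
    HasDerivAt (fun s : ℝ => ∫ x in tsupport δ, L (jet k (ψ + s • δ) x))
      (∫ x in tsupport δ, volDensity (ψ x) *
        ((∑ μ, ∑ ν, (E (jet 2 ψ x)).1 s(μ, ν) * invMetricVariation (ψ x) (δ x) μ ν) -
          ∑ μ, (E (jet 2 ψ x)).2 μ * (δ x).2 μ)) 0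

/-- A vector-tensor theory: a diffeomorphism-covariant local Lagrangian of some finite order in
`(g_{ab}, A_a)` whose field equations are of second order. -/
structure VectorTensorTheory where
  /-- number of derivatives in the Lagrangian -/
  order : ℕ
  /-- the Lagrangian density, as a function of the fields and their derivatives -/
  lagrangian : Jet order → ℝ
  lagrangian_smooth : ContDiffOn ℝ ∞ lagrangian (lorentzianJets order)
  covariant : IsDiffeoCovariant lagrangian
  /-- the second-order field equation operators `(E_{ab}, E^a)` -/
  fieldEq : Jet 2 → FieldValue
  fieldEq_smooth : ContDiffOn ℝ ∞ fieldEq (lorentzianJets 2)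
  isFieldEquation : IsFieldEquation lagrangian fieldEq

/-- The theory has the gauge symmetry `A → A + ∇χ`. -/
def VectorTensorTheory.HasMaxwellSymmetry (T : VectorTensorTheory) : Prop :=
  IsMaxwellInvariant T.lagrangian

/-! ### One-parameter families containing a shrinking body -/

/-- The event with time `t` and spatial coordinates `y`. -/
def event (t : ℝ) (y : Fin 3 → ℝ) : Event := Fin.cons t y

/-- The coordinate radius `r = (∑ (x^i)²)^{1/2}`. -/
def radius (x : Event) : ℝ := Real.sqrt (∑ i : Fin 3, x i.succ ^ 2)

/-- The worldline `x^i = 0`, parametrized by coordinate time. -/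
def worldline (t : ℝ) : Event := event t 0

/-- The times at which the worldline lies in `U`. -/
def lifetime (U : Set Event) : Set ℝ := {t | worldline t ∈ U}

/-- The map `(t̄, x̄^i) ↦ (t₀ + l t̄, l x̄^i)` from scaled to original coordinates. -/
def scaling (t₀ l : ℝ) (x : Event) : Event := worldline t₀ + l • x

/-- The components, in the scaled coordinates, of the scaled fields `ḡ = l⁻² g`, `Ā = l⁻¹ A`. -/
def scaledField (t₀ l : ℝ) (ψ : FieldConfig) : FieldConfig := fun x =>
  ((l ^ 2)⁻¹ • (pullback (scaling t₀ l) ψ x).1, l⁻¹ • (pullback (scaling t₀ l) ψ x).2)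

/-- Smoothness of the components of `ψ l` as functions of `(α, β) = (r, l/r)` at `(0,0)`, locally
uniformly in the time `t` and the direction `n`.  (Only `α, β ≥ 0` occur; `F t n` is the component
function in the new variables, extended to `α = 0`.) -/
def IsUniformlySmooth (U : Set Event) (ψ : ℝ → FieldConfig) : Prop :=
  ∀ t₀ ∈ lifetime U, ∃ δ > 0, ∃ F : ℝ → (Fin 3 → ℝ) → ℝ × ℝ → FieldValue,
    (∀ t, |t - t₀| < δ → ∀ n : Fin 3 → ℝ, ∑ i, n i ^ 2 = 1 →
      ContDiffOn ℝ ∞ (F t n) (Ico 0 δ ×ˢ Ico 0 δ) ∧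
      ∀ r l : ℝ, 0 < r → r < δ → 0 ≤ l → l < δ * r → F t n (r, l / r) = ψ l (event t (r • n))) ∧
    ∀ k : ℕ, ∃ C : ℝ, ∀ t, |t - t₀| < δ → ∀ n : Fin 3 → ℝ, ∑ i, n i ^ 2 = 1 →
      ∀ p ∈ Ico 0 δ ×ˢ Ico 0 δ,
        ‖iteratedFDerivWithin ℝ k (F t n) (Ico 0 δ ×ˢ Ico 0 δ) p‖ ≤ C

/-- A one-parameter family `ψ l = (g_{μν}(l), A_μ(l))`, `0 ≤ l < l₀`, of solutions of the theory on
`{x ∈ U | r > R l}`, containing a body that shrinks to the worldline `x^i = 0` as `l → 0`. -/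
structure IsSmallBodyFamily (T : VectorTensorTheory) (U : Set Event) (ψ : ℝ → FieldConfig)
    (l₀ R : ℝ) : Prop where
  isOpen : IsOpen U
  /-- the worldline in `U` is a single curve -/
  connected : (lifetime U).OrdConnected
  l₀_pos : 0 < l₀
  R_pos : 0 < R
  /-- (i): smoothness in `(l, t, x^i)` -/
  smooth : ContDiffOn ℝ ∞ (fun p : ℝ × Event => ψ p.1 p.2)
    {p | 0 ≤ p.1 ∧ p.1 < l₀ ∧ p.2 ∈ U ∧ R * p.1 < radius p.2}
  lorentzian : ∀ l, 0 ≤ l → l < l₀ → ∀ x ∈ U, R * l < radius x → IsLorentzian (ψ l x)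
  /-- (i): field equations -/
  solves : ∀ l, 0 ≤ l → l < l₀ → ∀ x ∈ U, R * l < radius x → T.fieldEq (jet 2 (ψ l) x) = 0
  /-- (i): the background is smooth, also at the worldline, -/
  background : IsSmoothConfig (ψ 0) U
  /-- and the worldline is timelike -/
  timelike : ∀ t ∈ lifetime U, metric (ψ 0 (worldline t)) 0 0 < 0
  /-- (ii): existence of the scaled limit -/
  scaled : ∀ t₀ ∈ lifetime U, ∃ G : ℝ × Event → FieldValue,
    ContDiffOn ℝ ∞ G {p | 0 ≤ p.1 ∧ p.1 < l₀ ∧ scaling t₀ p.1 p.2 ∈ U ∧ R < radius p.2} ∧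
    ∀ l, 0 < l → l < l₀ → ∀ x, scaling t₀ l x ∈ U → R < radius x →
      G (l, x) = scaledField t₀ l (ψ l) x
  /-- (iii): uniformity -/
  uniform : IsUniformlySmooth U ψ

/-- The first-order perturbation `(g⁽¹⁾, A⁽¹⁾) = ∂ψ/∂l` at `l = 0`. -/
def perturbation (ψ : ℝ → FieldConfig) : FieldConfig := fun x =>
  derivWithin (fun l => ψ l x) (Ici 0) 0

/-- The linearization `(E_{μν}⁽¹⁾, E⁽¹⁾^μ)[φ]` of the field equation operators about `ψ₀`. -/
def linearizedFieldEq (T : VectorTensorTheory) (ψ₀ φ : FieldConfig) (x : Event) : FieldValue :=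
  fderiv ℝ T.fieldEq (jet 2 ψ₀ x) (jet 2 φ x)

/-! ### Distributions -/

/-- `f` is a test function (or test field) on `U`. -/
def IsTest {Y : Type} [NormedAddCommGroup Y] [NormedSpace ℝ Y] (U : Set Event) (f : Event → Y) :
    Prop :=
  ContDiff ℝ ∞ f ∧ HasCompactSupport f ∧ tsupport f ⊆ U

/-- `F = P† f` for the linear differential operator `P` on `U`, the adjoint being taken with respect
to the volume element `vol d⁴x`.  Such a continuous `F` is unique. -/
def IsAdjointImage (U : Set Event) (vol : Event → ℝ) (P : FieldConfig → Event → ℝ)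
    (f : Event → ℝ) (F : Event → FieldValue →L[ℝ] ℝ) : Prop :=
  Continuous F ∧ HasCompactSupport F ∧ tsupport F ⊆ U ∧
    ∀ φ : FieldConfig, IsTest U φ →
      ∫ x in U, vol x * (f x * P φ x) = ∫ x in U, vol x * F x (φ x)

/-- The distribution `P φ`, given by `(P φ)[f] = ∫ vol d⁴x (P† f) φ`, exists and is equal to `D` on
`U`. -/
def DistributionalEq (U : Set Event) (vol : Event → ℝ) (P : FieldConfig → Event → ℝ)
    (φ : FieldConfig) (D : (Event → ℝ) → ℝ) : Prop :=
  ∀ f : Event → ℝ, IsTest U f → ∃ F : Event → FieldValue →L[ℝ] ℝ,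
    IsAdjointImage U vol P f F ∧ IntegrableOn (fun x => vol x * F x (φ x)) U ∧
      ∫ x in U, vol x * F x (φ x) = D f

/-! ### Geometry along the worldline in the background `ψ₀` -/

/-- `dτ/dt` along the worldline, `τ` being proper time. -/
def properTimeRate (ψ₀ : FieldConfig) (t : ℝ) : ℝ :=
  Real.sqrt (-(metric (ψ₀ (worldline t)) 0 0))

/-- The distribution `∫_γ c δ₄(x, z(τ)) dτ`, where `δ₄` is the invariant delta function, so that its
value on the test function `f` is `∫_γ c f dτ`. -/
def worldlineSource (U : Set Event) (ψ₀ : FieldConfig) (c : ℝ → ℝ) (f : Event → ℝ) : ℝ :=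
  ∫ t in lifetime U, c t * f (worldline t) * properTimeRate ψ₀ t

/-- The four-velocity `u^μ = dz^μ/dτ`. -/
def velocity (ψ₀ : FieldConfig) (t : ℝ) (μ : Fin 4) : ℝ :=
  (properTimeRate ψ₀ t)⁻¹ * coordVec 0 μ

/-- `u_μ = g_{μν} u^ν`. -/
def velocityLow (ψ₀ : FieldConfig) (t : ℝ) (μ : Fin 4) : ℝ :=
  ∑ ν, metric (ψ₀ (worldline t)) μ ν * velocity ψ₀ t ν

/-- The Christoffel symbol `Γ^ρ_{μν}` of the metric of `ψ₀`. -/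
def christoffel (ψ₀ : FieldConfig) (x : Event) (ρ μ ν : Fin 4) : ℝ :=
  (1 / 2) * ∑ σ, invMetric (ψ₀ x) ρ σ *
    (partialDeriv μ (fun y => metric (ψ₀ y) ν σ) x + partialDeriv ν (fun y => metric (ψ₀ y) μ σ) x -
      partialDeriv σ (fun y => metric (ψ₀ y) μ ν) x)

/-- `∇_μ A_ν`. -/
def covDerivA (ψ₀ : FieldConfig) (x : Event) (μ ν : Fin 4) : ℝ :=
  partialDeriv μ (fun y => (ψ₀ y).2 ν) x - ∑ ρ, christoffel ψ₀ x ρ μ ν * (ψ₀ x).2 ρ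

/-- `∇_{[μ} A_{ν]} = (∇_μ A_ν - ∇_ν A_μ) / 2`. -/
def antisymCovDerivA (ψ₀ : FieldConfig) (x : Event) (μ ν : Fin 4) : ℝ :=
  (1 / 2) * (covDerivA ψ₀ x μ ν - covDerivA ψ₀ x ν μ)

/-- The acceleration `u^ν ∇_ν u_μ = du_μ/dτ - Γ^ρ_{νμ} u^ν u_ρ` of the worldline. -/
def accelerationLow (ψ₀ : FieldConfig) (t : ℝ) (μ : Fin 4) : ℝ :=
  (properTimeRate ψ₀ t)⁻¹ * deriv (fun s => velocityLow ψ₀ s μ) t -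
    ∑ ν, ∑ ρ, christoffel ψ₀ (worldline t) ρ ν μ * velocity ψ₀ t ν * velocityLow ψ₀ t ρ

end SmallBody

end

open Filter Topology

noncomputable section

namespace SmallBody

/-! ### Lorentzian component arrays -/

/-! Write `φ` for the perturbation and `γ` for the worldline. Since the fields are smooth functions
of `r` and `l/r`, the derivative in `l` at `l = 0` is `1/r` times a bounded function, so `φ` is
smooth off `γ` and `O(1/r)` near it (`IsSmallBodyFamily.isSingularField`). In particular `φ` is
locally integrable, so the adjoint of the linearized operator can be paired with it, and the
resulting distribution is supported on `γ` because the linearized equations hold off `γ`.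

The analytic core is `IsSingularField.integral_adjJet_eq_zero`: a second-order operator applied to
an `O(1/r)` field produces no transverse derivatives of the delta function. If the coefficients
vanish on `γ`, multiplying them by a cutoff of width `1/n` keeps the adjoint coefficients `O(1/r)`
uniformly in `n`. The integrand is then dominated by `1/r²`, integrable in three transverse
dimensions, and it tends to zero. Hence each component of the source is a functional of the values
of the test function on `γ` alone (`isLineFunctional_source`).

The algebraic core is the pair of Noether identities. Gauge invariance and covariance of the
Lagrangian give off-shell integral identities between the field equations. About a background
solution these linearize to identities for the linearized operator, since every term carrying an
undifferentiated field equation drops out (`VectorTensorTheory.linearized_identity`). They say that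
an adjoint coefficient vanishes, so they also hold for the singular `φ`
(`source_eq_zero_of_identity`). `IsConservedSource` collects what remains: line functionals `T_{μν}`
and `J^μ` obeying both identities. The Lie derivatives are those of the background, so no self-field
enters the equation of motion.

The conclusion comes from a choice of test fields. The gauge parameter `x^i f` and the vector field
`x^i f ∂_ρ` vanish on `γ` while their gradients do not; they give `J^i = 0` and `T^i_ρ = 0`, so that
`T_{μν} = g_{μ0} g_{ν0} T^{00}` (`IsConservedSource.tensor_eq`). The gauge identity for a general
parameter makes the charge constant, the vector field along the four-velocity makes the mass
constant, and `k ∂_μ` gives the balance of momentum, which is the Lorentz force law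
(`IsConservedSource.force_law`). -/

theorem IsLorentzian.det_neg {v : FieldValue} (h : IsLorentzian v) : (metric v).det < 0 := by
  obtain ⟨P, hP, h⟩ := h
  have h2 := congrArg Matrix.det h
  rw [Matrix.det_mul, Matrix.det_mul, Matrix.det_transpose, Matrix.det_diagonal] at h2
  simp [Fin.prod_univ_four] at h2
  have h0 : P.det ≠ 0 := hP.ne_zero
  have : 0 < P.det ^ 2 := by positivity
  nlinarith

/-- The components of `Pᵀ diag(-1,1,1,1) P`. -/
def minkowskiPullback (P : Fin 4 → Fin 4 → ℝ) : SymTensor :=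
  Sym2.lift ⟨fun μ ν => ∑ ρ, (![-1, 1, 1, 1] : Fin 4 → ℝ) ρ * (P ρ μ * P ρ ν), by
    intro μ ν
    simp only [mul_comm (P _ μ)]⟩

theorem minkowskiPullback_mk (P : Fin 4 → Fin 4 → ℝ) (μ ν : Fin 4) :
    minkowskiPullback P s(μ, ν) = ∑ ρ, (![-1, 1, 1, 1] : Fin 4 → ℝ) ρ * (P ρ μ * P ρ ν) := rfl

theorem minkowskiPullback_eq_iff (P : Matrix (Fin 4) (Fin 4) ℝ) (v : FieldValue) :
    minkowskiPullback (fun μ ν => P μ ν) = v.1 ↔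
      P.transpose * Matrix.diagonal ![-1, 1, 1, 1] * P = metric v := by
  have h0 : ∀ μ ν, (P.transpose * Matrix.diagonal ![-1, 1, 1, 1] * P : Matrix (Fin 4) (Fin 4) ℝ) μ ν =
      minkowskiPullback (fun μ ν => P μ ν) s(μ, ν) := by
    intro μ ν
    rw [minkowskiPullback_mk, Matrix.mul_apply]
    refine Finset.sum_congr rfl fun ρ _ => ?_
    rw [Matrix.mul_diagonal, Matrix.transpose_apply]
    ring
  constructor
  · intro h
    ext μ ν
    rw [h0, h, metric, Matrix.of_apply]
  · intro h
    funext e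
    induction e using Sym2.ind with
    | _ μ ν => rw [← h0, h, metric, Matrix.of_apply]

/-- Inverting the congruence exhibits the Lorentzian forms as the image of the invertible matrices
under a polynomial map, the form suited to an open mapping argument. -/
theorem isLorentzian_iff {v : FieldValue} :
    IsLorentzian v ↔ ∃ P : Fin 4 → Fin 4 → ℝ, (Matrix.of P).det ≠ 0 ∧ minkowskiPullback P = v.1 := by
  constructor
  · rintro ⟨P, hP, h⟩
    refine ⟨fun μ ν => P⁻¹ μ ν, ?_, (minkowskiPullback_eq_iff P⁻¹ v).2 ?_⟩
    · exact (Matrix.isUnit_nonsing_inv_det_iff.2 hP).ne_zero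
    · rw [← h, Matrix.transpose_nonsing_inv]
      have hPt : IsUnit P.transpose.det := by rwa [Matrix.det_transpose]
      rw [Matrix.mul_assoc, Matrix.mul_assoc, Matrix.mul_nonsing_inv _ hP, Matrix.mul_one,
        ← Matrix.mul_assoc, Matrix.nonsing_inv_mul _ hPt, Matrix.one_mul]
  · rintro ⟨Q, hP, h⟩
    obtain ⟨P, rfl⟩ : ∃ P : Matrix (Fin 4) (Fin 4) ℝ, Q = fun μ ν => P μ ν := ⟨Matrix.of Q, rfl⟩
    have h := (minkowskiPullback_eq_iff P v).1 h
    have hP : IsUnit P.det := isUnit_iff_ne_zero.2 hP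
    have hPt : IsUnit P.transpose.det := by rwa [Matrix.det_transpose]
    refine ⟨P⁻¹, Matrix.isUnit_nonsing_inv_det_iff.2 hP, ?_⟩
    rw [← h, Matrix.transpose_nonsing_inv, Matrix.mul_assoc, Matrix.mul_assoc,
      Matrix.mul_nonsing_inv _ hP, Matrix.mul_one, ← Matrix.mul_assoc,
      Matrix.nonsing_inv_mul _ hPt, Matrix.one_mul]

/-- The map `P ↦ Pᵀ η P` is a submersion at invertible `P`, hence open there. Openness of the
Lorentzian jets, on which the Lagrangian and the field equations are smooth, follows from this. -/
theorem isOpen_isLorentzian : IsOpen {v : FieldValue | IsLorentzian v} := by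
  rw [isOpen_iff_mem_nhds]
  intro v hv
  obtain ⟨P, hP, hPv⟩ := isLorentzian_iff.1 hv
  set η : Fin 4 → ℝ := ![-1, 1, 1, 1] with hη
  have hηη : ∀ ρ, η ρ * η ρ = 1 := by
    intro ρ; fin_cases ρ <;> simp [hη]
  let pr : Fin 4 → Fin 4 → ((Fin 4 → Fin 4 → ℝ) →L[ℝ] ℝ) := fun ρ μ =>
    (ContinuousLinearMap.proj μ).comp (ContinuousLinearMap.proj (R := ℝ) (φ := fun _ : Fin 4 => Fin 4 → ℝ) ρ)
  let L : Fin 4 → Fin 4 → ((Fin 4 → Fin 4 → ℝ) →L[ℝ] ℝ) := fun μ ν =>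
    ∑ ρ, η ρ • (P ρ μ • pr ρ ν + P ρ ν • pr ρ μ)
  let D : (Fin 4 → Fin 4 → ℝ) →L[ℝ] SymTensor := ContinuousLinearMap.pi
    (Sym2.lift ⟨L, fun μ ν => by simp only [L, add_comm]⟩)
  have hD : HasStrictFDerivAt minkowskiPullback D P := by
    rw [hasStrictFDerivAt_pi']
    intro e
    induction e using Sym2.ind with
    | _ μ ν =>
      have h1 : ∀ ρ μ, HasStrictFDerivAt (fun Q : Fin 4 → Fin 4 → ℝ => Q ρ μ) (pr ρ μ) P :=
        fun ρ μ => (pr ρ μ).hasStrictFDerivAt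
      have h2 := HasStrictFDerivAt.fun_sum (u := Finset.univ) fun ρ _ =>
        ((h1 ρ μ).mul (h1 ρ ν)).const_mul (η ρ)
      exact h2
  have hsurj : D.range = ⊤ := by
    rw [LinearMap.range_eq_top]
    intro S
    set A : Matrix (Fin 4) (Fin 4) ℝ := Matrix.of P
    have hA : IsUnit A.det := isUnit_iff_ne_zero.2 hP
    have hAt : IsUnit A.transpose.det := by rwa [Matrix.det_transpose]
    set M : Matrix (Fin 4) (Fin 4) ℝ := Matrix.of fun μ ν => S s(μ, ν)
    set X : Matrix (Fin 4) (Fin 4) ℝ := A.transpose⁻¹ * M with hX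
    have hX2 : A.transpose * X = M := by
      rw [hX, ← Matrix.mul_assoc, Matrix.mul_nonsing_inv _ hAt, Matrix.one_mul]
    -- The preimage is `Q = ½ η (Pᵀ)⁻¹ M`: then `Pᵀ η Q = M / 2`, and symmetrization restores the
    -- symmetric matrix `M`.
    refine ⟨fun ρ ν => 2⁻¹ * (η ρ * X ρ ν), ?_⟩
    funext e
    induction e using Sym2.ind with
    | _ μ ν =>
      have e1 : ∀ μ ν, ∑ ρ, P ρ μ * X ρ ν = S s(μ, ν) := fun μ ν =>
        congrFun (congrFun hX2 μ) ν
      change (∑ ρ, η ρ • (P ρ μ • pr ρ ν + P ρ ν • pr ρ μ)) (fun ρ ν => 2⁻¹ * (η ρ * X ρ ν)) = _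
      rw [_root_.sum_apply]
      have : ∀ ρ, (η ρ • (P ρ μ • pr ρ ν + P ρ ν • pr ρ μ)) (fun ρ ν => 2⁻¹ * (η ρ * X ρ ν))
          = 2⁻¹ * (P ρ μ * X ρ ν) + 2⁻¹ * (P ρ ν * X ρ μ) := by
        intro ρ
        simp only [_root_.smul_apply, _root_.add_apply, smul_eq_mul]
        change η ρ * (P ρ μ * (2⁻¹ * (η ρ * X ρ ν)) + P ρ ν * (2⁻¹ * (η ρ * X ρ μ))) = _
        linear_combination (2⁻¹ * (P ρ μ * X ρ ν) + 2⁻¹ * (P ρ ν * X ρ μ)) * hηη ρ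
      simp only [this]
      rw [Finset.sum_add_distrib, ← Finset.mul_sum, ← Finset.mul_sum, e1, e1, Sym2.eq_swap]
      ring
  have hmap := hD.map_nhds_eq_of_surj hsurj
  have hdet : ∀ᶠ Q in 𝓝 P, (Matrix.of Q).det ≠ 0 := by
    have : Continuous fun Q : Fin 4 → Fin 4 → ℝ => (Matrix.of Q).det := by
      apply Continuous.matrix_det
      exact continuous_id
    exact this.continuousAt.eventually_ne hP
  have h1 : ∀ᶠ S in 𝓝 (minkowskiPullback P), ∃ Q : Fin 4 → Fin 4 → ℝ,
      (Matrix.of Q).det ≠ 0 ∧ minkowskiPullback Q = S := by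
    rw [← hmap, eventually_map]
    filter_upwards [hdet] with Q hQ using ⟨Q, hQ, rfl⟩
  rw [hPv] at h1
  filter_upwards [(continuous_fst.tendsto v).eventually h1] with w hw
  exact isLorentzian_iff.2 hw

theorem metric_symm (v : FieldValue) (μ ν : Fin 4) : metric v μ ν = metric v ν μ := by
  simp only [metric, Matrix.of_apply, Sym2.eq_swap]

theorem metric_apply (v : FieldValue) (μ ν : Fin 4) : metric v μ ν = v.1 s(μ, ν) := rfl

theorem invMetric_symm (v : FieldValue) (μ ν : Fin 4) : invMetric v μ ν = invMetric v ν μ := by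
  have : (metric v).transpose = metric v := by
    ext μ ν
    exact metric_symm v ν μ
  have h := Matrix.transpose_nonsing_inv (metric v)
  rw [this] at h
  exact congrFun (congrFun h ν) μ

theorem IsLorentzian.metric_mul_inv {v : FieldValue} (h : IsLorentzian v) (μ ν : Fin 4) :
    ∑ ρ, metric v μ ρ * invMetric v ρ ν = if μ = ν then 1 else 0 := by
  have := Matrix.mul_nonsing_inv (metric v) (isUnit_iff_ne_zero.2 h.det_neg.ne)
  have := congrFun (congrFun this μ) ν
  rwa [Matrix.mul_apply, Matrix.one_apply] at this

theorem IsLorentzian.inv_mul_metric {v : FieldValue} (h : IsLorentzian v) (μ ν : Fin 4) :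
    ∑ ρ, invMetric v μ ρ * metric v ρ ν = if μ = ν then 1 else 0 := by
  have := Matrix.nonsing_inv_mul (metric v) (isUnit_iff_ne_zero.2 h.det_neg.ne)
  have := congrFun (congrFun this μ) ν
  rwa [Matrix.mul_apply, Matrix.one_apply] at this

theorem contDiff_metric_apply (μ ν : Fin 4) : ContDiff ℝ ∞ fun v : FieldValue => metric v μ ν := by
  simp only [metric_apply]
  fun_prop

theorem contDiff_det_metric : ContDiff ℝ ∞ fun v : FieldValue => (metric v).det := by
  simp only [Matrix.det_apply]
  refine ContDiff.sum fun σ _ => ContDiff.const_smul _ ?_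
  exact contDiff_prod fun i _ => contDiff_metric_apply _ _

theorem contDiffAt_volDensity {v : FieldValue} (h : IsLorentzian v) :
    ContDiffAt ℝ ∞ volDensity v := by
  refine ContDiffAt.sqrt ?_ (by have := h.det_neg; simp [this.ne])
  exact contDiff_det_metric.contDiffAt.neg

theorem IsLorentzian.volDensity_pos {v : FieldValue} (h : IsLorentzian v) : 0 < volDensity v :=
  Real.sqrt_pos.2 (by have := h.det_neg; linarith)

theorem contDiffAt_invMetric {v : FieldValue} (h : IsLorentzian v) (μ ν : Fin 4) :
    ContDiffAt ℝ ∞ (fun v => invMetric v μ ν) v := by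
  have h1 : (fun v => invMetric v μ ν) = fun v => ((metric v).det)⁻¹ * (metric v).adjugate μ ν := by
    funext v
    simp [invMetric, Matrix.inv_def]
  rw [h1]
  refine ContDiffAt.mul (contDiff_det_metric.contDiffAt.inv h.det_neg.ne) ?_
  simp only [Matrix.adjugate_apply, Matrix.det_apply]
  refine (ContDiff.sum fun σ _ => ContDiff.const_smul _ ?_).contDiffAt
  refine contDiff_prod fun i _ => ?_
  by_cases hi : σ i = ν
  · subst hi
    simpa using contDiff_const
  · simpa [Matrix.updateRow_ne hi] using contDiff_metric_apply _ _

/-! ### The pairing of field equations with variations -/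

/-- The evaluation of the component `E_e` of a pair `(E_{μν}, E^μ)`. -/
def tensorEv (e : Sym2 (Fin 4)) : FieldValue →L[ℝ] ℝ :=
  (ContinuousLinearMap.proj e).comp (ContinuousLinearMap.fst ℝ SymTensor (Fin 4 → ℝ))

/-- The evaluation of the component `E^μ` of a pair `(E_{μν}, E^μ)`. -/
def vectorEv (μ : Fin 4) : FieldValue →L[ℝ] ℝ :=
  (ContinuousLinearMap.proj μ).comp (ContinuousLinearMap.snd ℝ SymTensor (Fin 4 → ℝ))

@[simp] theorem tensorEv_apply (e : Sym2 (Fin 4)) (v : FieldValue) : tensorEv e v = v.1 e := rfl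
@[simp] theorem vectorEv_apply (μ : Fin 4) (v : FieldValue) : vectorEv μ v = v.2 μ := rfl

/-- The functional `E ↦ E_{μν} δg^{μν} - E^μ δA_μ`, the variation being `w`. -/
def pairing (v w : FieldValue) : FieldValue →L[ℝ] ℝ :=
  (∑ μ, ∑ ν, invMetricVariation v w μ ν • tensorEv s(μ, ν)) - ∑ μ, w.2 μ • vectorEv μ

theorem pairing_apply (v w E : FieldValue) : pairing v w E =
    (∑ μ, ∑ ν, E.1 s(μ, ν) * invMetricVariation v w μ ν) - ∑ μ, E.2 μ * w.2 μ := by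
  simp only [pairing, _root_.sub_apply, _root_.sum_apply,
    _root_.smul_apply, tensorEv_apply, vectorEv_apply, smul_eq_mul]
  simp only [mul_comm]

theorem contDiffAt_pairing {v : FieldValue} (h : IsLorentzian v) (w : FieldValue) :
    ContDiffAt ℝ ∞ (fun p : FieldValue × FieldValue => pairing p.1 p.2) (v, w) := by
  unfold pairing invMetricVariation
  have hi : ∀ μ ν, ContDiffAt ℝ ∞ (fun p : FieldValue × FieldValue => invMetric p.1 μ ν) (v, w) :=
    fun μ ν => (contDiffAt_invMetric h μ ν).comp (v, w) contDiffAt_fst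
  have h2 : ∀ e, ContDiffAt ℝ ∞ (fun p : FieldValue × FieldValue => p.2.1 e) (v, w) := by
    intro e; fun_prop
  have h3 : ∀ e, ContDiffAt ℝ ∞ (fun p : FieldValue × FieldValue => p.2.2 e) (v, w) := by
    intro e; fun_prop
  refine ContDiffAt.sub ?_ ?_
  · refine ContDiffAt.sum fun μ _ => ContDiffAt.sum fun ν _ => ContDiffAt.fun_smul ?_ contDiffAt_const
    refine ContDiffAt.neg (ContDiffAt.sum fun ρ _ => ContDiffAt.sum fun σ _ => ?_)
    exact ((hi _ _).mul (hi _ _)).mul (h2 _)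
  · exact ContDiffAt.sum fun μ _ => ContDiffAt.fun_smul (h3 _) contDiffAt_const

theorem pairing_smul (v w : FieldValue) (c : ℝ) : pairing v (c • w) = c • pairing v w := by
  refine ContinuousLinearMap.ext fun E => ?_
  simp only [pairing_apply, _root_.smul_apply, invMetricVariation, Prod.smul_fst,
    Prod.smul_snd, Pi.smul_apply, smul_eq_mul, mul_sub, Finset.mul_sum, mul_neg]
  congr 1
  · refine Finset.sum_congr rfl fun μ _ => Finset.sum_congr rfl fun ν _ => ?_
    rw [neg_inj]
    refine Finset.sum_congr rfl fun ρ _ => Finset.sum_congr rfl fun σ _ => ?_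
    ring
  · refine Finset.sum_congr rfl fun μ _ => ?_
    ring

/-! ### Jets -/

/-- The value of a jet, as a continuous linear map. -/
def jetValueL (k : ℕ) : Jet k →L[ℝ] FieldValue :=
  (ContinuousMultilinearMap.apply ℝ (fun _ : Fin ((0 : Fin (k + 1)) : ℕ) => Event) FieldValue
    (fun _ => 0)).comp (ContinuousLinearMap.proj 0)

theorem isOpen_lorentzianJets (k : ℕ) : IsOpen (lorentzianJets k) :=
  isOpen_isLorentzian.preimage (jetValueL k).continuous

theorem jet_congr (k : ℕ) {ψ φ : FieldConfig} {x : Event} (h : ψ =ᶠ[𝓝 x] φ) :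
    jet k ψ x = jet k φ x :=
  funext fun _ => (h.iteratedFDeriv ℝ _).eq_of_nhds

theorem contDiffAt_jet (k : ℕ) {ψ : FieldConfig} {x : Event} (h : ContDiffAt ℝ ∞ ψ x) :
    ContDiffAt ℝ ∞ (jet k ψ) x := by
  rw [contDiffAt_pi]
  intro i
  exact h.iteratedFDeriv_right (m := ∞) (i := i) le_rfl

theorem jet_add_smul (k : ℕ) {ψ φ : FieldConfig} {x : Event} (hψ : ContDiffAt ℝ ∞ ψ x)
    (hφ : ContDiffAt ℝ ∞ φ x) (s : ℝ) :
    jet k (ψ + s • φ) x = jet k ψ x + s • jet k φ x := by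
  funext i
  have h1 : ContDiffAt ℝ (i : ℕ) ψ x := hψ.of_le (by exact_mod_cast le_top)
  have h2 : ContDiffAt ℝ (i : ℕ) φ x := hφ.of_le (by exact_mod_cast le_top)
  change iteratedFDeriv ℝ i (ψ + s • φ) x = iteratedFDeriv ℝ i ψ x + s • iteratedFDeriv ℝ i φ x
  have h3 : ContDiffAt ℝ (i : ℕ) (s • φ) x := h2.const_smul s
  rw [iteratedFDeriv_add_apply h1 h3, iteratedFDeriv_const_smul_apply h2]

theorem jet_eq_zero_of_notMem_tsupport (k : ℕ) {φ : FieldConfig} {x : Event} (h : x ∉ tsupport φ) :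
    jet k φ x = 0 := by
  rw [jet_congr k (notMem_tsupport_iff_eventuallyEq.1 h)]
  funext i
  change iteratedFDeriv ℝ i (fun _ => (0 : FieldValue)) x = 0
  rw [iteratedFDeriv_fun_zero]
  rfl

/-! ### Derivatives of one-sided families -/

section OneSided

variable {E F : Type} [NormedAddCommGroup E] [NormedSpace ℝ E] [NormedAddCommGroup F]
  [NormedSpace ℝ F]

/-- The part `0 ≤ l` of a subset of `ℝ × E`. -/
def nonnegPart (O : Set (ℝ × E)) : Set (ℝ × E) := {p | p ∈ O ∧ 0 ≤ p.1}

/-- The derivative at `l = 0` of a one-sided family. -/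
def initialDeriv (Ψ : ℝ → E → F) (x : E) : F := derivWithin (fun l => Ψ l x) (Ici 0) 0

theorem uniqueDiffOn_nonnegPart {O : Set (ℝ × E)} (hO : IsOpen O) :
    UniqueDiffOn ℝ (nonnegPart O) := by
  have h : nonnegPart O = (Ici (0 : ℝ) ×ˢ (univ : Set E)) ∩ O := by
    ext p; simp [nonnegPart, and_comm]
  rw [h]
  exact ((uniqueDiffOn_Ici 0).prod uniqueDiffOn_univ).inter hO

/-- This is the condition under which second derivatives within a set are symmetric also at the
boundary points `l = 0`. -/
theorem nonnegPart_subset_closure_interior {O : Set (ℝ × E)} (hO : IsOpen O) :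
    nonnegPart O ⊆ closure (interior (nonnegPart O)) := by
  rintro ⟨l, x⟩ ⟨hp, hl⟩
  have hsub : O ∩ {p | 0 < p.1} ⊆ interior (nonnegPart O) :=
    interior_maximal (fun p hp => ⟨hp.1, le_of_lt hp.2⟩)
      (hO.inter (isOpen_lt continuous_const continuous_fst))
  refine closure_mono hsub ?_
  have hc : Continuous fun e : ℝ => ((l + e, x) : ℝ × E) := by fun_prop
  have ht : Tendsto (fun e : ℝ => ((l + e, x) : ℝ × E)) (𝓝[>] 0) (𝓝 (l, x)) := by
    have := hc.tendsto 0
    simp only [add_zero] at this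
    exact this.mono_left nhdsWithin_le_nhds
  refine mem_closure_of_tendsto ht ?_
  filter_upwards [ht.eventually (hO.mem_nhds hp), self_mem_nhdsWithin] with e he he0
  exact ⟨he, add_pos_of_nonneg_of_pos hl he0⟩

variable {Ψ : ℝ → E → F} {O : Set (ℝ × E)}

/-- At fixed `l` the slice is open in `E`, so the derivative in `x` is an ordinary one although the
joint derivative is taken within a half-space. -/
theorem fderiv_slice (hO : IsOpen O)
    (h : ContDiffOn ℝ ∞ (fun p : ℝ × E => Ψ p.1 p.2) (nonnegPart O)) {p : ℝ × E}
    (hp : p ∈ nonnegPart O) :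
    HasFDerivAt (Ψ p.1) ((fderivWithin ℝ (fun p : ℝ × E => Ψ p.1 p.2) (nonnegPart O) p).comp
      (ContinuousLinearMap.inr ℝ ℝ E)) p.2 := by
  have h1 := ((h.differentiableOn (by simp)) p hp).hasFDerivWithinAt
  have h2 : HasFDerivAt (fun y : E => (p.1, y)) (ContinuousLinearMap.inr ℝ ℝ E) p.2 :=
    hasFDerivAt_prodMk_right _ _
  refine HasFDerivWithinAt.comp_hasFDerivAt (g := fun p : ℝ × E => Ψ p.1 p.2) (f := fun y : E => (p.1, y)) p.2 h1 h2 ?_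
  have : ∀ᶠ y in 𝓝 p.2, (p.1, y) ∈ O :=
    (Continuous.prodMk_right p.1).continuousAt.eventually (hO.mem_nhds hp.1)
  filter_upwards [this] with y hy using ⟨hy, hp.2⟩

theorem contDiffOn_fderiv_slice (hO : IsOpen O)
    (h : ContDiffOn ℝ ∞ (fun p : ℝ × E => Ψ p.1 p.2) (nonnegPart O)) :
    ContDiffOn ℝ ∞ (fun p : ℝ × E => fderiv ℝ (Ψ p.1) p.2) (nonnegPart O) := by
  have h1 := h.fderivWithin (m := ∞) (uniqueDiffOn_nonnegPart hO) le_rfl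
  have h2 := h1.clm_comp (contDiffOn_const (c := ContinuousLinearMap.inr ℝ ℝ E))
  exact h2.congr fun p hp => (fderiv_slice hO h hp).fderiv

theorem eventually_mem_nonnegPart (hO : IsOpen O) {x : E} (hx : (0, x) ∈ O) :
    ∀ᶠ l in 𝓝[Ici 0] (0 : ℝ), (l, x) ∈ nonnegPart O := by
  have : ∀ᶠ l in 𝓝 (0 : ℝ), (l, x) ∈ O :=
    (Continuous.prodMk_left x).continuousAt.eventually (hO.mem_nhds hx)
  filter_upwards [mem_nhdsWithin_of_mem_nhds this, self_mem_nhdsWithin] with l hl hl0 using ⟨hl, hl0⟩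

theorem hasDerivWithinAt_time {G : ℝ × E → F} (hO : IsOpen O) {x : E}
    (h : DifferentiableWithinAt ℝ G (nonnegPart O) (0, x)) (hx : (0, x) ∈ O) :
    HasDerivWithinAt (fun l => G (l, x)) (fderivWithin ℝ G (nonnegPart O) (0, x) (1, 0)) (Ici 0) 0 := by
  have h1 := h.hasFDerivWithinAt
  have hev := eventually_mem_nonnegPart hO hx
  have h2 : HasDerivAt (fun l : ℝ => (l, x)) ((1, 0) : ℝ × E) 0 :=
    (hasDerivAt_id (0 : ℝ)).prodMk (hasDerivAt_const _ _)
  have h3 : HasDerivWithinAt (fun l => G (l, x)) (fderivWithin ℝ G (nonnegPart O) (0, x) (1, 0))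
      {l | (l, x) ∈ nonnegPart O} 0 :=
    HasFDerivWithinAt.comp_hasDerivWithinAt (0 : ℝ) h1 h2.hasDerivWithinAt (fun l hl => hl)
  exact h3.mono_of_mem_nhdsWithin hev

theorem initialDeriv_eq (hO : IsOpen O)
    (h : ContDiffOn ℝ ∞ (fun p : ℝ × E => Ψ p.1 p.2) (nonnegPart O)) {x : E} (hx : (0, x) ∈ O) :
    initialDeriv Ψ x =
      fderivWithin ℝ (fun p : ℝ × E => Ψ p.1 p.2) (nonnegPart O) (0, x) (1, 0) :=
  (hasDerivWithinAt_time (G := fun p : ℝ × E => Ψ p.1 p.2) hO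
    ((h.differentiableOn (by simp)) _ ⟨hx, le_rfl⟩) hx).derivWithin
      (uniqueDiffOn_Ici 0 0 self_mem_Ici)

theorem hasDerivWithinAt_initialDeriv (hO : IsOpen O)
    (h : ContDiffOn ℝ ∞ (fun p : ℝ × E => Ψ p.1 p.2) (nonnegPart O)) {x : E} (hx : (0, x) ∈ O) :
    HasDerivWithinAt (fun l => Ψ l x) (initialDeriv Ψ x) (Ici 0) 0 := by
  rw [initialDeriv_eq hO h hx]
  exact hasDerivWithinAt_time (G := fun p : ℝ × E => Ψ p.1 p.2) hO
    ((h.differentiableOn (by simp)) _ ⟨hx, le_rfl⟩) hx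

theorem eventually_mem_slice (hO : IsOpen O) {x : E} (hx : (0, x) ∈ O) :
    ∀ᶠ y in 𝓝 x, ((0 : ℝ), y) ∈ O :=
  (Continuous.prodMk_right (0 : ℝ)).continuousAt.eventually (hO.mem_nhds hx)

theorem contDiffAt_initialDeriv (hO : IsOpen O)
    (h : ContDiffOn ℝ ∞ (fun p : ℝ × E => Ψ p.1 p.2) (nonnegPart O)) {x : E} (hx : (0, x) ∈ O) :
    ContDiffAt ℝ ∞ (initialDeriv Ψ) x := by
  have h1 := h.fderivWithin (m := ∞) (uniqueDiffOn_nonnegPart hO) le_rfl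
  have h2 := h1.clm_apply (contDiffOn_const (c := ((1, 0) : ℝ × E)))
  have h3 : ContDiffOn ℝ ∞ (fun y : E => fderivWithin ℝ (fun p : ℝ × E => Ψ p.1 p.2)
      (nonnegPart O) (0, y) (1, 0)) {y | ((0 : ℝ), y) ∈ O} :=
    h2.comp (contDiff_prodMk_right (0 : ℝ)).contDiffOn fun y hy => ⟨hy, le_rfl⟩
  refine ((h3 x hx).contDiffAt (eventually_mem_slice hO hx)).congr_of_eventuallyEq ?_
  filter_upwards [eventually_mem_slice hO hx] with y hy using initialDeriv_eq hO h hy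

/-- Both sides are mixed second derivatives of the joint function, so the symmetry of its second
derivative within the half-space identifies them. -/
theorem initialDeriv_fderiv (hO : IsOpen O)
    (h : ContDiffOn ℝ ∞ (fun p : ℝ × E => Ψ p.1 p.2) (nonnegPart O)) {x : E} (hx : (0, x) ∈ O) :
    initialDeriv (fun l y => fderiv ℝ (Ψ l) y) x = fderiv ℝ (initialDeriv Ψ) x := by
  set S := nonnegPart O with hS
  set G : ℝ × E → F := fun p => Ψ p.1 p.2 with hG
  have hp : ((0 : ℝ), x) ∈ S := ⟨hx, le_rfl⟩
  have hu : UniqueDiffOn ℝ S := uniqueDiffOn_nonnegPart hO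
  have h1 : ContDiffOn ℝ ∞ (fderivWithin ℝ G S) S := h.fderivWithin (m := ∞) hu le_rfl
  have hd1 : DifferentiableWithinAt ℝ (fderivWithin ℝ G S) S (0, x) :=
    (h1.differentiableOn (by simp)) _ hp
  have hsymm : IsSymmSndFDerivWithinAt ℝ G S (0, x) :=
    (h _ hp).isSymmSndFDerivWithinAt (by simp; exact WithTop.coe_le_coe.2 le_top) hu
      (nonnegPart_subset_closure_interior hO hp) hp
  set DD := fderivWithin ℝ (fderivWithin ℝ G S) S (0, x) with hDD
  have e1 : HasDerivWithinAt (fun l => fderiv ℝ (Ψ l) x)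
      ((DD (1, 0)).comp (ContinuousLinearMap.inr ℝ ℝ E)) (Ici 0) 0 := by
    have a1 := (hasDerivWithinAt_time hO hd1 hx).clm_comp
      (hasDerivWithinAt_const 0 (Ici (0:ℝ)) (ContinuousLinearMap.inr ℝ ℝ E))
    simp only [ContinuousLinearMap.comp_zero, add_zero] at a1
    refine a1.congr_of_eventuallyEq ?_ (fderiv_slice hO h hp).fderiv
    filter_upwards [eventually_mem_nonnegPart hO hx] with l hl using (fderiv_slice hO h hl).fderiv
  have e2 : HasFDerivAt (initialDeriv Ψ)
      (((ContinuousLinearMap.apply ℝ F ((1, 0) : ℝ × E)).comp DD).comp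
        (ContinuousLinearMap.inr ℝ ℝ E)) x := by
    have a1 : HasFDerivAt (fun y : E => fderivWithin ℝ G S (0, y))
        (DD.comp (ContinuousLinearMap.inr ℝ ℝ E)) x := by
      refine HasFDerivWithinAt.comp_hasFDerivAt (f := fun y : E => ((0 : ℝ), y)) x
        hd1.hasFDerivWithinAt (hasFDerivAt_prodMk_right _ _) ?_
      filter_upwards [eventually_mem_slice hO hx] with y hy using ⟨hy, le_rfl⟩
    have a2 := (ContinuousLinearMap.apply ℝ F ((1, 0) : ℝ × E)).hasFDerivAt.comp x a1
    refine a2.congr_of_eventuallyEq ?_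
    filter_upwards [eventually_mem_slice hO hx] with y hy using initialDeriv_eq hO h hy
  rw [initialDeriv, e1.derivWithin (uniqueDiffOn_Ici 0 0 self_mem_Ici), e2.fderiv]
  ext v
  exact hsymm.eq (1, 0) (0, v)

/-- Joint smoothness and the exchange of derivatives are proved together: the exchange at order `n +
1` applies `initialDeriv_fderiv` to the family of `n`-th derivatives, which must already be jointly
smooth. -/
theorem iteratedFDeriv_slice (hO : IsOpen O)
    (h : ContDiffOn ℝ ∞ (fun p : ℝ × E => Ψ p.1 p.2) (nonnegPart O)) (n : ℕ) :
    ContDiffOn ℝ ∞ (fun p : ℝ × E => iteratedFDeriv ℝ n (Ψ p.1) p.2) (nonnegPart O) ∧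
      ∀ x, (0, x) ∈ O → initialDeriv (fun l y => iteratedFDeriv ℝ n (Ψ l) y) x =
        iteratedFDeriv ℝ n (initialDeriv Ψ) x := by
  induction n with
  | zero =>
    constructor
    · simp only [iteratedFDeriv_zero_eq_comp]
      exact (continuousMultilinearCurryFin0 ℝ E F).symm.contDiff.comp_contDiffOn h
    · intro x hx
      have h1 := hasDerivWithinAt_initialDeriv hO h hx
      have h2 := ((continuousMultilinearCurryFin0 ℝ E
        F).symm.toContinuousLinearEquiv.toContinuousLinearMap).hasFDerivAt.comp_hasDerivWithinAt 0 h1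
      exact h2.derivWithin (uniqueDiffOn_Ici 0 0 self_mem_Ici)
  | succ n ih =>
    obtain ⟨ih1, ih2⟩ := ih
    have h1 := contDiffOn_fderiv_slice (Ψ := fun l y => iteratedFDeriv ℝ n (Ψ l) y) hO ih1
    constructor
    · simp only [iteratedFDeriv_succ_eq_comp_left]
      exact (continuousMultilinearCurryLeftEquiv ℝ (fun _ : Fin (n + 1) => E) F).symm.contDiff.comp_contDiffOn h1
    · intro x hx
      have h2 := hasDerivWithinAt_initialDeriv (Ψ := fun l y => fderiv ℝ (iteratedFDeriv ℝ n (Ψ l)) y)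
        hO h1 hx
      have h3 := initialDeriv_fderiv (Ψ := fun l y => iteratedFDeriv ℝ n (Ψ l) y) hO ih1 hx
      rw [h3] at h2
      have h4 : initialDeriv (fun l y => iteratedFDeriv ℝ n (Ψ l) y) =ᶠ[𝓝 x]
          iteratedFDeriv ℝ n (initialDeriv Ψ) := by
        filter_upwards [eventually_mem_slice hO hx] with y hy using ih2 y hy
      rw [h4.fderiv_eq] at h2
      have h5 := ((continuousMultilinearCurryLeftEquiv ℝ (fun _ : Fin (n + 1) => E)
        F).symm.toContinuousLinearEquiv.toContinuousLinearMap).hasFDerivAt.comp_hasDerivWithinAt 0 h2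
      exact h5.derivWithin (uniqueDiffOn_Ici 0 0 self_mem_Ici)

end OneSided

/-- Used for two families: the pullbacks `pullback (shift ξ s) ψ`, to obtain infinitesimal
covariance, and the small body family, to linearize its field equations. -/
theorem hasDerivWithinAt_jet (k : ℕ) {Ψ : ℝ → FieldConfig} {O : Set (ℝ × Event)} (hO : IsOpen O)
    (h : ContDiffOn ℝ ∞ (fun p : ℝ × Event => Ψ p.1 p.2) (nonnegPart O)) {x : Event}
    (hx : (0, x) ∈ O) :
    HasDerivWithinAt (fun l => jet k (Ψ l) x) (jet k (initialDeriv Ψ) x) (Ici 0) 0 := by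
  rw [hasDerivWithinAt_pi]
  intro i
  obtain ⟨h1, h2⟩ := iteratedFDeriv_slice hO h i
  have h3 := hasDerivWithinAt_initialDeriv (Ψ := fun l y => iteratedFDeriv ℝ i (Ψ l) y) hO h1 hx
  rwa [h2 x hx] at h3

/-! ### Test functions -/

section Test

variable {Y : Type} [NormedAddCommGroup Y] [NormedSpace ℝ Y]

/-- Coefficients built from the background are smooth on `U` only; a compact set of `U` outside
which the product vanishes makes the product smooth everywhere. -/
theorem isTest_of_contDiffAt {U K : Set Event} {f : Event → Y} (hf : ∀ x ∈ U, ContDiffAt ℝ ∞ f x)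
    (hK : IsCompact K) (hKU : K ⊆ U) (h0 : ∀ x, x ∉ K → f x = 0) : IsTest U f := by
  have hts : tsupport f ⊆ K := closure_minimal (fun x hx => by
    by_contra h; exact hx (h0 x h)) hK.isClosed
  refine ⟨contDiff_iff_contDiffAt.2 fun x => ?_, hK.of_isClosed_subset isClosed_closure hts,
    hts.trans hKU⟩
  by_cases hx : x ∈ tsupport f
  · exact hf x (hKU (hts hx))
  · exact (contDiffAt_const (c := (0 : Y))).congr_of_eventuallyEq (notMem_tsupport_iff_eventuallyEq.1 hx)

theorem IsTest.contDiff {U : Set Event} {f : Event → Y} (hf : IsTest U f) : ContDiff ℝ ∞ f := hf.1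

theorem IsTest.contDiffAt {U : Set Event} {f : Event → Y} (hf : IsTest U f) (x : Event) :
    ContDiffAt ℝ ∞ f x := hf.1.contDiffAt

theorem IsTest.isCompact {U : Set Event} {f : Event → Y} (hf : IsTest U f) :
    IsCompact (tsupport f) := hf.2.1

theorem IsTest.subset {U : Set Event} {f : Event → Y} (hf : IsTest U f) :
    tsupport f ⊆ U := hf.2.2

theorem IsTest.integrable {U : Set Event} {f : Event → Y} (hf : IsTest U f) : Integrable f :=
  hf.1.continuous.integrable_of_hasCompactSupport hf.2.1

theorem IsTest.of_left {U : Set Event} {Z : Type} [NormedAddCommGroup Z] [NormedSpace ℝ Z]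
    {f : Event → Y} (hf : IsTest U f) {g : Event → Z} (hg : ∀ x ∈ U, ContDiffAt ℝ ∞ g x)
    (h : ∀ x, x ∉ tsupport f → g x = 0) : IsTest U g :=
  isTest_of_contDiffAt hg hf.isCompact hf.subset h

theorem IsTest.add {U : Set Event} {f g : Event → Y} (hf : IsTest U f) (hg : IsTest U g) :
    IsTest U (f + g) :=
  isTest_of_contDiffAt (fun x _ => (hf.contDiffAt x).add (hg.contDiffAt x))
    (hf.isCompact.union hg.isCompact) (union_subset hf.subset hg.subset) fun x hx => by
      rw [mem_union, not_or] at hx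
      simp [image_eq_zero_of_notMem_tsupport hx.1, image_eq_zero_of_notMem_tsupport hx.2]

theorem isTest_zero {U : Set Event} : IsTest U (fun _ => (0 : Y)) :=
  isTest_of_contDiffAt (fun _ _ => contDiffAt_const) isCompact_empty (empty_subset _) fun _ _ => rfl

theorem IsTest.sum {U : Set Event} {ι : Type} (s : Finset ι) {f : ι → Event → Y}
    (hf : ∀ i, IsTest U (f i)) : IsTest U (fun x => ∑ i ∈ s, f i x) := by
  classical
  induction s using Finset.induction_on with
  | empty => simpa using isTest_zero
  | insert a s ha ih =>
    simp only [Finset.sum_insert ha]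
    exact (hf a).add ih

theorem IsTest.smul_left {U : Set Event} {c : Event → ℝ} {f : Event → Y} (hf : IsTest U f)
    (hc : ∀ x ∈ U, ContDiffAt ℝ ∞ c x) : IsTest U (fun x => c x • f x) :=
  hf.of_left (fun x hx => (hc x hx).fun_smul (hf.contDiffAt x)) fun x hx => by
    rw [image_eq_zero_of_notMem_tsupport hx, smul_zero]

theorem IsTest.smul_right {U : Set Event} {c : Event → ℝ} {f : Event → Y} (hc : IsTest U c)
    (hf : ∀ x ∈ U, ContDiffAt ℝ ∞ f x) : IsTest U (fun x => c x • f x) :=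
  hc.of_left (fun x hx => (hc.contDiffAt x).fun_smul (hf x hx)) fun x hx => by
    rw [image_eq_zero_of_notMem_tsupport hx, zero_smul]

theorem IsTest.mul_left {U : Set Event} {c f : Event → ℝ} (hf : IsTest U f)
    (hc : ∀ x ∈ U, ContDiffAt ℝ ∞ c x) : IsTest U (fun x => c x * f x) :=
  hf.smul_left hc

theorem IsTest.fderiv_apply {U : Set Event} {f : Event → Y} (hf : IsTest U f) (v : Event) :
    IsTest U (fun x => fderiv ℝ f x v) :=
  hf.of_left (fun x _ => ((hf.contDiffAt x).fderiv_right (m := ∞) le_rfl).clm_apply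
    contDiffAt_const) fun x hx => by
      rw [fderiv_of_notMem_tsupport (𝕜 := ℝ) hx]; rfl

end Test

theorem contDiffAt_of_isSmoothConfig {U : Set Event} (hU : IsOpen U) {ψ : FieldConfig}
    (h : IsSmoothConfig ψ U) {x : Event} (hx : x ∈ U) : ContDiffAt ℝ ∞ ψ x :=
  (h.1 x hx).contDiffAt (hU.mem_nhds hx)

/-! ### Differentiation under the integral sign -/

theorem hasDerivAt_integral_of_contDiffOn {K : Set Event} (hK : IsCompact K) {O : Set (ℝ × Event)}
    (hO : IsOpen O) (hKO : ∀ x ∈ K, ((0 : ℝ), x) ∈ O) {h : ℝ → Event → ℝ}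
    (hh : ContDiffOn ℝ 1 (fun p : ℝ × Event => h p.1 p.2) O) :
    HasDerivAt (fun s => ∫ x in K, h s x) (∫ x in K, deriv (fun s => h s x) 0) 0 := by
  set G : ℝ × Event → ℝ := fun p => h p.1 p.2 with hG
  have hsub : ({0} : Set ℝ) ×ˢ K ⊆ O := by
    rintro ⟨s, x⟩ ⟨hs, hx⟩
    obtain rfl : s = 0 := hs
    exact hKO x hx
  -- Smoothness is known on `O` only. The tube lemma provides one interval of parameters valid for
  -- all of `K`, and compactness of the tube provides a constant dominating the derivative.
  obtain ⟨u, v, hu, -, h0u, hKv, huv⟩ := generalized_tube_lemma isCompact_singleton hK hO hsub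
  obtain ⟨ε, hε, hεu⟩ := Metric.nhds_basis_closedBall.mem_iff.1
    (hu.mem_nhds (h0u (mem_singleton (0 : ℝ))))
  have hsubO : Metric.closedBall (0 : ℝ) ε ×ˢ K ⊆ O :=
    (prod_mono hεu hKv).trans huv
  have hd : ∀ p ∈ O, HasFDerivAt G (fderiv ℝ G p) p := fun p hp =>
    (((hh p hp).contDiffAt (hO.mem_nhds hp)).differentiableAt (by simp)).hasFDerivAt
  have hD : ∀ s x, (s, x) ∈ O → HasDerivAt (fun s => h s x) (fderiv ℝ G (s, x) (1, 0)) s := by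
    intro s x hp
    have h2 : HasDerivAt (fun l : ℝ => (l, x)) ((1, 0) : ℝ × Event) s :=
      (hasDerivAt_id s).prodMk (hasDerivAt_const _ _)
    exact (hd _ hp).comp_hasDerivAt s h2
  have hc : ContinuousOn (fun p => fderiv ℝ G p (1, 0)) O :=
    (hh.continuousOn_fderiv_of_isOpen hO le_rfl).clm_apply continuousOn_const
  obtain ⟨C, hC⟩ := ((isCompact_closedBall (0 : ℝ) ε).prod hK).exists_bound_of_continuousOn
    (hc.mono hsubO)
  have hsl : ∀ s ∈ Metric.closedBall (0 : ℝ) ε, ∀ {W : ℝ × Event → ℝ}, ContinuousOn W O →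
      ContinuousOn (fun x => W (s, x)) K := fun s hs W hW =>
    hW.comp (Continuous.prodMk_right s).continuousOn fun x hx => hsubO ⟨hs, hx⟩
  have h0 : (0 : ℝ) ∈ Metric.closedBall (0 : ℝ) ε := Metric.mem_closedBall_self hε.le
  have key := hasDerivAt_integral_of_dominated_loc_of_deriv_le (μ := volume.restrict K)
    (F := h) (x₀ := (0 : ℝ)) (s := Metric.ball 0 ε) (bound := fun _ => C)
    (F' := fun s x => fderiv ℝ G (s, x) (1, 0)) (Metric.ball_mem_nhds 0 hε) ?_ ?_ ?_ ?_ ?_ ?_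
  · refine key.2.congr_deriv ?_
    exact setIntegral_congr_fun hK.measurableSet fun x hx =>
      (hD 0 x (hKO x hx)).deriv.symm
  · filter_upwards [Metric.closedBall_mem_nhds (0 : ℝ) hε] with s hs
    exact (hsl s hs hh.continuousOn).aestronglyMeasurable hK.measurableSet
  · exact (hsl 0 h0 hh.continuousOn).integrableOn_compact hK
  · exact (hsl 0 h0 hc).aestronglyMeasurable hK.measurableSet
  · refine (ae_restrict_iff' hK.measurableSet).2 (Eventually.of_forall fun x hx s hs => ?_)
    exact hC (s, x) ⟨Metric.ball_subset_closedBall hs, hx⟩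
  · exact continuousOn_const.integrableOn_compact hK
  · refine (ae_restrict_iff' hK.measurableSet).2 (Eventually.of_forall fun x hx s hs => ?_)
    exact hD s x (hsubO ⟨Metric.ball_subset_closedBall hs, hx⟩)

theorem pairing_zero (v : FieldValue) : pairing v 0 = 0 := by
  simpa using pairing_smul v 0 0

/-! ### First variation of the action -/

section Variation

variable {k : ℕ} {V : Set Event} {ψ δ : FieldConfig}

/-- The pairs `(s, x)` for which `ψ + s δ` is Lorentzian at `x`. -/
def lorentzianDomain (k : ℕ) (V : Set Event) (ψ δ : FieldConfig) : Set (ℝ × Event) :=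
  {p | p.2 ∈ V ∧ jet k ψ p.2 + p.1 • jet k δ p.2 ∈ lorentzianJets k}

theorem contDiffOn_jet_line (k : ℕ) (hV : IsOpen V) (hψ : IsSmoothConfig ψ V) (hδ : IsTest V δ) :
    ContDiffOn ℝ ∞ (fun p : ℝ × Event => jet k ψ p.2 + p.1 • jet k δ p.2) {p | p.2 ∈ V} := by
  intro p hp
  have h1 : ContDiffAt ℝ ∞ (fun p : ℝ × Event => jet k ψ p.2) p :=
    (contDiffAt_jet k (contDiffAt_of_isSmoothConfig hV hψ hp)).comp p contDiffAt_snd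
  have h2 : ContDiffAt ℝ ∞ (fun p : ℝ × Event => jet k δ p.2) p :=
    (contDiffAt_jet k (hδ.contDiffAt _)).comp p contDiffAt_snd
  exact (h1.add (contDiffAt_fst.fun_smul h2)).contDiffWithinAt

theorem isOpen_lorentzianDomain (k : ℕ) (hV : IsOpen V) (hψ : IsSmoothConfig ψ V)
    (hδ : IsTest V δ) : IsOpen (lorentzianDomain k V ψ δ) :=
  (contDiffOn_jet_line k hV hψ hδ).continuousOn.isOpen_inter_preimage
    (hV.preimage continuous_snd) (isOpen_lorentzianJets k)

theorem zero_mem_lorentzianDomain (k : ℕ) (hψ : IsSmoothConfig ψ V) {x : Event} (hx : x ∈ V) :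
    ((0 : ℝ), x) ∈ lorentzianDomain k V ψ δ :=
  ⟨hx, by
    simp only [zero_smul, add_zero]
    exact hψ.2 x hx⟩

theorem contDiffOn_comp_jet_line {G : Type} [NormedAddCommGroup G] [NormedSpace ℝ G] (hV : IsOpen V)
    (hψ : IsSmoothConfig ψ V) (hδ : IsTest V δ) {L : Jet k → G}
    (hL : ContDiffOn ℝ ∞ L (lorentzianJets k)) :
    ContDiffOn ℝ ∞ (fun p : ℝ × Event => L (jet k ψ p.2 + p.1 • jet k δ p.2))
      (lorentzianDomain k V ψ δ) :=
  hL.comp ((contDiffOn_jet_line k hV hψ hδ).mono fun _ hp => hp.1) fun _ hp => hp.2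

theorem jet_line (k : ℕ) (hV : IsOpen V) (hψ : IsSmoothConfig ψ V) (hδ : IsTest V δ) {x : Event}
    (hx : x ∈ V) (s : ℝ) : jet k (ψ + s • δ) x = jet k ψ x + s • jet k δ x :=
  jet_add_smul k (contDiffAt_of_isSmoothConfig hV hψ hx) (hδ.contDiffAt x) s

theorem hasFDerivAt_of_contDiffOn_lorentzianJets {G : Type} [NormedAddCommGroup G]
    [NormedSpace ℝ G] {L : Jet k → G} (hL : ContDiffOn ℝ ∞ L (lorentzianJets k)) {j : Jet k}
    (hj : j ∈ lorentzianJets k) : HasFDerivAt L (fderiv ℝ L j) j :=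
  (((hL j hj).contDiffAt ((isOpen_lorentzianJets k).mem_nhds hj)).differentiableAt
    (by simp)).hasFDerivAt

theorem hasDerivAt_comp_jet_line {G : Type} [NormedAddCommGroup G] [NormedSpace ℝ G]
    (hψ : IsSmoothConfig ψ V) {L : Jet k → G} (hL : ContDiffOn ℝ ∞ L (lorentzianJets k))
    {x : Event} (hx : x ∈ V) :
    HasDerivAt (fun s : ℝ => L (jet k ψ x + s • jet k δ x))
      (fderiv ℝ L (jet k ψ x) (jet k δ x)) 0 := by
  have h1 : HasDerivAt (fun s : ℝ => jet k ψ x + s • jet k δ x) (jet k δ x) 0 := by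
    simpa using ((hasDerivAt_id (0 : ℝ)).smul_const (jet k δ x)).const_add (jet k ψ x)
  have h2 := hasFDerivAt_of_contDiffOn_lorentzianJets hL (j := jet k ψ x) (hψ.2 x hx)
  refine HasFDerivAt.comp_hasDerivAt (0 : ℝ) ?_ h1
  simpa using h2

/-- The derivative of the action is computed twice, by the definition of the field equations and by
differentiating under the integral sign. -/
theorem VectorTensorTheory.firstVariation (T : VectorTensorTheory) (hV : IsOpen V)
    (hψ : IsSmoothConfig ψ V) (hδ : IsTest V δ) :
    ∫ x in tsupport δ, volDensity (ψ x) * pairing (ψ x) (δ x) (T.fieldEq (jet 2 ψ x)) =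
      ∫ x in tsupport δ, fderiv ℝ T.lagrangian (jet T.order ψ x) (jet T.order δ x) := by
  have h1 := T.isFieldEquation V ψ δ hV hψ hδ.1 hδ.2.1 hδ.2.2
  simp only [← pairing_apply] at h1
  have h2 := hasDerivAt_integral_of_contDiffOn hδ.isCompact
    (isOpen_lorentzianDomain T.order hV hψ hδ)
    (fun x hx => zero_mem_lorentzianDomain T.order hψ (hδ.subset hx))
    (h := fun s x => T.lagrangian (jet T.order ψ x + s • jet T.order δ x))
    ((contDiffOn_comp_jet_line hV hψ hδ T.lagrangian_smooth).of_le (by simp))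
  have h3 : (fun s : ℝ => ∫ x in tsupport δ, T.lagrangian (jet T.order (ψ + s • δ) x)) =
      fun s => ∫ x in tsupport δ, T.lagrangian (jet T.order ψ x + s • jet T.order δ x) := by
    funext s
    exact setIntegral_congr_fun hδ.isCompact.measurableSet fun x hx => by
      simp only [jet_line T.order hV hψ hδ (hδ.subset hx)]
  rw [h3] at h1
  rw [h1.unique h2]
  exact setIntegral_congr_fun hδ.isCompact.measurableSet fun x hx =>
    (hasDerivAt_comp_jet_line hψ T.lagrangian_smooth (hδ.subset hx)).deriv

end Variation

/-! ### Gauge identity -/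

theorem isTest_gaugeVariation {V : Set Event} {χ : Event → ℝ} (hχ : IsTest V χ) :
    IsTest V (fun x => ((0, fun μ => partialDeriv μ χ x) : FieldValue)) := by
  refine hχ.of_left (fun x _ => contDiffAt_const.prodMk (contDiffAt_pi.2 fun μ => ?_)) fun x hx => ?_
  · exact (hχ.fderiv_apply _).contDiffAt x
  · simp only [partialDeriv, fderiv_of_notMem_tsupport (𝕜 := ℝ) hx]
    rfl

/-- The action is constant along `A + s dχ`, so the derivative given by the field equations is zero.
-/
theorem VectorTensorTheory.gauge_identity (T : VectorTensorTheory) (hT : T.HasMaxwellSymmetry)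
    {V : Set Event} (hV : IsOpen V) {ψ : FieldConfig} (hψ : IsSmoothConfig ψ V) {χ : Event → ℝ}
    (hχ : IsTest V χ) :
    ∫ x, volDensity (ψ x) * pairing (ψ x) (0, fun μ => partialDeriv μ χ x)
      (T.fieldEq (jet 2 ψ x)) = 0 := by
  set δ : FieldConfig := fun x => (0, fun μ => partialDeriv μ χ x) with hδdef
  have hδ : IsTest V δ := isTest_gaugeVariation hχ
  have h1 := T.isFieldEquation V ψ δ hV hψ hδ.1 hδ.2.1 hδ.2.2
  simp only [← pairing_apply] at h1
  have h3 : (fun s : ℝ => ∫ x in tsupport δ, T.lagrangian (jet T.order (ψ + s • δ) x)) =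
      fun s => ∫ x in tsupport δ, T.lagrangian (jet T.order ψ x) := by
    funext s
    refine setIntegral_congr_fun hδ.isCompact.measurableSet fun x hx => ?_
    have h4 : ψ + s • δ = gaugeTransform (fun y => s * χ y) ψ := by
      funext y
      refine Prod.ext ?_ ?_
      · change (ψ y).1 + s • (0 : SymTensor) = (ψ y).1
        rw [smul_zero, add_zero]
      · funext μ
        change (ψ y).2 μ + s * partialDeriv μ χ y = (ψ y).2 μ + partialDeriv μ (fun y => s * χ y) y
        rw [partialDeriv, partialDeriv,
          fderiv_const_mul ((hχ.contDiffAt y).differentiableAt (by simp))]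
        rfl
    simp only [h4]
    exact hT V (fun y => s * χ y) hV (contDiff_const.mul hχ.contDiff).contDiffOn ψ hψ x
      (hδ.subset hx)
  rw [h3] at h1
  have h4 := h1.unique (hasDerivAt_const _ _)
  rw [← h4]
  refine (setIntegral_eq_integral_of_forall_compl_eq_zero fun x hx => ?_).symm
  change volDensity (ψ x) * pairing (ψ x) (δ x) _ = 0
  rw [image_eq_zero_of_notMem_tsupport hx, pairing_zero]
  simp

/-! ### Lie derivatives -/

/-- The map `x ↦ x + s ξ(x)`. -/
def shift (ξ : Event → Event) (s : ℝ) (x : Event) : Event := x + s • ξ x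

/-- The Lie derivative of the metric and of the covector field along `ξ`. -/
def lieDeriv (ξ : Event → Event) (ψ : FieldConfig) : FieldConfig := fun x =>
  fderiv ℝ ψ x (ξ x) +
  (Sym2.lift ⟨fun μ ν => ∑ ρ, (partialDeriv μ (fun y => ξ y ρ) x * (ψ x).1 s(ρ, ν) +
      partialDeriv ν (fun y => ξ y ρ) x * (ψ x).1 s(ρ, μ)), by
    intro μ ν
    simp only [add_comm]⟩,
   fun μ => ∑ ρ, partialDeriv μ (fun y => ξ y ρ) x * (ψ x).2 ρ)

theorem lieDeriv_fst (ξ : Event → Event) (ψ : FieldConfig) (x : Event) (μ ν : Fin 4) :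
    (lieDeriv ξ ψ x).1 s(μ, ν) = (fderiv ℝ ψ x (ξ x)).1 s(μ, ν) +
      ∑ ρ, (partialDeriv μ (fun y => ξ y ρ) x * (ψ x).1 s(ρ, ν) +
        partialDeriv ν (fun y => ξ y ρ) x * (ψ x).1 s(ρ, μ)) := rfl

theorem lieDeriv_snd (ξ : Event → Event) (ψ : FieldConfig) (x : Event) (μ : Fin 4) :
    (lieDeriv ξ ψ x).2 μ = (fderiv ℝ ψ x (ξ x)).2 μ +
      ∑ ρ, partialDeriv μ (fun y => ξ y ρ) x * (ψ x).2 ρ := rfl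

theorem pullback_fst (Φ : Event → Event) (ψ : FieldConfig) (x : Event) (μ ν : Fin 4) :
    (pullback Φ ψ x).1 s(μ, ν) = ∑ ρ, ∑ σ, partialDeriv μ (fun y => Φ y ρ) x *
      partialDeriv ν (fun y => Φ y σ) x * (ψ (Φ x)).1 s(ρ, σ) := rfl

theorem pullback_snd (Φ : Event → Event) (ψ : FieldConfig) (x : Event) (μ : Fin 4) :
    (pullback Φ ψ x).2 μ = ∑ ρ, partialDeriv μ (fun y => Φ y ρ) x * (ψ (Φ x)).2 ρ := rfl

section Lie

variable {ξ : Event → Event} {ψ : FieldConfig}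

theorem hasFDerivAt_component (hξ : ContDiff ℝ ∞ ξ) (x : Event) (ρ : Fin 4) :
    HasFDerivAt (fun y => ξ y ρ) (fderiv ℝ (fun y => ξ y ρ) x) x :=
  ((contDiff_pi.1 hξ ρ).contDiffAt.differentiableAt (by simp)).hasFDerivAt

theorem partialDeriv_component (hξ : ContDiff ℝ ∞ ξ) (x : Event) (μ ρ : Fin 4) :
    partialDeriv μ (fun y => ξ y ρ) x = fderiv ℝ ξ x (coordVec μ) ρ := by
  have h := ((hξ.contDiffAt (x := x)).differentiableAt (by simp)).hasFDerivAt
  rw [hasFDerivAt_pi'] at h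
  rw [partialDeriv, (h ρ).fderiv]
  rfl

theorem partialDeriv_shift (hξ : ContDiff ℝ ∞ ξ) (s : ℝ) (x : Event) (μ ρ : Fin 4) :
    partialDeriv μ (fun y => shift ξ s y ρ) x =
      (if μ = ρ then 1 else 0) + s * partialDeriv μ (fun y => ξ y ρ) x := by
  have h1 : HasFDerivAt (fun y : Event => y ρ) (ContinuousLinearMap.proj (R := ℝ) ρ) x :=
    (ContinuousLinearMap.proj (R := ℝ) (φ := fun _ : Fin 4 => ℝ) ρ).hasFDerivAt
  have h2 : HasFDerivAt (fun y => shift ξ s y ρ) (ContinuousLinearMap.proj (R := ℝ) ρ +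
    s • fderiv ℝ (fun y => ξ y ρ) x) x := h1.add ((hasFDerivAt_component hξ x ρ).const_mul s)
  rw [partialDeriv, h2.fderiv]
  change (Pi.single μ (1 : ℝ) : Event) ρ + _ = _
  simp only [Pi.single_apply, eq_comm]
  rfl

theorem contDiffAt_partialDeriv {f : Event → ℝ} {x : Event} (h : ContDiffAt ℝ ∞ f x) (μ : Fin 4) :
    ContDiffAt ℝ ∞ (partialDeriv μ f) x :=
  (h.fderiv_right (m := ∞) le_rfl).clm_apply contDiffAt_const

theorem contDiffAt_pullback_shift (hξ : ContDiff ℝ ∞ ξ) {p : ℝ × Event}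
    (hψ : ContDiffAt ℝ ∞ ψ (shift ξ p.1 p.2)) :
    ContDiffAt ℝ ∞ (fun p : ℝ × Event => pullback (shift ξ p.1) ψ p.2) p := by
  have hJ : ∀ μ ρ, ContDiffAt ℝ ∞
      (fun p : ℝ × Event => partialDeriv μ (fun y => shift ξ p.1 y ρ) p.2) p := by
    intro μ ρ
    simp only [partialDeriv_shift hξ]
    have h1 : ContDiffAt ℝ ∞ (fun p : ℝ × Event => partialDeriv μ (fun y => ξ y ρ) p.2) p :=
      (contDiffAt_partialDeriv (contDiff_pi.1 hξ ρ).contDiffAt μ).comp p contDiffAt_snd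
    exact contDiffAt_const.add (contDiffAt_fst.mul h1)
  have hv : ContDiffAt ℝ ∞ (fun p : ℝ × Event => ψ (shift ξ p.1 p.2)) p := by
    refine ContDiffAt.comp (g := ψ) (f := fun p : ℝ × Event => shift ξ p.1 p.2) p hψ ?_
    exact contDiffAt_snd.add (contDiffAt_fst.fun_smul (hξ.contDiffAt.comp p contDiffAt_snd))
  refine ContDiffAt.prodMk (contDiffAt_pi.2 fun e => ?_) (contDiffAt_pi.2 fun μ => ?_)
  · induction e using Sym2.ind with
    | _ μ ν =>
      change ContDiffAt ℝ ∞ (fun q : ℝ × Event => ∑ ρ, ∑ σ,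
        partialDeriv μ (fun y => shift ξ q.1 y ρ) q.2 * partialDeriv ν (fun y => shift ξ q.1 y σ) q.2 *
          (ψ (shift ξ q.1 q.2)).1 s(ρ, σ)) p
      refine ContDiffAt.sum fun ρ _ => ContDiffAt.sum fun σ _ => ((hJ _ _).mul (hJ _ _)).mul ?_
      exact contDiffAt_pi.1 hv.fst s(ρ, σ)
  · refine ContDiffAt.sum fun ρ _ => (hJ _ _).mul ?_
    exact contDiffAt_pi.1 hv.snd ρ

theorem hasDerivAt_pullback_shift (hξ : ContDiff ℝ ∞ ξ) {x : Event} (hψ : ContDiffAt ℝ ∞ ψ x) :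
    HasDerivAt (fun s => pullback (shift ξ s) ψ x) (lieDeriv ξ ψ x) 0 := by
  have hJ : ∀ μ ρ, HasDerivAt (fun s : ℝ => partialDeriv μ (fun y => shift ξ s y ρ) x)
      (partialDeriv μ (fun y => ξ y ρ) x) 0 := by
    intro μ ρ
    simp only [partialDeriv_shift hξ]
    simpa using ((hasDerivAt_id (0 : ℝ)).mul_const (partialDeriv μ (fun y => ξ y ρ) x)).const_add
      (if μ = ρ then (1 : ℝ) else 0)
  have hs : HasDerivAt (fun s => shift ξ s x) (ξ x) 0 := by
    simpa [shift] using ((hasDerivAt_id (0 : ℝ)).smul_const (ξ x)).const_add x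
  have h0 : shift ξ 0 x = x := by simp [shift]
  have hv : HasDerivAt (fun s => ψ (shift ξ s x)) (fderiv ℝ ψ x (ξ x)) 0 := by
    refine HasFDerivAt.comp_hasDerivAt (0 : ℝ) ?_ hs
    rw [h0]
    exact (hψ.differentiableAt (by simp)).hasFDerivAt
  have hv1 := hasDerivAt_pi.1 (HasFDerivAt.comp_hasDerivAt (0 : ℝ)
    (ContinuousLinearMap.fst ℝ SymTensor (Fin 4 → ℝ)).hasFDerivAt hv)
  have hv2 := hasDerivAt_pi.1 (HasFDerivAt.comp_hasDerivAt (0 : ℝ)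
    (ContinuousLinearMap.snd ℝ SymTensor (Fin 4 → ℝ)).hasFDerivAt hv)
  refine HasDerivAt.prodMk (hasDerivAt_pi.2 fun e => ?_) (hasDerivAt_pi.2 fun μ => ?_)
  · induction e using Sym2.ind with
    | _ μ ν =>
      have h1 := HasDerivAt.fun_sum (u := Finset.univ) fun ρ _ =>
        HasDerivAt.fun_sum (u := Finset.univ) fun σ _ =>
          ((hJ μ ρ).mul (hJ ν σ)).mul (hv1 s(ρ, σ))
      refine h1.congr_deriv ?_
      change _ = (lieDeriv ξ ψ x).1 s(μ, ν)
      rw [lieDeriv_fst, Finset.sum_add_distrib, add_comm]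
      simp only [partialDeriv_shift hξ, Function.comp, h0, Pi.mul_apply, zero_mul, add_zero,
        ContinuousLinearMap.coe_fst']
      simp only [Finset.sum_add_distrib, add_mul, mul_ite, ite_mul, mul_one, one_mul, mul_zero,
        zero_mul, Finset.sum_ite_eq, Finset.mem_univ, if_true]
      congr 2
      rw [Finset.sum_comm]
      simp only [Finset.sum_ite_eq, Finset.mem_univ, if_true, Sym2.eq_swap (a := μ)]
  · have h1 := HasDerivAt.fun_sum (u := Finset.univ) fun ρ _ => (hJ μ ρ).mul (hv2 ρ)
    refine h1.congr_deriv ?_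
    simp only [partialDeriv_shift hξ, Function.comp, h0, zero_mul, add_zero,
      ContinuousLinearMap.coe_snd']
    simp only [Finset.sum_add_distrib, ite_mul, one_mul, zero_mul, Finset.sum_ite_eq,
      Finset.mem_univ, if_true]
    exact add_comm _ _

theorem fderiv_shift (hξ : ContDiff ℝ ∞ ξ) (s : ℝ) (x : Event) :
    HasFDerivAt (shift ξ s) (ContinuousLinearMap.id ℝ Event + s • fderiv ℝ ξ x) x :=
  (hasFDerivAt_id x).add (((hξ.contDiffAt.differentiableAt (by simp)).hasFDerivAt).const_smul s)

/-- From `det (1 + s A) = 1 + s tr A + O(s²)`, the remainder being a polynomial multiple of `s²`. -/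
theorem hasDerivAt_det_shift (hξ : ContDiff ℝ ∞ ξ) (x : Event) :
    HasDerivAt (fun s => (fderiv ℝ (shift ξ s) x).det)
      (∑ μ, partialDeriv μ (fun y => ξ y μ) x) 0 := by
  set A : Matrix (Fin 4) (Fin 4) ℝ := LinearMap.toMatrix' (fderiv ℝ ξ x : Event →ₗ[ℝ] Event) with hA
  have h1 : ∀ s, (fderiv ℝ (shift ξ s) x).det = (1 + s • A).det := by
    intro s
    rw [(fderiv_shift hξ s x).fderiv, ContinuousLinearMap.det, ← LinearMap.det_toMatrix']
    congr 1
    rw [ContinuousLinearMap.toLinearMap_add, map_add, ContinuousLinearMap.toLinearMap_smul, map_smul,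
      ContinuousLinearMap.coe_id, LinearMap.toMatrix'_id]
  have h2 : A.trace = ∑ μ, partialDeriv μ (fun y => ξ y μ) x := by
    refine Finset.sum_congr rfl fun μ _ => ?_
    rw [partialDeriv_component hξ, hA, Matrix.diag_apply, LinearMap.toMatrix'_apply]
    rfl
  rw [funext h1, funext fun s => Matrix.det_one_add_smul s A, h2]
  set P := (1 + (Polynomial.X : Polynomial ℝ) • A.map Polynomial.C).det.divX.divX
  have h3 := (((hasDerivAt_id (0 : ℝ)).const_mul (∑ μ, partialDeriv μ (fun y => ξ y μ) x)).const_add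
    1).add ((P.hasDerivAt 0).mul ((hasDerivAt_id (0 : ℝ)).pow 2))
  refine h3.congr_deriv ?_
  simp

/-- For small `s` the map `s ξ` has Lipschitz constant below one near `x`, so `x ↦ x + s ξ(x)` is
injective on a fixed ball. Covariance can then be applied to these maps; they agree with the flow of
`ξ` to first order, so no flow is needed. -/
theorem eventually_shift_injOn (hξ : ContDiff ℝ ∞ ξ) {V : Set Event} (hV : IsOpen V) {x : Event}
    (hx : x ∈ V) : ∃ ε > 0, ∀ s ∈ Metric.ball (0 : ℝ) ε,
      InjOn (shift ξ s) (Metric.ball x ε) ∧ (∀ y ∈ Metric.ball x ε, shift ξ s y ∈ V) ∧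
      ∀ y ∈ Metric.ball x ε, 0 < (fderiv ℝ (shift ξ s) y).det := by
  obtain ⟨K, t, ht, hK⟩ := (hξ.contDiffAt (x := x)).of_le (show (1 : WithTop ℕ∞) ≤ ∞ by simp)
    |>.exists_lipschitzOnWith
  have hcs : Continuous fun p : ℝ × Event => shift ξ p.1 p.2 :=
    continuous_snd.add (continuous_fst.smul (hξ.continuous.comp continuous_snd))
  have hcd : Continuous fun p : ℝ × Event => (fderiv ℝ (shift ξ p.1) p.2).det := by
    simp only [(fderiv_shift hξ _ _).fderiv]
    refine ContinuousLinearMap.continuous_det.comp (continuous_const.add (continuous_fst.smul ?_))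
    exact (hξ.continuous_fderiv (by simp)).comp continuous_snd
  have e1 : ∀ᶠ p : ℝ × Event in 𝓝 (0, x), shift ξ p.1 p.2 ∈ V := by
    refine hcs.continuousAt.eventually (hV.mem_nhds ?_)
    simpa [shift] using hx
  have e2 : ∀ᶠ p : ℝ × Event in 𝓝 (0, x), 0 < (fderiv ℝ (shift ξ p.1) p.2).det := by
    refine hcd.continuousAt.eventually (lt_mem_nhds ?_)
    simp [(fderiv_shift hξ _ _).fderiv, ContinuousLinearMap.det]
  have e3 : ∀ᶠ p : ℝ × Event in 𝓝 (0, x), p.2 ∈ t := continuous_snd.continuousAt.eventually ht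
  have e4 : ∀ᶠ p : ℝ × Event in 𝓝 (0, x), |p.1| * K < 1 := by
    have : Continuous fun p : ℝ × Event => |p.1| * (K : ℝ) := by fun_prop
    refine this.continuousAt.eventually (gt_mem_nhds ?_)
    simp
  obtain ⟨ε, hε, hball⟩ := Metric.eventually_nhds_iff_ball.1 (e1.and (e2.and (e3.and e4)))
  have hb : ∀ s ∈ Metric.ball (0 : ℝ) ε, ∀ y ∈ Metric.ball x ε,
      ((s, y) : ℝ × Event) ∈ Metric.ball ((0, x) : ℝ × Event) ε := by
    intro s hs y hy
    rw [← ball_prod_same]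
    exact ⟨hs, hy⟩
  refine ⟨ε, hε, fun s hs => ⟨fun y hy z hz hyz => ?_, fun y hy => (hball _ (hb s hs y hy)).1,
    fun y hy => (hball _ (hb s hs y hy)).2.1⟩⟩
  have h1 := hball _ (hb s hs y hy)
  have h2 := hball _ (hb s hs z hz)
  have h3 := hK.dist_le_mul y h1.2.2.1 z h2.2.2.1
  have h4 : y - z = s • (ξ z - ξ y) := by
    simp only [shift] at hyz
    rw [smul_sub]
    linear_combination (exp := 1) hyz
  have h5 : dist y z ≤ |s| * K * dist y z := by
    calc dist y z = ‖s • (ξ z - ξ y)‖ := by rw [dist_eq_norm, h4]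
      _ = |s| * dist (ξ y) (ξ z) := by rw [norm_smul, Real.norm_eq_abs, dist_comm, dist_eq_norm]
      _ ≤ |s| * (K * dist y z) := by gcongr
      _ = _ := by ring
  have h6 : dist y z = 0 := by
    by_contra hne
    have : 0 < dist y z := lt_of_le_of_ne dist_nonneg (Ne.symm hne)
    have h7 := h1.2.2.2
    simp only at h7
    nlinarith
  exact dist_eq_zero.1 h6

/-- The infinitesimal form of diffeomorphism covariance. -/
theorem VectorTensorTheory.lagrangian_lieDeriv (T : VectorTensorTheory) {V : Set Event}
    (hV : IsOpen V) (hψ : IsSmoothConfig ψ V) (hξ : ContDiff ℝ ∞ ξ) {x : Event} (hx : x ∈ V) :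
    fderiv ℝ T.lagrangian (jet T.order ψ x) (jet T.order (lieDeriv ξ ψ) x) =
      (∑ μ, partialDeriv μ (fun y => ξ y μ) x) * T.lagrangian (jet T.order ψ x) +
        fderiv ℝ (fun y => T.lagrangian (jet T.order ψ y)) x (ξ x) := by
  obtain ⟨ε, hε, hsh⟩ := eventually_shift_injOn hξ hV hx
  have hψx : ∀ y ∈ V, ContDiffAt ℝ ∞ ψ y := fun y hy => contDiffAt_of_isSmoothConfig hV hψ hy
  set O : Set (ℝ × Event) := Metric.ball 0 ε ×ˢ Metric.ball x ε
  have hO : IsOpen O := Metric.isOpen_ball.prod Metric.isOpen_ball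
  have hxO : ((0 : ℝ), x) ∈ O := ⟨Metric.mem_ball_self hε, Metric.mem_ball_self hε⟩
  have hsm : ContDiffOn ℝ ∞ (fun p : ℝ × Event => pullback (shift ξ p.1) ψ p.2) (nonnegPart O) :=
    fun p hp => (contDiffAt_pullback_shift hξ
      (hψx _ ((hsh p.1 hp.1.1).2.1 p.2 hp.1.2))).contDiffWithinAt
  have h1 := hasDerivWithinAt_jet T.order (Ψ := fun s => pullback (shift ξ s) ψ) hO hsm hxO
  have h2 : jet T.order (initialDeriv fun s => pullback (shift ξ s) ψ) x =
      jet T.order (lieDeriv ξ ψ) x := by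
    refine jet_congr _ ?_
    filter_upwards [hV.mem_nhds hx] with y hy
    exact (hasDerivAt_pullback_shift hξ (hψx y hy)).hasDerivWithinAt.derivWithin
      (uniqueDiffOn_Ici 0 0 self_mem_Ici)
  rw [h2] at h1
  have h0 : pullback (shift ξ 0) ψ = ψ := by
    funext y
    have hs : shift ξ 0 y = y := by simp [shift]
    refine Prod.ext (funext fun e => ?_) (funext fun μ => ?_)
    · induction e using Sym2.ind with
      | _ μ ν =>
        rw [pullback_fst]
        simp [partialDeriv_shift hξ, hs]
    · rw [pullback_snd]
      simp [partialDeriv_shift hξ, hs]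
  have hLd : HasFDerivAt T.lagrangian (fderiv ℝ T.lagrangian (jet T.order ψ x))
      (jet T.order (pullback (shift ξ 0) ψ) x) := by
    rw [h0]
    exact hasFDerivAt_of_contDiffOn_lorentzianJets T.lagrangian_smooth (hψ.2 x hx)
  have h3 := hLd.comp_hasDerivWithinAt (0 : ℝ) h1
  have hℓ : HasFDerivAt (fun y => T.lagrangian (jet T.order ψ y))
      (fderiv ℝ (fun y => T.lagrangian (jet T.order ψ y)) x) (shift ξ 0 x) := by
    have hs : shift ξ 0 x = x := by simp [shift]
    rw [hs]
    have hj : DifferentiableAt ℝ (jet T.order ψ) x :=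
      (contDiffAt_jet T.order (hψx x hx)).differentiableAt (by simp)
    exact (DifferentiableAt.comp x (hasFDerivAt_of_contDiffOn_lorentzianJets
      T.lagrangian_smooth (j := jet T.order ψ x) (hψ.2 x hx)).differentiableAt hj).hasFDerivAt
  have hs : HasDerivAt (fun s => shift ξ s x) (ξ x) 0 := by
    simpa [shift] using ((hasDerivAt_id (0 : ℝ)).smul_const (ξ x)).const_add x
  have h4 := ((hasDerivAt_det_shift hξ x).mul (hℓ.comp_hasDerivAt (0 : ℝ) hs)).hasDerivWithinAt
    (s := Ici 0)
  have h5 : HasDerivWithinAt (fun s => T.lagrangian (jet T.order (pullback (shift ξ s) ψ) x))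
      ((∑ μ, partialDeriv μ (fun y => ξ y μ) x) * T.lagrangian (jet T.order ψ (shift ξ 0 x)) +
        (fderiv ℝ (shift ξ 0) x).det * fderiv ℝ (fun y => T.lagrangian (jet T.order ψ y)) x (ξ x))
      (Ici 0) 0 := by
    refine h4.congr_of_eventuallyEq ?_ ?_
    · filter_upwards [mem_nhdsWithin_of_mem_nhds (Metric.ball_mem_nhds (0 : ℝ) hε)] with s hs
      obtain ⟨hi, hm, hd⟩ := hsh s hs
      have hcd : ContDiff ℝ ∞ (shift ξ s) := contDiff_id.add (hξ.const_smul _)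
      exact T.covariant (Metric.ball x ε) (shift ξ s) Metric.isOpen_ball hcd.contDiffOn hi hd ψ
        ⟨hψ.1.mono (image_subset_iff.2 hm), fun y hy => hψ.2 y (image_subset_iff.2 hm hy)⟩ x
        (Metric.mem_ball_self hε)
    · obtain ⟨hi, hm, hd⟩ := hsh 0 (Metric.mem_ball_self hε)
      have hcd : ContDiff ℝ ∞ (shift ξ 0) := contDiff_id.add (hξ.const_smul _)
      exact T.covariant (Metric.ball x ε) (shift ξ 0) Metric.isOpen_ball hcd.contDiffOn hi hd ψ
        ⟨hψ.1.mono (image_subset_iff.2 hm), fun y hy => hψ.2 y (image_subset_iff.2 hm hy)⟩ x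
        (Metric.mem_ball_self hε)
  -- The same function of `s` is differentiated by the chain rule through the jets (`h3`) and
  -- through the right side of the covariance law, a determinant times the shifted Lagrangian
  -- (`h5`).
  have h6 := (uniqueDiffOn_Ici (0 : ℝ) 0 self_mem_Ici).eq_deriv _ h3 h5
  rw [h6, (fderiv_shift hξ 0 x).fderiv]
  simp [shift, ContinuousLinearMap.det]

end Lie

/-! ### Noether identities -/

theorem clm_apply_eq_sum {Y : Type} [NormedAddCommGroup Y] [NormedSpace ℝ Y] (L : Event →L[ℝ] Y)
    (v : Event) : L v = ∑ μ, v μ • L (coordVec μ) := by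
  have h : v = ∑ μ, v μ • coordVec μ := by
    funext ν
    simp [coordVec, Pi.single_apply, Finset.sum_apply]
  conv_lhs => rw [h]
  simp [map_sum]

theorem isTest_lieDeriv {V : Set Event} {ξ : Event → Event} {ψ : FieldConfig}
    (hψ : ∀ x ∈ V, ContDiffAt ℝ ∞ ψ x) (hξ : IsTest V ξ) : IsTest V (lieDeriv ξ ψ) := by
  refine hξ.of_left (fun x hx => ?_) fun x hx => ?_
  · have hψx := hψ x hx
    have h1 : ContDiffAt ℝ ∞ (fun x => fderiv ℝ ψ x (ξ x)) x :=
      (hψx.fderiv_right (m := ∞) le_rfl).clm_apply (hξ.contDiffAt x)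
    have h2 : ∀ μ ρ, ContDiffAt ℝ ∞ (partialDeriv μ (fun y => ξ y ρ)) x := fun μ ρ =>
      contDiffAt_partialDeriv (contDiffAt_pi.1 (hξ.contDiffAt x) ρ) μ
    have h3 := fun e => contDiffAt_pi.1 hψx.fst e
    have h4 := fun e => contDiffAt_pi.1 hψx.snd e
    have h5 := fun e => contDiffAt_pi.1 h1.fst e
    have h6 := fun e => contDiffAt_pi.1 h1.snd e
    refine ContDiffAt.prodMk (contDiffAt_pi.2 fun e => ?_) (contDiffAt_pi.2 fun μ => ?_)
    · induction e using Sym2.ind with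
      | _ μ ν =>
        change ContDiffAt ℝ ∞ (fun x => (lieDeriv ξ ψ x).1 s(μ, ν)) x
        simp only [lieDeriv_fst]
        exact (h5 _).add (ContDiffAt.sum fun ρ _ =>
          ((h2 _ _).mul (h3 _)).add ((h2 _ _).mul (h3 _)))
    · change ContDiffAt ℝ ∞ (fun x => (lieDeriv ξ ψ x).2 μ) x
      simp only [lieDeriv_snd]
      exact (h6 _).add (ContDiffAt.sum fun ρ _ => (h2 _ _).mul (h4 _))
  · have h1 : ∀ μ ρ, partialDeriv μ (fun y => ξ y ρ) x = 0 := by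
      intro μ ρ
      rw [partialDeriv_component hξ.contDiff, fderiv_of_notMem_tsupport (𝕜 := ℝ) hx]
      rfl
    refine Prod.ext (funext fun e => ?_) (funext fun μ => ?_)
    · induction e using Sym2.ind with
      | _ μ ν =>
        rw [lieDeriv_fst]
        simp [h1, image_eq_zero_of_notMem_tsupport hx]
    · rw [lieDeriv_snd]
      simp [h1, image_eq_zero_of_notMem_tsupport hx]

theorem integral_divergence_eq_zero {V : Set Event} {ξ : Event → Event} (hξ : IsTest V ξ)
    {ℓ : Event → ℝ} (hℓ : ∀ x ∈ V, ContDiffAt ℝ ∞ ℓ x) :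
    ∫ x, ((∑ μ, partialDeriv μ (fun y => ξ y μ) x) * ℓ x + fderiv ℝ ℓ x (ξ x)) = 0 := by
  have hξμ : ∀ μ, IsTest V (fun y => ξ y μ) := fun μ =>
    hξ.of_left (fun x _ => contDiffAt_pi.1 (hξ.contDiffAt x) μ) fun x hx => by
      rw [image_eq_zero_of_notMem_tsupport hx]; rfl
  have h1 : ∀ μ, IsTest V (fun x => fderiv ℝ (fun y => ξ y μ) x (coordVec μ) * ℓ x) := fun μ =>
    IsTest.smul_right ((hξμ μ).fderiv_apply _) hℓ
  have h2 : ∀ μ, IsTest V (fun x => ξ x μ * fderiv ℝ ℓ x (coordVec μ)) := fun μ =>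
    IsTest.smul_right (hξμ μ) fun x hx => contDiffAt_partialDeriv (hℓ x hx) μ
  have h3 : ∀ x, (∑ μ, partialDeriv μ (fun y => ξ y μ) x) * ℓ x + fderiv ℝ ℓ x (ξ x) =
      ∑ μ, (fderiv ℝ (fun y => ξ y μ) x (coordVec μ) * ℓ x +
        ξ x μ * fderiv ℝ ℓ x (coordVec μ)) := by
    intro x
    rw [Finset.sum_add_distrib, Finset.sum_mul, clm_apply_eq_sum (fderiv ℝ ℓ x)]
    rfl
  simp only [h3]
  have h4 : ∀ μ, Integrable fun x => fderiv ℝ (fun y => ξ y μ) x (coordVec μ) * ℓ x +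
      ξ x μ * fderiv ℝ ℓ x (coordVec μ) := fun μ => (h1 μ).integrable.add (h2 μ).integrable
  rw [integral_finsetSum _ fun μ _ => h4 μ]
  refine Finset.sum_eq_zero fun μ _ => ?_
  rw [integral_add (h1 μ).integrable (h2 μ).integrable,
    integral_mul_fderiv_eq_neg_fderiv_mul_of_integrable (h1 μ).integrable (h2 μ).integrable
      (IsTest.smul_right (hξμ μ) hℓ).integrable, add_neg_cancel]
  · exact fun x _ => ((hξμ μ).contDiffAt x).differentiableAt (by simp)
  · exact fun x hx => (hℓ x ((hξμ μ).subset hx)).differentiableAt (by simp)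

/-- By the first variation the left side is the integral of the derivative of the Lagrangian along
`lieDeriv ξ ψ`. Infinitesimal covariance makes that integrand the divergence `∂_μ (ξ^μ L)`, which
has compact support. -/
theorem VectorTensorTheory.diffeo_identity (T : VectorTensorTheory) {V : Set Event} (hV : IsOpen V)
    {ψ : FieldConfig} (hψ : IsSmoothConfig ψ V) {ξ : Event → Event} (hξ : IsTest V ξ) :
    ∫ x, volDensity (ψ x) * pairing (ψ x) (lieDeriv ξ ψ x) (T.fieldEq (jet 2 ψ x)) = 0 := by
  have hδ := isTest_lieDeriv (fun x => contDiffAt_of_isSmoothConfig hV hψ) hξ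
  have h1 := T.firstVariation hV hψ hδ
  rw [setIntegral_eq_integral_of_forall_compl_eq_zero (fun x hx => by
    rw [image_eq_zero_of_notMem_tsupport hx, pairing_zero]; simp),
    setIntegral_eq_integral_of_forall_compl_eq_zero (fun x hx => by
    rw [jet_eq_zero_of_notMem_tsupport _ hx, map_zero])] at h1
  rw [h1, ← integral_divergence_eq_zero hξ (ℓ := fun y => T.lagrangian (jet T.order ψ y))]
  · refine integral_congr_ae (Eventually.of_forall fun x => ?_)
    by_cases hx : x ∈ V
    · exact T.lagrangian_lieDeriv hV hψ hξ.contDiff hx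
    · have hx1 : x ∉ tsupport (lieDeriv ξ ψ) := fun h => hx (hδ.subset h)
      have hx2 : x ∉ tsupport ξ := fun h => hx (hξ.subset h)
      have h2 : ∀ μ, partialDeriv μ (fun y => ξ y μ) x = 0 := by
        intro μ
        rw [partialDeriv_component hξ.contDiff, fderiv_of_notMem_tsupport (𝕜 := ℝ) hx2]
        rfl
      simp [jet_eq_zero_of_notMem_tsupport _ hx1, h2, image_eq_zero_of_notMem_tsupport hx2]
  · intro x hx
    have h2 := (T.lagrangian_smooth (jet T.order ψ x) (hψ.2 x hx)).contDiffAt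
      ((isOpen_lorentzianJets _).mem_nhds (hψ.2 x hx))
    exact h2.comp x (contDiffAt_jet _ (contDiffAt_of_isSmoothConfig hV hψ hx))

/-! ### Linearization -/

theorem eventually_isSmoothConfig {U : Set Event} (hU : IsOpen U) {ψ φ : FieldConfig}
    (hψ : IsSmoothConfig ψ U) (hφ : IsTest U φ) :
    ∀ᶠ s in 𝓝 (0 : ℝ), IsSmoothConfig (ψ + s • φ) U := by
  have h1 : ∀ᶠ s in 𝓝 (0 : ℝ), ∀ x ∈ tsupport φ, (s, x) ∈ lorentzianDomain 0 U ψ φ :=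
    hφ.isCompact.eventually_forall_of_forall_eventually fun x hx =>
      (isOpen_lorentzianDomain 0 hU hψ hφ).mem_nhds (zero_mem_lorentzianDomain 0 hψ (hφ.subset hx))
  filter_upwards [h1] with s hs
  refine ⟨hψ.1.add (hφ.contDiff.contDiffOn.const_smul s), fun x hx => ?_⟩
  by_cases hxφ : x ∈ tsupport φ
  · have h2 := (hs x hxφ).2
    rw [← jet_line 0 hU hψ hφ hx s] at h2
    exact h2
  · have : (ψ + s • φ) x = ψ x := by
      simp [image_eq_zero_of_notMem_tsupport hxφ]
    rw [this]
    exact hψ.2 x hx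

/-- If the field equations hold for `ψ`, an off-shell identity between the field equations
linearizes to the same identity between the linearized field equations. -/
theorem VectorTensorTheory.linearized_identity (T : VectorTensorTheory) {U : Set Event}
    (hU : IsOpen U) {ψ φ δ₀ δ₁ : FieldConfig} (hψ : IsSmoothConfig ψ U)
    (hE : ∀ x ∈ U, T.fieldEq (jet 2 ψ x) = 0) (hφ : IsTest U φ) (hδ₀ : IsTest U δ₀)
    (hδ₁ : IsTest U δ₁)
    (hN : ∀ s : ℝ, IsSmoothConfig (ψ + s • φ) U →
      ∫ x, volDensity ((ψ + s • φ) x) * pairing ((ψ + s • φ) x) (δ₀ x + s • δ₁ x)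
        (T.fieldEq (jet 2 (ψ + s • φ) x)) = 0) :
    ∫ x, volDensity (ψ x) * pairing (ψ x) (δ₀ x) (linearizedFieldEq T ψ φ x) = 0 := by
  set K := tsupport δ₀ ∪ tsupport δ₁
  have hK : IsCompact K := hδ₀.isCompact.union hδ₁.isCompact
  have hKU : K ⊆ U := union_subset hδ₀.subset hδ₁.subset
  let c : ℝ → Event → (FieldValue →L[ℝ] ℝ) := fun s x =>
    volDensity (ψ x + s • φ x) • pairing (ψ x + s • φ x) (δ₀ x + s • δ₁ x)
  have hc : ∀ p ∈ lorentzianDomain 2 U ψ φ,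
      ContDiffAt ℝ ∞ (fun p : ℝ × Event => c p.1 p.2) p := by
    rintro p ⟨hpU, hpL⟩
    have hpL : IsLorentzian (ψ p.2 + p.1 • φ p.2) := hpL
    have a1 : ContDiffAt ℝ ∞ (fun p : ℝ × Event => ψ p.2 + p.1 • φ p.2) p :=
      ((contDiffAt_of_isSmoothConfig hU hψ hpU).comp p contDiffAt_snd).add
        (contDiffAt_fst.fun_smul ((hφ.contDiffAt _).comp p contDiffAt_snd))
    have a2 : ContDiffAt ℝ ∞ (fun p : ℝ × Event => δ₀ p.2 + p.1 • δ₁ p.2) p :=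
      ((hδ₀.contDiffAt _).comp p contDiffAt_snd).add
        (contDiffAt_fst.fun_smul ((hδ₁.contDiffAt _).comp p contDiffAt_snd))
    exact ((contDiffAt_volDensity hpL).comp p a1).fun_smul
      (ContDiffAt.comp (g := fun q : FieldValue × FieldValue => pairing q.1 q.2) p
        (contDiffAt_pairing hpL _) (a1.prodMk a2))
  have h1 := hasDerivAt_integral_of_contDiffOn hK (isOpen_lorentzianDomain 2 hU hψ hφ)
    (fun x hx => zero_mem_lorentzianDomain 2 hψ (hKU hx))
    (h := fun s x => c s x (T.fieldEq (jet 2 ψ x + s • jet 2 φ x)))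
    (ContDiffOn.of_le (n := ∞) (ContDiffOn.clm_apply (fun p hp => (hc p hp).contDiffWithinAt)
      (contDiffOn_comp_jet_line hU hψ hφ T.fieldEq_smooth)) (by simp))
  have h2 : (fun s : ℝ => ∫ x in K, c s x (T.fieldEq (jet 2 ψ x + s • jet 2 φ x))) =ᶠ[𝓝 0]
      fun _ => 0 := by
    filter_upwards [eventually_isSmoothConfig hU hψ hφ] with s hs
    rw [← hN s hs]
    have e1 : ∫ x, volDensity ((ψ + s • φ) x) * pairing ((ψ + s • φ) x) (δ₀ x + s • δ₁ x)
        (T.fieldEq (jet 2 (ψ + s • φ) x)) = ∫ x in K, volDensity ((ψ + s • φ) x) *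
          pairing ((ψ + s • φ) x) (δ₀ x + s • δ₁ x) (T.fieldEq (jet 2 (ψ + s • φ) x)) := by
      refine (setIntegral_eq_integral_of_forall_compl_eq_zero fun x hx => ?_).symm
      rw [mem_union, not_or] at hx
      simp [image_eq_zero_of_notMem_tsupport hx.1, image_eq_zero_of_notMem_tsupport hx.2,
        pairing_zero]
    rw [e1]
    refine setIntegral_congr_fun hK.measurableSet fun x hx => ?_
    simp only [jet_line 2 hU hψ hφ (hKU hx)]
    rfl
  have h3 := h1.unique ((hasDerivAt_const (0 : ℝ) (0 : ℝ)).congr_of_eventuallyEq h2)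
  rw [← h3]
  rw [← setIntegral_eq_integral_of_forall_compl_eq_zero (s := K) fun x hx => by
    rw [mem_union, not_or] at hx
    rw [image_eq_zero_of_notMem_tsupport hx.1, pairing_zero]; simp]
  refine setIntegral_congr_fun hK.measurableSet fun x hx => ?_
  have d1 : HasDerivAt (fun s => c s x) (deriv (fun s => c s x) 0) 0 := by
    have := (hc (0, x) (zero_mem_lorentzianDomain 2 hψ (hKU hx))).comp (0 : ℝ)
      (contDiff_prodMk_left x).contDiffAt
    exact (this.differentiableAt (by simp)).hasDerivAt
  have d2 := hasDerivAt_comp_jet_line (δ := φ) hψ T.fieldEq_smooth (hKU hx)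
  have d3 := (d1.clm_apply d2).deriv
  refine (d3.trans ?_).symm
  -- In the product rule, the term that differentiates the volume density, the pairing and the
  -- variation multiplies the background field equations, which vanish.
  rw [ zero_smul, add_zero, hE x (hKU hx), map_zero, zero_add]
  simp [c, linearizedFieldEq]

/-- Linearity in the fields puts the variation for `ψ + s φ` into the form `δ₀ + s δ₁` required by
`linearized_identity`. -/
theorem lieDeriv_add_smul {ξ : Event → Event} {ψ φ : FieldConfig} {x : Event}
    (hψ : ContDiffAt ℝ ∞ ψ x) (hφ : ContDiffAt ℝ ∞ φ x) (s : ℝ) :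
    lieDeriv ξ (ψ + s • φ) x = lieDeriv ξ ψ x + s • lieDeriv ξ φ x := by
  have h1 : fderiv ℝ (ψ + s • φ) x = fderiv ℝ ψ x + s • fderiv ℝ φ x :=
    ((hψ.differentiableAt (by simp)).hasFDerivAt.add
      ((hφ.differentiableAt (by simp)).hasFDerivAt.const_smul s)).fderiv
  refine Prod.ext (funext fun e => ?_) (funext fun μ => ?_)
  · induction e using Sym2.ind with
    | _ μ ν =>
      rw [Prod.fst_add, Pi.add_apply, Prod.smul_fst, Pi.smul_apply, lieDeriv_fst, lieDeriv_fst,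
        lieDeriv_fst, h1]
      simp only [_root_.add_apply, _root_.smul_apply, Prod.fst_add, Prod.smul_fst, Pi.add_apply,
        Pi.smul_apply, smul_eq_mul, mul_add, Finset.sum_add_distrib, Finset.mul_sum]
      simp only [mul_left_comm s]
      ring
  · rw [Prod.snd_add, Pi.add_apply, Prod.smul_snd, Pi.smul_apply, lieDeriv_snd, lieDeriv_snd,
        lieDeriv_snd, h1]
    simp only [_root_.add_apply, _root_.smul_apply, Prod.snd_add, Prod.smul_snd, Pi.add_apply,
        Pi.smul_apply, smul_eq_mul, mul_add, Finset.sum_add_distrib, Finset.mul_sum]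
    simp only [mul_left_comm s]
    ring

theorem VectorTensorTheory.linearized_gauge_identity (T : VectorTensorTheory)
    (hT : T.HasMaxwellSymmetry) {U : Set Event} (hU : IsOpen U) {ψ φ : FieldConfig}
    (hψ : IsSmoothConfig ψ U) (hE : ∀ x ∈ U, T.fieldEq (jet 2 ψ x) = 0) (hφ : IsTest U φ)
    {χ : Event → ℝ} (hχ : IsTest U χ) :
    ∫ x, volDensity (ψ x) * pairing (ψ x) (0, fun μ => partialDeriv μ χ x)
      (linearizedFieldEq T ψ φ x) = 0 := by
  refine T.linearized_identity hU hψ hE hφ (isTest_gaugeVariation hχ)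
    (δ₁ := fun _ => 0) isTest_zero fun s hs => ?_
  simp only [smul_zero, add_zero]
  exact T.gauge_identity hT hU hs hχ

theorem VectorTensorTheory.linearized_diffeo_identity (T : VectorTensorTheory) {U : Set Event}
    (hU : IsOpen U) {ψ φ : FieldConfig} (hψ : IsSmoothConfig ψ U)
    (hE : ∀ x ∈ U, T.fieldEq (jet 2 ψ x) = 0) (hφ : IsTest U φ) {ξ : Event → Event}
    (hξ : IsTest U ξ) :
    ∫ x, volDensity (ψ x) * pairing (ψ x) (lieDeriv ξ ψ x) (linearizedFieldEq T ψ φ x) = 0 := by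
  have hψ' : ∀ x ∈ U, ContDiffAt ℝ ∞ ψ x := fun x hx => contDiffAt_of_isSmoothConfig hU hψ hx
  have h1 := isTest_lieDeriv hψ' hξ
  have h2 := isTest_lieDeriv (fun x _ => hφ.contDiffAt x) hξ
  refine T.linearized_identity hU hψ hE hφ h1 h2 fun s hs => ?_
  rw [← T.diffeo_identity hU hs hξ]
  refine integral_congr_ae (Eventually.of_forall fun x => ?_)
  by_cases hx : x ∈ U
  · simp only [lieDeriv_add_smul (hψ' x hx) (hφ.contDiffAt x)]
  · have h3 := isTest_lieDeriv (fun x hx => contDiffAt_of_isSmoothConfig hU hs hx) hξ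
    simp only [image_eq_zero_of_notMem_tsupport fun h => hx (h1.subset h),
      image_eq_zero_of_notMem_tsupport fun h => hx (h2.subset h),
      image_eq_zero_of_notMem_tsupport fun h => hx (h3.subset h), smul_zero, add_zero]

/-! ### The adjoint of a second-order operator -/

section PD

variable {Y Z : Type} [NormedAddCommGroup Y] [NormedSpace ℝ Y] [NormedAddCommGroup Z]
  [NormedSpace ℝ Z]

/-- The partial derivative of a vector-valued function. -/
def pd (μ : Fin 4) (f : Event → Y) (x : Event) : Y := fderiv ℝ f x (coordVec μ)

theorem contDiffAt_pd {f : Event → Y} {x : Event} (h : ContDiffAt ℝ ∞ f x) (μ : Fin 4) :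
    ContDiffAt ℝ ∞ (pd μ f) x :=
  (h.fderiv_right (m := ∞) le_rfl).clm_apply contDiffAt_const

theorem IsTest.pd {U : Set Event} {f : Event → Y} (hf : IsTest U f) (μ : Fin 4) :
    IsTest U (pd μ f) := hf.fderiv_apply _

theorem pd_add {f g : Event → Y} {x : Event} (hf : ContDiffAt ℝ ∞ f x) (hg : ContDiffAt ℝ ∞ g x)
    (μ : Fin 4) : pd μ (fun y => f y + g y) x = pd μ f x + pd μ g x := by
  rw [pd, fderiv_fun_add (hf.differentiableAt (by simp)) (hg.differentiableAt (by simp))]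
  rfl

theorem pd_smul {χ : Event → ℝ} {f : Event → Y} {x : Event} (hχ : ContDiffAt ℝ ∞ χ x)
    (hf : ContDiffAt ℝ ∞ f x) (μ : Fin 4) :
    pd μ (fun y => χ y • f y) x = χ x • pd μ f x + pd μ χ x • f x := by
  rw [pd, fderiv_fun_smul (hχ.differentiableAt (by simp)) (hf.differentiableAt (by simp))]
  rfl

theorem pd_congr {f g : Event → Y} {x : Event} (h : f =ᶠ[𝓝 x] g) (μ : Fin 4) :
    pd μ f x = pd μ g x := by
  rw [pd, h.fderiv_eq]; rfl

theorem IsTest.clm_apply {U : Set Event} {c : Event → (Y →L[ℝ] Z)} (hc : IsTest U c)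
    {g : Event → Y} (hg : ∀ x ∈ U, ContDiffAt ℝ ∞ g x) : IsTest U (fun x => c x (g x)) :=
  hc.of_left (fun x hx => (hc.contDiffAt x).clm_apply (hg x hx)) fun x hx => by
    rw [image_eq_zero_of_notMem_tsupport hx]; rfl

theorem IsTest.clm_comp {X : Type} [NormedAddCommGroup X] [NormedSpace ℝ X] {U : Set Event}
    {c : Event → (Y →L[ℝ] Z)} (hc : IsTest U c) (e : X →L[ℝ] Y) :
    IsTest U (fun x => (c x).comp e) :=
  hc.of_left (fun x _ => (hc.contDiffAt x).clm_comp contDiffAt_const) fun x hx => by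
    rw [image_eq_zero_of_notMem_tsupport hx]; rfl

theorem integral_clm_pd {U : Set Event} {c : Event → (Y →L[ℝ] ℝ)} (hc : IsTest U c)
    {g : Event → Y} (hg : ContDiff ℝ ∞ g) (μ : Fin 4) :
    ∫ x, c x (pd μ g x) = -∫ x, pd μ c x (g x) := by
  refine integral_bilinear_fderiv_right_eq_neg_left_of_integrable
    (B := ContinuousLinearMap.id ℝ (Y →L[ℝ] ℝ)) ?_ ?_ ?_ ?_ ?_
  · exact ((hc.pd μ).clm_apply fun x _ => hg.contDiffAt).integrable
  · exact (hc.clm_apply fun x _ => contDiffAt_pd hg.contDiffAt μ).integrable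
  · exact (hc.clm_apply fun x _ => hg.contDiffAt).integrable
  · exact fun x _ => (hc.contDiffAt x).differentiableAt (by simp)
  · exact fun x _ => hg.contDiffAt.differentiableAt (by simp)

end PD

/-- The jet of order two whose only nonzero component is `m ↦ (∏ a, (m a)_{I a}) w`, of order `i`. -/
def jetMonomial (i : Fin 3) (I : Fin (i : ℕ) → Fin 4) : FieldValue →L[ℝ] Jet 2 :=
  (ContinuousLinearMap.single ℝ
    (fun i : Fin 3 => ContinuousMultilinearMap ℝ (fun _ : Fin (i : ℕ) => Event) FieldValue) i).comp
  (ContinuousMultilinearMap.smulRightL ℝ (fun _ : Fin (i : ℕ) => Event) FieldValue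
    ((ContinuousMultilinearMap.mkPiAlgebra ℝ (Fin (i : ℕ)) ℝ).compContinuousLinearMap
      fun a => ContinuousLinearMap.proj (I a)))

theorem multilinear_eq_sum {n : ℕ} (f : ContinuousMultilinearMap ℝ (fun _ : Fin n => Event) FieldValue) :
    f = ∑ I : Fin n → Fin 4, ContinuousMultilinearMap.smulRightL ℝ (fun _ : Fin n => Event) FieldValue
      ((ContinuousMultilinearMap.mkPiAlgebra ℝ (Fin n) ℝ).compContinuousLinearMap
        fun a => ContinuousLinearMap.proj (I a)) (f fun a => coordVec (I a)) := by
  refine ContinuousMultilinearMap.ext fun m => ?_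
  have h : m = fun a => ∑ μ, m a μ • coordVec μ := by
    funext a ν
    simp [coordVec, Pi.single_apply, Finset.sum_apply]
  conv_lhs => rw [h]
  rw [ContinuousMultilinearMap.map_sum, _root_.sum_apply]
  refine Finset.sum_congr rfl fun I _ => ?_
  rw [ContinuousMultilinearMap.map_smul_univ]
  rfl

theorem jet_eq_sum (φ : FieldConfig) (x : Event) :
    jet 2 φ x = ∑ i : Fin 3, ∑ I : Fin (i : ℕ) → Fin 4,
      jetMonomial i I (iteratedFDeriv ℝ i φ x fun a => coordVec (I a)) := by
  have h : ∀ j : Jet 2, j = ∑ i : Fin 3, ContinuousLinearMap.single ℝ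
    (fun i : Fin 3 => ContinuousMultilinearMap ℝ (fun _ : Fin (i : ℕ) => Event) FieldValue) i (j i) :=
    fun j => (Finset.univ_sum_single j).symm
  conv_lhs => rw [h (jet 2 φ x)]
  refine Finset.sum_congr rfl fun i _ => ?_
  rw [jet, multilinear_eq_sum (iteratedFDeriv ℝ i φ x), map_sum]
  rw [← multilinear_eq_sum (iteratedFDeriv ℝ i φ x)]
  rfl

theorem iteratedFDeriv_two_coordVec {φ : FieldConfig} {x : Event} (hφ : ContDiffAt ℝ ∞ φ x)
    (μ ν : Fin 4) :
    iteratedFDeriv ℝ 2 φ x ![coordVec μ, coordVec ν] = pd μ (pd ν φ) x := by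
  rw [iteratedFDeriv_two_apply]
  have h : HasFDerivAt (fun y => fderiv ℝ φ y) (fderiv ℝ (fderiv ℝ φ) x) x :=
    ((hφ.fderiv_right (m := ∞) le_rfl).differentiableAt (by simp)).hasFDerivAt
  have h2 := h.clm_apply (hasFDerivAt_const (coordVec ν) x)
  have h3 : fderiv ℝ (pd ν φ) x = _ := h2.fderiv
  rw [pd, h3]
  simp

/-- The inclusion of field values into jets. -/
def jetZero : FieldValue →L[ℝ] Jet 2 := jetMonomial 0 fun _ => 0

/-- The inclusion of the first derivative along `∂_μ` into jets. -/
def jetOne (μ : Fin 4) : FieldValue →L[ℝ] Jet 2 := jetMonomial 1 fun _ => μ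

/-- The inclusion of the second derivative along `∂_μ`, `∂_ν` into jets. -/
def jetTwo (μ ν : Fin 4) : FieldValue →L[ℝ] Jet 2 := jetMonomial 2 ![μ, ν]

/-- This resolves an operator on jets into coefficients of `φ`, `∂_μ φ` and `∂_μ ∂_ν φ`, which can
be integrated by parts one coordinate at a time. The double sum runs over ordered pairs, so no
symmetry factor appears. -/
theorem jet_eq {φ : FieldConfig} {x : Event} (hφ : ContDiffAt ℝ ∞ φ x) :
    jet 2 φ x = jetZero (φ x) + ∑ μ, jetOne μ (pd μ φ x) + ∑ μ, ∑ ν, jetTwo μ ν (pd μ (pd ν φ) x) := by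
  rw [jet_eq_sum, Fin.sum_univ_three]
  congr 1
  · congr 1
    · have hu : ∀ I : Fin ((0 : Fin 3) : ℕ) → Fin 4, I = fun _ => 0 := fun I =>
        funext fun a => Fin.elim0 a
      rw [Fintype.sum_eq_single (fun _ => 0) fun I hI => absurd (hu I) hI]
      rfl
    · refine Fintype.sum_equiv (Equiv.funUnique (Fin 1) (Fin 4)) _ _ fun I => ?_
      change jetMonomial 1 I (iteratedFDeriv ℝ 1 φ x fun a => coordVec (I a)) = _
      rw [iteratedFDeriv_one_apply, jetOne]
      congr 2
      funext a
      rw [Subsingleton.elim a 0]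
      rfl
  · rw [← Fintype.sum_prod_type' (f := fun μ ν => jetTwo μ ν (pd μ (pd ν φ) x))]
    refine Fintype.sum_equiv (finTwoArrowEquiv (Fin 4)) _ _ fun I => ?_
    have h1 : (fun a => coordVec (I a)) = ![coordVec (I 0), coordVec (I 1)] := by
      funext a; fin_cases a <;> rfl
    have h2 : I = ![I 0, I 1] := by
      funext a; fin_cases a <;> rfl
    change jetMonomial 2 I (iteratedFDeriv ℝ 2 φ x fun a => coordVec (I a)) =
      jetTwo (I 0) (I 1) (pd (I 0) (pd (I 1) φ) x)
    rw [h1, iteratedFDeriv_two_coordVec hφ, jetTwo, ← h2]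

/-- The adjoint, with respect to `d⁴x`, of the operator `φ ↦ B(x)(jet 2 φ x)`, applied to `1`. -/
def adjJet (B : Event → (Jet 2 →L[ℝ] ℝ)) (x : Event) : FieldValue →L[ℝ] ℝ :=
  (B x).comp jetZero - ∑ μ, pd μ (fun y => (B y).comp (jetOne μ)) x +
    ∑ μ, ∑ ν, pd ν (pd μ fun y => (B y).comp (jetTwo μ ν)) x

section Adjoint

variable {U : Set Event} {B : Event → (Jet 2 →L[ℝ] ℝ)}

theorem adjJet_eq_zero {x : Event} (hx : x ∉ tsupport B) : adjJet B x = 0 := by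
  have h1 : B =ᶠ[𝓝 x] 0 := notMem_tsupport_iff_eventuallyEq.1 hx
  have h2 : ∀ {X : Type} [NormedAddCommGroup X] [NormedSpace ℝ X] (e : X →L[ℝ] Jet 2),
      (fun y => (B y).comp e) =ᶠ[𝓝 x] fun _ => 0 := by
    intro X _ _ e
    filter_upwards [h1] with y hy
    rw [hy]; rfl
  have h3 : ∀ (μ : Fin 4) (c : Event → (FieldValue →L[ℝ] ℝ)), (c =ᶠ[𝓝 x] fun _ => 0) →
      pd μ c =ᶠ[𝓝 x] fun _ => 0 := by
    intro μ c hc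
    have hz : pd μ (fun _ : Event => (0 : FieldValue →L[ℝ] ℝ)) = fun _ => 0 := by
      funext y; simp [pd]
    rw [← hz]
    filter_upwards [hc.eventuallyEq_nhds] with y hy using pd_congr hy μ
  have h4 : (B x).comp jetZero = 0 := (h2 jetZero).eq_of_nhds
  rw [adjJet, h4]
  have h5 : ∀ μ, pd μ (fun y => (B y).comp (jetOne μ)) x = 0 := fun μ =>
    (h3 μ _ (h2 (jetOne μ))).eq_of_nhds
  have h6 : ∀ μ ν, pd ν (pd μ fun y => (B y).comp (jetTwo μ ν)) x = 0 := fun μ ν =>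
    (h3 ν _ (h3 μ _ (h2 (jetTwo μ ν)))).eq_of_nhds
  simp [h5, h6]

theorem IsTest.adjJet (hB : IsTest U B) : IsTest U (adjJet B) := by
  refine hB.of_left (fun x _ => ?_) fun x hx => adjJet_eq_zero hx
  refine ContDiffAt.add (ContDiffAt.sub ((hB.clm_comp jetZero).contDiffAt x) ?_) ?_
  · exact ContDiffAt.sum fun μ _ => ((hB.clm_comp (jetOne μ)).pd μ).contDiffAt x
  · exact ContDiffAt.sum fun μ _ => ContDiffAt.sum fun ν _ =>
      (((hB.clm_comp (jetTwo μ ν)).pd μ).pd ν).contDiffAt x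

theorem integral_adjJet (hB : IsTest U B) {φ : FieldConfig} (hφ : ContDiff ℝ ∞ φ) :
    ∫ x, adjJet B x (φ x) = ∫ x, B x (jet 2 φ x) := by
  have hp : ∀ μ, ContDiff ℝ ∞ (pd μ φ) := fun μ =>
    contDiff_iff_contDiffAt.2 fun x => contDiffAt_pd hφ.contDiffAt μ
  have hpp : ∀ μ ν, ContDiff ℝ ∞ (pd μ (pd ν φ)) := fun μ ν =>
    contDiff_iff_contDiffAt.2 fun x => contDiffAt_pd (hp ν).contDiffAt μ
  have i0 : Integrable fun x => (B x).comp jetZero (φ x) :=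
    ((hB.clm_comp jetZero).clm_apply fun x _ => hφ.contDiffAt).integrable
  have i1 : ∀ μ, Integrable fun x => (B x).comp (jetOne μ) (pd μ φ x) := fun μ =>
    ((hB.clm_comp (jetOne μ)).clm_apply fun x _ => (hp μ).contDiffAt).integrable
  have i2 : ∀ μ ν, Integrable fun x => (B x).comp (jetTwo μ ν) (pd μ (pd ν φ) x) := fun μ ν =>
    ((hB.clm_comp (jetTwo μ ν)).clm_apply fun x _ => (hpp μ ν).contDiffAt).integrable
  have j1 : ∀ μ, Integrable fun x => pd μ (fun y => (B y).comp (jetOne μ)) x (φ x) := fun μ =>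
    (((hB.clm_comp (jetOne μ)).pd μ).clm_apply fun x _ => hφ.contDiffAt).integrable
  have j2 : ∀ μ ν, Integrable fun x => pd ν (pd μ fun y => (B y).comp (jetTwo μ ν)) x (φ x) :=
    fun μ ν => ((((hB.clm_comp (jetTwo μ ν)).pd μ).pd ν).clm_apply
      fun x _ => hφ.contDiffAt).integrable
  have hL : ∀ x, adjJet B x (φ x) = (B x).comp jetZero (φ x) -
      ∑ μ, pd μ (fun y => (B y).comp (jetOne μ)) x (φ x) +
      ∑ μ, ∑ ν, pd ν (pd μ fun y => (B y).comp (jetTwo μ ν)) x (φ x) := by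
    intro x
    simp only [SmallBody.adjJet, _root_.add_apply, _root_.sub_apply, _root_.sum_apply]
  have hR : ∀ x, B x (jet 2 φ x) = (B x).comp jetZero (φ x) +
      ∑ μ, (B x).comp (jetOne μ) (pd μ φ x) +
      ∑ μ, ∑ ν, (B x).comp (jetTwo μ ν) (pd μ (pd ν φ) x) := by
    intro x
    rw [jet_eq hφ.contDiffAt]
    simp only [map_add, map_sum, ContinuousLinearMap.comp_apply]
  simp only [hL, hR]
  have s1 : Integrable fun x => ∑ μ, (B x).comp (jetOne μ) (pd μ φ x) :=
    integrable_finsetSum _ fun μ _ => i1 μ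
  have s2 : Integrable fun x => ∑ μ, ∑ ν, (B x).comp (jetTwo μ ν) (pd μ (pd ν φ) x) :=
    integrable_finsetSum _ fun μ _ => integrable_finsetSum _ fun ν _ => i2 μ ν
  have t1 : Integrable fun x => ∑ μ, pd μ (fun y => (B y).comp (jetOne μ)) x (φ x) :=
    integrable_finsetSum _ fun μ _ => j1 μ
  have t2 : Integrable fun x =>
      ∑ μ, ∑ ν, pd ν (pd μ fun y => (B y).comp (jetTwo μ ν)) x (φ x) :=
    integrable_finsetSum _ fun μ _ => integrable_finsetSum _ fun ν _ => j2 μ ν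
  have u1 : Integrable fun x => (B x).comp jetZero (φ x) +
      ∑ μ, (B x).comp (jetOne μ) (pd μ φ x) := i0.add s1
  have u2 : Integrable fun x => (B x).comp jetZero (φ x) -
      ∑ μ, pd μ (fun y => (B y).comp (jetOne μ)) x (φ x) := i0.sub t1
  rw [integral_add u2 t2, integral_add u1 s2, integral_sub i0 t1, integral_add i0 s1,
    integral_finsetSum _ fun μ _ => i1 μ, integral_finsetSum _ fun μ _ => j1 μ,
    integral_finsetSum _ fun μ _ => integrable_finsetSum _ fun ν _ => i2 μ ν,
    integral_finsetSum _ fun μ _ => integrable_finsetSum _ fun ν _ => j2 μ ν]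
  congr 1
  · rw [sub_eq_add_neg, ← Finset.sum_neg_distrib]
    congr 1
    exact Finset.sum_congr rfl fun μ _ => (integral_clm_pd (hB.clm_comp (jetOne μ)) hφ μ).symm
  · refine Finset.sum_congr rfl fun μ _ => ?_
    rw [integral_finsetSum _ fun ν _ => i2 μ ν, integral_finsetSum _ fun ν _ => j2 μ ν]
    refine Finset.sum_congr rfl fun ν _ => ?_
    rw [integral_clm_pd (hB.clm_comp (jetTwo μ ν)) (hp ν) μ,
      integral_clm_pd ((hB.clm_comp (jetTwo μ ν)).pd μ) hφ ν, neg_neg]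

theorem adjJet_add {B' : Event → (Jet 2 →L[ℝ] ℝ)} (hB : IsTest U B) (hB' : IsTest U B')
    (x : Event) : adjJet (fun y => B y + B' y) x = adjJet B x + adjJet B' x := by
  have h1 : ∀ μ, pd μ (fun y => (B y).comp (jetOne μ) + (B' y).comp (jetOne μ)) x = _ := fun μ =>
    pd_add ((hB.clm_comp (jetOne μ)).contDiffAt x) ((hB'.clm_comp (jetOne μ)).contDiffAt x) μ
  have h2 : ∀ μ ν, pd ν (pd μ fun y => (B y).comp (jetTwo μ ν) + (B' y).comp (jetTwo μ ν)) x =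
      pd ν (pd μ fun y => (B y).comp (jetTwo μ ν)) x +
        pd ν (pd μ fun y => (B' y).comp (jetTwo μ ν)) x := by
    intro μ ν
    rw [← pd_add (((hB.clm_comp (jetTwo μ ν)).pd μ).contDiffAt x)
      (((hB'.clm_comp (jetTwo μ ν)).pd μ).contDiffAt x)]
    congr 1
    funext y
    exact pd_add ((hB.clm_comp (jetTwo μ ν)).contDiffAt y)
      ((hB'.clm_comp (jetTwo μ ν)).contDiffAt y) μ
  simp only [adjJet, ContinuousLinearMap.add_comp, h1, h2, Finset.sum_add_distrib]
  abel

/-- The Leibniz rule sorts the terms by the number of derivatives that fall on the cutoff. Terms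
with two of them are the most singular, and they contain `B` undifferentiated; this is where
vanishing of `B` on the worldline helps. -/
theorem adjJet_cutoff {χ : Event → ℝ} (hχ : ContDiff ℝ ∞ χ) (hB : IsTest U B) (x : Event) :
    adjJet (fun y => χ y • B y) x = χ x • adjJet B x
      - ∑ μ, pd μ χ x • (B x).comp (jetOne μ)
      + ∑ μ, ∑ ν, (pd ν χ x • pd μ (fun y => (B y).comp (jetTwo μ ν)) x +
          pd μ χ x • pd ν (fun y => (B y).comp (jetTwo μ ν)) x +
          pd ν (pd μ χ) x • (B x).comp (jetTwo μ ν)) := by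
  have hχμ : ∀ μ, ContDiff ℝ ∞ (pd μ χ) := fun μ =>
    contDiff_iff_contDiffAt.2 fun x => contDiffAt_pd hχ.contDiffAt μ
  have h1 : ∀ μ, pd μ (fun y => χ y • (B y).comp (jetOne μ)) x =
      χ x • pd μ (fun y => (B y).comp (jetOne μ)) x + pd μ χ x • (B x).comp (jetOne μ) :=
    fun μ => pd_smul hχ.contDiffAt ((hB.clm_comp (jetOne μ)).contDiffAt x) μ
  have h2 : ∀ μ ν, pd ν (pd μ fun y => χ y • (B y).comp (jetTwo μ ν)) x =
      χ x • pd ν (pd μ fun y => (B y).comp (jetTwo μ ν)) x +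
        (pd ν χ x • pd μ (fun y => (B y).comp (jetTwo μ ν)) x +
          pd μ χ x • pd ν (fun y => (B y).comp (jetTwo μ ν)) x +
          pd ν (pd μ χ) x • (B x).comp (jetTwo μ ν)) := by
    intro μ ν
    have hc := hB.clm_comp (jetTwo μ ν)
    have e1 : (pd μ fun y => χ y • (B y).comp (jetTwo μ ν)) = fun y =>
        χ y • pd μ (fun y => (B y).comp (jetTwo μ ν)) y + pd μ χ y • (B y).comp (jetTwo μ ν) := by
      funext y
      exact pd_smul hχ.contDiffAt (hc.contDiffAt y) μ
    rw [e1, pd_add (hχ.contDiffAt.fun_smul ((hc.pd μ).contDiffAt x))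
      ((hχμ μ).contDiffAt.fun_smul (hc.contDiffAt x)),
      pd_smul hχ.contDiffAt ((hc.pd μ).contDiffAt x),
      pd_smul (hχμ μ).contDiffAt (hc.contDiffAt x)]
    abel
  simp only [adjJet, ContinuousLinearMap.smul_comp, h1, h2, Finset.sum_add_distrib, smul_add,
    smul_sub, Finset.smul_sum]
  abel

end Adjoint

/-! ### The spatial part of an event -/

/-- The projection `(t, x) ↦ (0, x)`. -/
def spatial : Event →L[ℝ] Event :=
  ContinuousLinearMap.pi fun μ => if μ = 0 then 0 else ContinuousLinearMap.proj μ

theorem spatial_apply (x : Event) (μ : Fin 4) : spatial x μ = if μ = 0 then 0 else x μ := by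
  by_cases h : μ = 0 <;> simp [spatial, h]

theorem spatial_eq_zero_iff {x : Event} : spatial x = 0 ↔ x = worldline (x 0) := by
  constructor
  · intro h
    funext μ
    refine Fin.cases ?_ (fun i => ?_) μ
    · rfl
    · have := congrFun h i.succ
      rw [spatial_apply, if_neg (Fin.succ_ne_zero i)] at this
      rw [this]; rfl
  · intro h
    rw [h]
    funext μ
    refine Fin.cases ?_ (fun i => ?_) μ
    · rw [spatial_apply, if_pos rfl]; rfl
    · rw [spatial_apply, if_neg (Fin.succ_ne_zero i)]; rfl

theorem spatial_spatial (x : Event) : spatial (spatial x) = spatial x := by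
  funext μ
  by_cases h : μ = 0 <;> simp [spatial_apply, h]

/-- Distances from the worldline are measured below in the sup norm; this inequality converts bounds
in the Euclidean `radius`. -/
theorem norm_spatial_le_radius (x : Event) : ‖spatial x‖ ≤ radius x := by
  refine (pi_norm_le_iff_of_nonneg (Real.sqrt_nonneg _)).2 fun μ => ?_
  refine Fin.cases ?_ (fun i => ?_) μ
  · rw [spatial_apply, if_pos rfl, norm_zero]
    exact Real.sqrt_nonneg _
  · rw [spatial_apply, if_neg (Fin.succ_ne_zero i), Real.norm_eq_abs]
    refine Real.abs_le_sqrt ?_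
    exact Finset.single_le_sum (f := fun i : Fin 3 => x i.succ ^ 2) (fun j _ => sq_nonneg _)
      (Finset.mem_univ i)

theorem radius_pos_iff {x : Event} : 0 < radius x ↔ spatial x ≠ 0 := by
  constructor
  · intro h h0
    have h1 : ∀ i : Fin 3, x i.succ = 0 := by
      intro i
      have := congrFun h0 i.succ
      rwa [spatial_apply, if_neg (Fin.succ_ne_zero i)] at this
    simp [radius, h1] at h
  · intro h
    exact (norm_pos_iff.2 h).trans_le (norm_spatial_le_radius x)

theorem isOpen_spatial_ne_zero : IsOpen {x : Event | spatial x ≠ 0} :=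
  isOpen_ne_fun spatial.continuous continuous_const

theorem volume_coord_eq_zero (μ : Fin 4) : volume {x : Event | x μ = 0} = 0 :=
  Measure.pi_hyperplane (fun _ : Fin 4 => (volume : Measure ℝ)) μ 0

theorem volume_spatial_eq_zero : volume {x : Event | spatial x = 0} = 0 := by
  refine measure_mono_null (fun x hx => ?_) (volume_coord_eq_zero 1)
  have := congrFun hx 1
  rwa [spatial_apply, if_neg (by decide)] at this

theorem ae_spatial_ne_zero : ∀ᵐ x : Event, spatial x ≠ 0 := by
  rw [ae_iff]
  simpa using volume_spatial_eq_zero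

/-- The inverse square of the distance from the worldline is locally integrable. -/
theorem integrableOn_inv_sq_spatial {K : Set Event} (hK : IsCompact K) :
    IntegrableOn (fun x => (‖spatial x‖ ^ 2)⁻¹) K := by
  obtain ⟨R, hR⟩ := hK.isBounded.subset_closedBall (0 : Event)
  -- Each of the three spatial coordinates is at most `r`, so `r⁻²` is at most the product of the
  -- three factors `|x^i|^(-2/3)`. Each factor is locally integrable on the line because `2/3 < 1`,
  -- and a product of integrable functions of separate coordinates is integrable.
  have h1 : IntegrableOn (fun s : ℝ => |s| ^ (-(2 / 3) : ℝ)) (Icc (-R) R) := by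
    by_cases hR0 : -R ≤ R
    · rw [integrableOn_Icc_iff_integrableOn_Ioc, ← intervalIntegrable_iff_integrableOn_Ioc_of_le hR0]
      refine intervalIntegrable_of_even (f := fun s : ℝ => |s| ^ (-(2 / 3) : ℝ))
        (fun x => by rw [abs_neg]) (fun x hx => ?_)
      refine (intervalIntegral.intervalIntegrable_rpow' (r := -(2 / 3)) (by norm_num)).congr ?_
      intro s hs
      rw [uIoc_of_le hx.le] at hs
      simp only [abs_of_pos hs.1]
    · rw [Icc_eq_empty hR0]; exact integrableOn_empty
  let g : Fin 4 → ℝ → ℝ := fun μ => if μ = 0 then (Icc (-R) R).indicator fun _ => 1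
    else (Icc (-R) R).indicator fun s : ℝ => |s| ^ (-(2 / 3) : ℝ)
  have hg : ∀ μ, Integrable (g μ) := by
    intro μ
    by_cases h : μ = 0
    · simp only [g, h, if_true]
      rw [integrable_indicator_iff measurableSet_Icc]
      exact continuousOn_const.integrableOn_compact isCompact_Icc
    · simp only [g, h, if_false]
      rw [integrable_indicator_iff measurableSet_Icc]
      exact h1
  have h2 : Integrable fun x : Event => ∏ μ, g μ (x μ) := Integrable.fintype_prod hg
  refine (h2.integrableOn (s := K)).mono' ?_ ?_
  · exact (((spatial.continuous.norm.pow 2).measurable).inv).aestronglyMeasurable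
  · have h3 : ∀ᵐ x : Event, ∀ μ, x μ ≠ 0 := by
      rw [ae_all_iff]
      intro μ
      rw [ae_iff]
      simpa using volume_coord_eq_zero μ
    filter_upwards [ae_restrict_of_ae h3, ae_restrict_mem hK.measurableSet] with x hx hxK
    have hI : ∀ μ, x μ ∈ Icc (-R) R := by
      intro μ
      have h4 := norm_le_pi_norm x μ
      have h5 := hR hxK
      rw [mem_closedBall_zero_iff] at h5
      exact abs_le.1 (h4.trans h5)
    have hS : ∀ i : Fin 3, |x i.succ| ≤ ‖spatial x‖ := by
      intro i
      have h4 := norm_le_pi_norm (spatial x) i.succ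
      rwa [spatial_apply, if_neg (Fin.succ_ne_zero i)] at h4
    set r := ‖spatial x‖
    have hpos : ∀ i : Fin 3, 0 < |x i.succ| := fun i => abs_pos.2 (hx _)
    have hr : 0 < r := (hpos 0).trans_le (hS 0)
    rw [Real.norm_of_nonneg (by positivity), Fin.prod_univ_succ]
    have e1 : g 0 (x 0) = 1 := by simp only [g, if_true]; rw [indicator_of_mem (hI 0)]
    have e2 : ∀ i : Fin 3, g i.succ (x i.succ) = |x i.succ| ^ (-(2 / 3) : ℝ) := by
      intro i
      simp only [g, if_neg (Fin.succ_ne_zero i)]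
      rw [indicator_of_mem (hI _)]
    have e3 : ∀ i : Fin 3, r ^ (-(2 / 3) : ℝ) ≤ |x i.succ| ^ (-(2 / 3) : ℝ) := fun i =>
      Real.rpow_le_rpow_of_nonpos (hpos i) (hS i) (by norm_num)
    rw [e1, one_mul]
    calc (r ^ 2)⁻¹ = ∏ _i : Fin 3, r ^ (-(2 / 3) : ℝ) := by
          rw [Finset.prod_const, Finset.card_univ, Fintype.card_fin,
            ← Real.rpow_natCast (r ^ (-(2 / 3) : ℝ)), ← Real.rpow_mul hr.le, ← Real.rpow_natCast r,
            ← Real.rpow_neg hr.le]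
          norm_num
      _ ≤ ∏ i : Fin 3, |x i.succ| ^ (-(2 / 3) : ℝ) :=
          Finset.prod_le_prod (fun i _ => by positivity) fun i _ => e3 i
      _ = _ := by simp only [e2]

/-! ### Distributions defined by fields that are singular on the worldline -/

/-- Fields that are smooth away from the worldline and of order `1/r` there. -/
structure IsSingularField (U : Set Event) (φ : FieldConfig) : Prop where
  smooth : ∀ x ∈ U, spatial x ≠ 0 → ContDiffAt ℝ ∞ φ x
  bound : ∀ x ∈ U, ∃ C : ℝ, ∀ᶠ y in 𝓝 x, ‖spatial y‖ * ‖φ y‖ ≤ C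

section Singular

variable {U : Set Event} {φ : FieldConfig} {B : Event → (Jet 2 →L[ℝ] ℝ)}

theorem IsSingularField.bound_of_isCompact (hφ : IsSingularField U φ) {K : Set Event}
    (hK : IsCompact K) (hKU : K ⊆ U) : ∃ C : ℝ, ∀ y ∈ K, ‖spatial y‖ * ‖φ y‖ ≤ C := by
  refine hK.induction_on (p := fun K => ∃ C : ℝ, ∀ y ∈ K, ‖spatial y‖ * ‖φ y‖ ≤ C) ?_ ?_ ?_ ?_
  · exact ⟨0, fun y hy => absurd hy (notMem_empty y)⟩
  · rintro s t hst ⟨C, hC⟩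
    exact ⟨C, fun y hy => hC y (hst hy)⟩
  · rintro s t ⟨C, hC⟩ ⟨D, hD⟩
    refine ⟨max C D, fun y hy => ?_⟩
    rcases hy with hy | hy
    · exact (hC y hy).trans (le_max_left _ _)
    · exact (hD y hy).trans (le_max_right _ _)
  · intro x hx
    obtain ⟨C, hC⟩ := hφ.bound x (hKU hx)
    exact ⟨_, mem_nhdsWithin_of_mem_nhds hC, C, fun y hy => hy⟩

theorem IsSingularField.aestronglyMeasurable (hU : IsOpen U) (hφ : IsSingularField U φ)
    {A : Event → (FieldValue →L[ℝ] ℝ)} (hA : IsTest U A) :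
    AEStronglyMeasurable (fun x => A x (φ x)) := by
  set W : Set Event := U ∩ {x | spatial x ≠ 0}
  have hW : IsOpen W := hU.inter isOpen_spatial_ne_zero
  have h1 : ContinuousOn (fun x => A x (φ x)) W := fun x hx =>
    ((hA.contDiffAt x).continuousAt.clm_apply
      (hφ.smooth x hx.1 hx.2).continuousAt).continuousWithinAt
  have h2 := (aestronglyMeasurable_indicator_iff hW.measurableSet).2
    (h1.aestronglyMeasurable (μ := volume) hW.measurableSet)
  refine h2.congr ?_
  filter_upwards [ae_spatial_ne_zero] with x hx
  by_cases hxU : x ∈ U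
  · rw [indicator_of_mem (show x ∈ W from ⟨hxU, hx⟩)]
  · rw [indicator_of_notMem fun h : x ∈ W => hxU h.1,
      image_eq_zero_of_notMem_tsupport fun h => hxU (hA.subset h)]
    rfl

/-- Two factors of order `1/ρ` give `1/ρ²`. The coefficient is allowed this singularity because the
adjoint of an operator with a cutoff is bounded only in this weighted sense, uniformly in the
cutoff. -/
theorem norm_apply_le_of_mul_norm_le {A : FieldValue →L[ℝ] ℝ} {v : FieldValue} {ρ C D : ℝ}
    (hρ : 0 < ρ) (hA : ρ * ‖A‖ ≤ C) (hv : ρ * ‖v‖ ≤ D) : ‖A v‖ ≤ C * D * (ρ ^ 2)⁻¹ := by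
  have hC : 0 ≤ C := (by positivity : 0 ≤ ρ * ‖A‖).trans hA
  rw [← div_eq_mul_inv, le_div_iff₀ (by positivity)]
  calc ‖A v‖ * ρ ^ 2 ≤ (‖A‖ * ‖v‖) * ρ ^ 2 := by gcongr; exact A.le_opNorm v
    _ = (ρ * ‖A‖) * (ρ * ‖v‖) := by ring
    _ ≤ C * D := by gcongr

theorem IsTest.mul_norm_bound {Y : Type} [NormedAddCommGroup Y] [NormedSpace ℝ Y] {f : Event → Y}
    (hf : IsTest U f) : ∃ C : ℝ, ∀ x, ‖spatial x‖ * ‖f x‖ ≤ C := by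
  have hc : Continuous fun x => ‖spatial x‖ • f x :=
    spatial.continuous.norm.smul hf.contDiff.continuous
  obtain ⟨C, hC⟩ := hc.bounded_above_of_compact_support (hf.isCompact.of_isClosed_subset
    isClosed_closure (tsupport_smul_subset_right _ _))
  refine ⟨C, fun x => ?_⟩
  have := hC x
  rwa [norm_smul, norm_norm] at this

theorem IsSingularField.integrable (hU : IsOpen U) (hφ : IsSingularField U φ)
    {A : Event → (FieldValue →L[ℝ] ℝ)} (hA : IsTest U A) : Integrable (fun x => A x (φ x)) := by
  obtain ⟨D, hD⟩ := hφ.bound_of_isCompact hA.isCompact hA.subset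
  obtain ⟨C, hC⟩ := hA.mul_norm_bound
  have h1 : Integrable ((tsupport A).indicator fun x => C * D * (‖spatial x‖ ^ 2)⁻¹) := by
    rw [integrable_indicator_iff hA.isCompact.measurableSet]
    exact (integrableOn_inv_sq_spatial hA.isCompact).const_mul _
  refine h1.mono' (hφ.aestronglyMeasurable hU hA) ?_
  filter_upwards [ae_spatial_ne_zero] with x hx
  by_cases hxK : x ∈ tsupport A
  · rw [indicator_of_mem hxK]
    exact norm_apply_le_of_mul_norm_le (norm_pos_iff.2 hx) (hC x) (hD x hxK)
  · rw [indicator_of_notMem hxK, image_eq_zero_of_notMem_tsupport hxK]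
    simp

theorem exists_isTest_one_nhds {K : Set Event} (hU : IsOpen U) (hK : IsCompact K) (hKU : K ⊆ U) :
    ∃ η : Event → ℝ, IsTest U η ∧ ∀ x ∈ K, ∀ᶠ y in 𝓝 x, η y = 1 := by
  obtain ⟨K', hK', hKK', hK'U⟩ := exists_compact_between hK hU hKU
  obtain ⟨f, hf1, hf0, -⟩ := exists_contMDiffMap_one_nhds_of_subset_interior
    (n := (⊤ : ℕ∞)) (modelWithCornersSelf ℝ Event) hK.isClosed hKK'
  refine ⟨f, isTest_of_contDiffAt (fun x _ => f.contMDiff.contDiff.contDiffAt) hK' hK'U hf0,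
    fun x hx => ?_⟩
  exact hf1.filter_mono (nhds_le_nhdsSet hx)

/-- If `B` vanishes near the worldline and `B(jet φ) = 0`, then `φ` is annihilated by the
adjoint. -/
theorem IsSingularField.integral_adjJet_eq_zero_of_tsupport (hU : IsOpen U)
    (hφ : IsSingularField U φ) (hB : IsTest (U ∩ {x | spatial x ≠ 0}) B)
    (hBφ : ∀ x ∈ U, spatial x ≠ 0 → B x (jet 2 φ x) = 0) : ∫ x, adjJet B x (φ x) = 0 := by
  obtain ⟨η, hη, hη1⟩ := exists_isTest_one_nhds (hU.inter isOpen_spatial_ne_zero) hB.isCompact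
    hB.subset
  -- Integration by parts needs a smooth field. Multiplying `φ` by a function equal to one near the
  -- support of `B` produces one, without changing the jets there.
  have h1 : IsTest (U ∩ {x | spatial x ≠ 0}) fun x => η x • φ x :=
    hη.smul_right fun x hx => hφ.smooth x hx.1 hx.2
  have h2 : ∫ x, adjJet B x (φ x) = ∫ x, adjJet B x (η x • φ x) := by
    refine integral_congr_ae (Eventually.of_forall fun x => ?_)
    by_cases hx : x ∈ tsupport B
    · simp only [(hη1 x hx).self_of_nhds, one_smul]
    · simp only [adjJet_eq_zero hx, _root_.zero_apply]
  rw [h2, integral_adjJet hB h1.contDiff]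
  refine integral_eq_zero_of_ae (Eventually.of_forall fun x => ?_)
  by_cases hx : x ∈ tsupport B
  · have h3 : jet 2 (fun x => η x • φ x) x = jet 2 φ x := by
      refine jet_congr 2 ?_
      filter_upwards [hη1 x hx] with y hy
      rw [hy, one_smul]
    have hxU := hB.subset hx
    simp only [h3, hBφ x hxU.1 hxU.2, Pi.zero_apply]
  · simp only [image_eq_zero_of_notMem_tsupport hx, _root_.zero_apply, Pi.zero_apply]

end Singular

/-! ### Cutting off near the worldline -/

/-- A smooth bump function. -/
def bump : ContDiffBump (0 : Event) := ⟨1, 2, one_pos, one_lt_two⟩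

theorem contDiff_bump : ContDiff ℝ ∞ bump := bump.contDiff

/-- A cutoff equal to `1` for `n ‖x‖ ≤ 1` and to `0` for `n ‖x‖ ≥ 2`. -/
def cutoff (n : ℕ) (x : Event) : ℝ := bump ((n : ℝ) • spatial x)

theorem contDiff_cutoff (n : ℕ) : ContDiff ℝ ∞ (cutoff n) :=
  contDiff_bump.comp (spatial.contDiff.const_smul (n : ℝ))

theorem pd_comp_smul_spatial {Y : Type} [NormedAddCommGroup Y] [NormedSpace ℝ Y] {f : Event → Y}
    (hf : ContDiff ℝ ∞ f) (c : ℝ) (μ : Fin 4) (x : Event) :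
    pd μ (fun y => f (c • spatial y)) x = c • fderiv ℝ f (c • spatial x) (spatial (coordVec μ)) := by
  have h1 : HasFDerivAt (fun y => c • spatial y) (c • spatial) x := spatial.hasFDerivAt.const_smul c
  have h2 : HasFDerivAt (fun y => f (c • spatial y)) _ x :=
    ((hf.differentiable (by simp)) _).hasFDerivAt.comp x h1
  rw [pd, h2.fderiv]
  simp

theorem pd_cutoff (n : ℕ) (μ : Fin 4) (x : Event) :
    pd μ (cutoff n) x =
      n * fderiv ℝ bump ((n : ℝ) • spatial x) (spatial (coordVec μ)) :=
  pd_comp_smul_spatial contDiff_bump n μ x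

theorem pd_pd_cutoff (n : ℕ) (μ ν : Fin 4) (x : Event) :
    pd ν (pd μ (cutoff n)) x = n * (n * fderiv ℝ (fderiv ℝ bump) ((n : ℝ) • spatial x)
      (spatial (coordVec ν)) (spatial (coordVec μ))) := by
  have h0 : ContDiff ℝ ∞ (fderiv ℝ bump) := contDiff_bump.fderiv_right (m := ∞) le_rfl
  have h1 : pd μ (cutoff n) = fun x =>
      (n : ℝ) • (fun y => fderiv ℝ bump y (spatial (coordVec μ))) ((n : ℝ) • spatial x) := by
    funext x; exact pd_cutoff n μ x
  have h2 : ContDiff ℝ ∞ fun y => fderiv ℝ bump y (spatial (coordVec μ)) :=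
    h0.clm_apply contDiff_const
  have h3 : ∀ y, fderiv ℝ (fun y => fderiv ℝ bump y (spatial (coordVec μ))) y
      (spatial (coordVec ν)) = fderiv ℝ (fderiv ℝ bump) y (spatial (coordVec ν))
        (spatial (coordVec μ)) := by
    intro y
    have h4 := (((h0.differentiable (by simp)) y).hasFDerivAt.clm_apply
      (hasFDerivAt_const (spatial (coordVec μ)) y)).fderiv
    rw [h4]
    simp
  rw [h1, ← h3]
  have h5 := pd_comp_smul_spatial (h2.const_smul (n : ℝ)) n ν x
  refine h5.trans ?_
  have h6 : ∀ y, fderiv ℝ (fun y => (n : ℝ) • fderiv ℝ bump y (spatial (coordVec μ))) y =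
      (n : ℝ) • fderiv ℝ (fun y => fderiv ℝ bump y (spatial (coordVec μ))) y := fun y =>
    (((h2.differentiable (by simp)) y).hasFDerivAt.const_smul (n : ℝ)).fderiv
  rw [h6]
  rfl

theorem norm_spatial_coordVec_le (μ : Fin 4) : ‖spatial (coordVec μ)‖ ≤ 1 := by
  refine (pi_norm_le_iff_of_nonneg zero_le_one).2 fun ν => ?_
  rw [spatial_apply]
  by_cases h : ν = 0
  · simp [h]
  · rw [if_neg h]
    by_cases h2 : ν = μ <;> simp [coordVec, h2]

theorem exists_bound_mul_norm {Y : Type} [NormedAddCommGroup Y] {f : Event → Y}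
    (hf : Continuous f) (hc : HasCompactSupport f) (k : ℕ) : ∃ C : ℝ, ∀ z, ‖z‖ ^ k * ‖f z‖ ≤ C := by
  have h1 : Continuous fun z => ‖z‖ ^ k * ‖f z‖ := (continuous_norm.pow k).mul hf.norm
  obtain ⟨C, hC⟩ := h1.bounded_above_of_compact_support (hc.norm.mul_left)
  exact ⟨C, fun z => (le_abs_self _).trans (hC z)⟩

/-- The families of fields that are `O(1/r)`, uniformly in the parameter. -/
def IsUniformlySingular {Y : Type} [NormedAddCommGroup Y] (f : ℕ → Event → Y) : Prop :=
  ∃ C : ℝ, ∀ n x, ‖spatial x‖ * ‖f n x‖ ≤ C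

namespace IsUniformlySingular

variable {Y : Type} [NormedAddCommGroup Y] {f g : ℕ → Event → Y}

theorem add (hf : IsUniformlySingular f) (hg : IsUniformlySingular g) :
    IsUniformlySingular fun n x => f n x + g n x := by
  obtain ⟨C, hC⟩ := hf
  obtain ⟨D, hD⟩ := hg
  refine ⟨C + D, fun n x => ?_⟩
  calc _ ≤ ‖spatial x‖ * (‖f n x‖ + ‖g n x‖) := by gcongr; exact norm_add_le _ _
    _ ≤ C + D := by rw [mul_add]; exact add_le_add (hC n x) (hD n x)

theorem neg (hf : IsUniformlySingular f) : IsUniformlySingular fun n x => -f n x := by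
  obtain ⟨C, hC⟩ := hf
  exact ⟨C, fun n x => by rw [norm_neg]; exact hC n x⟩

theorem sub (hf : IsUniformlySingular f) (hg : IsUniformlySingular g) :
    IsUniformlySingular fun n x => f n x - g n x := by
  simpa only [sub_eq_add_neg] using hf.add hg.neg

theorem sum {ι : Type} (s : Finset ι) {f : ι → ℕ → Event → Y}
    (hf : ∀ i, IsUniformlySingular (f i)) : IsUniformlySingular fun n x => ∑ i ∈ s, f i n x := by
  classical
  induction s using Finset.induction_on with
  | empty => exact ⟨0, fun n x => by simp⟩
  | insert a s ha ih =>
    simp only [Finset.sum_insert ha]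
    exact (hf a).add ih

end IsUniformlySingular

section Cutoff

variable {U : Set Event} {Y : Type} [NormedAddCommGroup Y] [NormedSpace ℝ Y]

theorem isUniformlySingular_cutoff {c : Event → Y} (hc : IsTest U c) :
    IsUniformlySingular fun n x => cutoff n x • c x := by
  obtain ⟨C, hC⟩ := hc.mul_norm_bound
  refine ⟨C, fun n x => ?_⟩
  have h1 : ‖cutoff n x‖ ≤ 1 := by
    rw [cutoff, Real.norm_of_nonneg bump.nonneg]; exact bump.le_one
  calc ‖spatial x‖ * ‖cutoff n x • c x‖ = ‖cutoff n x‖ * (‖spatial x‖ * ‖c x‖) := by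
        rw [norm_smul]; ring
    _ ≤ 1 * (‖spatial x‖ * ‖c x‖) := by gcongr
    _ ≤ C := by rw [one_mul]; exact hC x

/-- By scaling: with `z = n • spatial x` the weight absorbs the factor `n`, and `‖z‖ ‖D bump z‖` is
bounded independently of `n`. -/
theorem isUniformlySingular_pd_cutoff {c : Event → Y} (hc : IsTest U c) (μ : Fin 4) :
    IsUniformlySingular fun n x => pd μ (cutoff n) x • c x := by
  have h0 : ContDiff ℝ ∞ (fderiv ℝ bump) := contDiff_bump.fderiv_right (m := ∞) le_rfl
  obtain ⟨C, hC⟩ := exists_bound_mul_norm h0.continuous (bump.hasCompactSupport.fderiv (𝕜 := ℝ)) 1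
  obtain ⟨D, hD⟩ := hc.contDiff.continuous.bounded_above_of_compact_support hc.isCompact
  refine ⟨C * D, fun n x => ?_⟩
  have h1 : ‖pd μ (cutoff n) x‖ ≤ n * ‖fderiv ℝ bump ((n : ℝ) • spatial x)‖ := by
    rw [pd_cutoff, norm_mul, Real.norm_natCast]
    gcongr
    exact (ContinuousLinearMap.le_opNorm_of_le _ (norm_spatial_coordVec_le μ)).trans_eq (mul_one _)
  have h2 := hC ((n : ℝ) • spatial x)
  rw [pow_one, norm_smul, Real.norm_natCast] at h2
  have hC0 : 0 ≤ C := (by positivity : (0 : ℝ) ≤ _).trans h2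
  calc ‖spatial x‖ * ‖pd μ (cutoff n) x • c x‖ = ‖spatial x‖ * (‖pd μ (cutoff n) x‖ * ‖c x‖) := by
        rw [norm_smul]
    _ ≤ ‖spatial x‖ * ((n * ‖fderiv ℝ bump ((n : ℝ) • spatial x)‖) * ‖c x‖) := by gcongr
    _ = n * ‖spatial x‖ * ‖fderiv ℝ bump ((n : ℝ) • spatial x)‖ * ‖c x‖ := by ring
    _ ≤ C * D := by gcongr; exact hD x

/-- A compactly supported smooth function is Lipschitz; compare `x` with its projection `x - spatial
x` onto the axis, where `c` vanishes. -/
theorem exists_norm_le_mul_norm_spatial {c : Event → Y} (hc : IsTest U c)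
    (h0 : ∀ x, spatial x = 0 → c x = 0) : ∃ C : ℝ, 0 ≤ C ∧ ∀ x, ‖c x‖ ≤ C * ‖spatial x‖ := by
  obtain ⟨C, hC⟩ := ContDiff.lipschitzWith_of_hasCompactSupport (𝕂 := ℝ) hc.isCompact hc.contDiff
    (by simp)
  refine ⟨C, C.2, fun x => ?_⟩
  have h1 : c (x - spatial x) = 0 := h0 _ (by rw [map_sub, spatial_spatial, sub_self])
  have h2 := hC.dist_le_mul x (x - spatial x)
  rw [h1, dist_zero_right, dist_eq_norm, sub_sub_cancel] at h2
  exact h2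

/-- Two derivatives cost `n²`. One power of the distance comes from the weight and the other from
the vanishing of `c` on the axis, so the bound is again one on `‖z‖² ‖D² bump z‖` with `z = n •
spatial x`. -/
theorem isUniformlySingular_pd_pd_cutoff {c : Event → Y} (hc : IsTest U c)
    (h0 : ∀ x, spatial x = 0 → c x = 0) (μ ν : Fin 4) :
    IsUniformlySingular fun n x => pd ν (pd μ (cutoff n)) x • c x := by
  have hd : ContDiff ℝ ∞ (fderiv ℝ (fderiv ℝ bump)) :=
    (contDiff_bump.fderiv_right (m := ∞) le_rfl).fderiv_right (m := ∞) le_rfl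
  obtain ⟨C, hC⟩ := exists_bound_mul_norm hd.continuous
    ((bump.hasCompactSupport.fderiv (𝕜 := ℝ)).fderiv (𝕜 := ℝ)) 2
  obtain ⟨D, hD0, hD⟩ := exists_norm_le_mul_norm_spatial hc h0
  refine ⟨C * D, fun n x => ?_⟩
  set z := (n : ℝ) • spatial x with hz
  have h1 : ‖pd ν (pd μ (cutoff n)) x‖ ≤ n * (n * ‖fderiv ℝ (fderiv ℝ bump) z‖) := by
    rw [pd_pd_cutoff, norm_mul, norm_mul, Real.norm_natCast]
    gcongr
    refine (ContinuousLinearMap.le_opNorm_of_le _ (norm_spatial_coordVec_le μ)).trans ?_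
    rw [mul_one]
    exact (ContinuousLinearMap.le_opNorm_of_le _ (norm_spatial_coordVec_le ν)).trans_eq (mul_one _)
  have h2 := hC z
  rw [hz, norm_smul, Real.norm_natCast, ← hz] at h2
  calc ‖spatial x‖ * ‖pd ν (pd μ (cutoff n)) x • c x‖
      = ‖spatial x‖ * (‖pd ν (pd μ (cutoff n)) x‖ * ‖c x‖) := by rw [norm_smul]
    _ ≤ ‖spatial x‖ * ((n * (n * ‖fderiv ℝ (fderiv ℝ bump) z‖)) * (D * ‖spatial x‖)) := by
        gcongr; exact hD x
    _ = ((n * ‖spatial x‖) ^ 2 * ‖fderiv ℝ (fderiv ℝ bump) z‖) * D := by ring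
    _ ≤ C * D := by gcongr

variable {φ : FieldConfig} {B : Event → (Jet 2 →L[ℝ] ℝ)}

theorem isUniformlySingular_adjJet_cutoff (hB : IsTest U B) (h0 : ∀ x, spatial x = 0 → B x = 0) :
    IsUniformlySingular fun n x => adjJet (fun y => cutoff n y • B y) x := by
  have h1 : ∀ n x, adjJet (fun y => cutoff n y • B y) x = _ := fun n x =>
    adjJet_cutoff (contDiff_cutoff n) hB x
  simp only [h1]
  refine ((isUniformlySingular_cutoff hB.adjJet).sub (.sum _ fun μ => ?_)).add
    (.sum _ fun μ => .sum _ fun ν => ((?_ : IsUniformlySingular _).add ?_).add ?_)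
  · exact isUniformlySingular_pd_cutoff (hB.clm_comp (jetOne μ)) μ
  · exact isUniformlySingular_pd_cutoff ((hB.clm_comp (jetTwo μ ν)).pd μ) ν
  · exact isUniformlySingular_pd_cutoff ((hB.clm_comp (jetTwo μ ν)).pd ν) μ
  · refine isUniformlySingular_pd_pd_cutoff (hB.clm_comp (jetTwo μ ν)) (fun x hx => ?_) μ ν
    rw [h0 x hx]; rfl

/-- A coefficient that vanishes on the worldline does not see a field of order `1/r`. -/
theorem IsSingularField.integral_adjJet_eq_zero (hU : IsOpen U) (hφ : IsSingularField U φ)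
    (hB : IsTest U B) (h0 : ∀ x, spatial x = 0 → B x = 0)
    (hBφ : ∀ x ∈ U, spatial x ≠ 0 → B x (jet 2 φ x) = 0) : ∫ x, adjJet B x (φ x) = 0 := by
  have hc : ∀ n, IsTest U fun x => cutoff n x • B x := fun n =>
    hB.smul_left fun x _ => (contDiff_cutoff n).contDiffAt
  have hd : ∀ n, IsTest U fun x => (1 - cutoff n x) • B x := fun n =>
    hB.smul_left fun x _ => contDiffAt_const.sub (contDiff_cutoff n).contDiffAt
  have hd' : ∀ n, IsTest (U ∩ {x | spatial x ≠ 0}) fun x => (1 - cutoff n x) • B x := by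
    intro n
    refine ⟨(hd n).1, (hd n).2.1, fun x hx => ⟨(hd n).2.2 hx, fun hx0 => ?_⟩⟩
    refine absurd hx (notMem_tsupport_iff_eventuallyEq.2 ?_)
    have hcont : Continuous fun y => ‖(n : ℝ) • spatial y‖ :=
      (spatial.continuous.const_smul (n : ℝ)).norm
    have : ∀ᶠ y in 𝓝 x, ‖(n : ℝ) • spatial y‖ < 1 := by
      refine hcont.continuousAt.eventually (gt_mem_nhds ?_)
      change ‖(n : ℝ) • spatial x‖ < 1
      rw [hx0, smul_zero, norm_zero]
      exact one_pos
    filter_upwards [this] with y hy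
    have h1 : cutoff n y = 1 := bump.one_of_mem_closedBall (by
      rw [mem_closedBall_zero_iff]; exact hy.le)
    rw [h1, sub_self, zero_smul]; rfl
  -- The remaining part `(1 - cutoff n) • B` is supported away from the axis and contributes
  -- nothing, so the integral with the cutoff does not depend on `n`.
  have h1 : ∀ n, ∫ x, adjJet (fun y => cutoff n y • B y) x (φ x) = ∫ x, adjJet B x (φ x) := by
    intro n
    have e1 : ∀ x, adjJet B x (φ x) = adjJet (fun y => cutoff n y • B y) x (φ x) +
        adjJet (fun y => (1 - cutoff n y) • B y) x (φ x) := by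
      intro x
      rw [← _root_.add_apply, ← adjJet_add (hc n) (hd n)]
      congr 2
      funext y
      rw [← add_smul, add_sub_cancel, one_smul]
    simp only [e1]
    rw [integral_add (hφ.integrable hU (hc n).adjJet) (hφ.integrable hU (hd n).adjJet),
      hφ.integral_adjJet_eq_zero_of_tsupport hU (hd' n), add_zero]
    intro x hxU hx
    rw [_root_.smul_apply, hBφ x hxU hx, smul_zero]
  obtain ⟨C, hC⟩ := isUniformlySingular_adjJet_cutoff hB h0
  obtain ⟨D, hD⟩ := hφ.bound_of_isCompact hB.isCompact hB.subset
  -- The integrands are dominated by a multiple of `1/r²` on the support of `B`, and at each point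
  -- off the axis they are eventually zero. The constant sequence of `h1` therefore has limit zero.
  have h2 : Tendsto (fun n : ℕ => ∫ x, adjJet (fun y => cutoff n y • B y) x (φ x)) atTop
      (𝓝 (∫ _x : Event, (0 : ℝ))) := by
    refine tendsto_integral_of_dominated_convergence
      ((tsupport B).indicator fun x => C * D * (‖spatial x‖ ^ 2)⁻¹)
      (fun n => hφ.aestronglyMeasurable hU (hc n).adjJet) ?_ (fun n => ?_) ?_
    · rw [integrable_indicator_iff hB.isCompact.measurableSet]
      exact (integrableOn_inv_sq_spatial hB.isCompact).const_mul _
    · filter_upwards [ae_spatial_ne_zero] with x hx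
      by_cases hxK : x ∈ tsupport B
      · rw [indicator_of_mem hxK]
        exact norm_apply_le_of_mul_norm_le (norm_pos_iff.2 hx) (hC n x) (hD x hxK)
      · have : x ∉ tsupport fun y => cutoff n y • B y := fun h =>
          hxK (tsupport_smul_subset_right _ _ h)
        rw [indicator_of_notMem hxK, adjJet_eq_zero this]
        simp
    · filter_upwards [ae_spatial_ne_zero] with x hx
      have hpos : 0 < ‖spatial x‖ := norm_pos_iff.2 hx
      obtain ⟨N, hN⟩ := exists_nat_gt (2 / ‖spatial x‖)
      refine tendsto_const_nhds.congr' ?_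
      filter_upwards [eventually_ge_atTop N] with n hn
      have hn2 : 2 < ‖(n : ℝ) • spatial x‖ := by
        rw [norm_smul, Real.norm_natCast, ← div_lt_iff₀ hpos]
        exact hN.trans_le (by exact_mod_cast hn)
      have hx2 : x ∉ tsupport fun y => cutoff n y • B y := by
        refine notMem_tsupport_iff_eventuallyEq.2 ?_
        have hcont : Continuous fun y => ‖(n : ℝ) • spatial y‖ :=
          (spatial.continuous.const_smul (n : ℝ)).norm
        filter_upwards [hcont.continuousAt.eventually (lt_mem_nhds hn2)] with y hy
        have h1 : cutoff n y = 0 := bump.zero_of_le_dist (by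
          rw [dist_zero_right]; exact hy.le)
        rw [h1, zero_smul]; rfl
      rw [adjJet_eq_zero hx2]
      rfl
  simp only [h1, integral_zero] at h2
  exact tendsto_nhds_unique tendsto_const_nhds h2

end Cutoff

/-! ### The perturbation of a small body family -/

theorem continuous_radius : Continuous radius :=
  Real.continuous_sqrt.comp (continuous_finsetSum _ fun i _ => (continuous_apply i.succ).pow 2)

section Family

variable {T : VectorTensorTheory} {U : Set Event} {ψ : ℝ → FieldConfig} {l₀ R : ℝ}

/-- The exterior region of a family, without the restriction `0 ≤ l`. -/
def exteriorRegion (U : Set Event) (l₀ R : ℝ) : Set (ℝ × Event) :=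
  {p | p.1 < l₀ ∧ p.2 ∈ U ∧ R * p.1 < radius p.2}

theorem isOpen_exteriorRegion (hU : IsOpen U) (l₀ R : ℝ) : IsOpen (exteriorRegion U l₀ R) :=
  (isOpen_lt continuous_fst continuous_const).inter ((hU.preimage continuous_snd).inter
    (isOpen_lt (continuous_const.mul continuous_fst) (continuous_radius.comp continuous_snd)))

theorem IsSmallBodyFamily.contDiffOn (hψ : IsSmallBodyFamily T U ψ l₀ R) :
    ContDiffOn ℝ ∞ (fun p : ℝ × Event => ψ p.1 p.2) (nonnegPart (exteriorRegion U l₀ R)) :=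
  hψ.smooth.mono fun _ hp => ⟨hp.2, hp.1⟩

theorem IsSmallBodyFamily.zero_mem (hψ : IsSmallBodyFamily T U ψ l₀ R) {x : Event} (hx : x ∈ U)
    (hx0 : spatial x ≠ 0) : ((0 : ℝ), x) ∈ exteriorRegion U l₀ R :=
  ⟨hψ.l₀_pos, hx, by rw [mul_zero]; exact radius_pos_iff.2 hx0⟩

/-- The equations are assumed off the worldline; they extend to it by continuity, its complement
being dense. -/
theorem IsSmallBodyFamily.background_solves (hψ : IsSmallBodyFamily T U ψ l₀ R) {x : Event}
    (hx : x ∈ U) : T.fieldEq (jet 2 (ψ 0) x) = 0 := by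
  by_contra h
  have h1 : ContinuousAt (fun y => T.fieldEq (jet 2 (ψ 0) y)) x :=
    ContinuousAt.comp (g := T.fieldEq) (hasFDerivAt_of_contDiffOn_lorentzianJets T.fieldEq_smooth
      (j := jet 2 (ψ 0) x) (hψ.background.2 x hx)).continuousAt
      (contDiffAt_jet 2 (contDiffAt_of_isSmoothConfig hψ.isOpen hψ.background hx)).continuousAt
  have hd : Dense {y : Event | spatial y ≠ 0} := Measure.dense_of_ae ae_spatial_ne_zero
  obtain ⟨y, ⟨hy1, hy2⟩, hy3⟩ := mem_closure_iff_nhds.1 (hd x) _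
    ((h1.eventually_ne h).and (hψ.isOpen.mem_nhds hx))
  exact hy1 (hψ.solves 0 le_rfl hψ.l₀_pos y hy2 (by rw [mul_zero]; exact radius_pos_iff.2 hy3))

/-- A fixed point off the worldline lies in the exterior region for all small `l`, so the field
equations can be differentiated there at `l = 0`. -/
theorem IsSmallBodyFamily.linearizedFieldEq_perturbation (hψ : IsSmallBodyFamily T U ψ l₀ R)
    {x : Event} (hx : x ∈ U) (hx0 : spatial x ≠ 0) :
    linearizedFieldEq T (ψ 0) (perturbation ψ) x = 0 := by
  have hO := isOpen_exteriorRegion hψ.isOpen l₀ R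
  have hm := hψ.zero_mem hx hx0
  have h1 := hasDerivWithinAt_jet 2 hO hψ.contDiffOn hm
  have h2 : HasFDerivAt T.fieldEq (fderiv ℝ T.fieldEq (jet 2 (ψ 0) x)) (jet 2 (ψ 0) x) :=
    hasFDerivAt_of_contDiffOn_lorentzianJets T.fieldEq_smooth (hψ.background.2 x hx)
  have h3 := h2.comp_hasDerivWithinAt (0 : ℝ) h1
  have h4 : HasDerivWithinAt (T.fieldEq ∘ fun l => jet 2 (ψ l) x) 0 (Ici 0) 0 := by
    refine (hasDerivWithinAt_const (0 : ℝ) (Ici 0) (0 : FieldValue)).congr_of_eventuallyEq ?_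
      (hψ.background_solves hx)
    filter_upwards [eventually_mem_nonnegPart hO hm] with l hl
    exact hψ.solves l hl.2 hl.1.1 x hx hl.1.2.2
  exact (uniqueDiffOn_Ici (0 : ℝ) 0 self_mem_Ici).eq_deriv _ h3 h4

theorem event_eq_self (y : Event) {r : ℝ} (hr : r ≠ 0) :
    event (y 0) (r • fun i : Fin 3 => y i.succ / r) = y := by
  funext μ
  refine Fin.cases rfl (fun i => ?_) μ
  change r * (y i.succ / r) = y i.succ
  field_simp

/-- Near the axis, `∂_l F(r, l/r)` at `l = 0` equals `r⁻¹ ∂_β F(r, 0)`, and the first derivatives of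
`F` are bounded uniformly in time and direction. Off the axis, smoothness already gives a local
bound. -/
theorem IsSmallBodyFamily.isSingularField (hψ : IsSmallBodyFamily T U ψ l₀ R) :
    IsSingularField U (perturbation ψ) := by
  have hO := isOpen_exteriorRegion hψ.isOpen l₀ R
  have hsm : ∀ x ∈ U, spatial x ≠ 0 → ContDiffAt ℝ ∞ (perturbation ψ) x := fun x hx hx0 =>
    contDiffAt_initialDeriv hO hψ.contDiffOn (hψ.zero_mem hx hx0)
  refine ⟨hsm, fun x hx => ?_⟩
  by_cases hx0 : spatial x = 0
  · have hxw := spatial_eq_zero_iff.1 hx0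
    obtain ⟨δ, hδ, F, hF, hb⟩ := hψ.uniform (x 0) (by
      change worldline (x 0) ∈ U
      rwa [← hxw])
    obtain ⟨C, hC⟩ := hb 1
    have hr0 : radius x = 0 := by
      by_contra h
      exact radius_pos_iff.1 (lt_of_le_of_ne (Real.sqrt_nonneg _) (Ne.symm h)) hx0
    have e1 : ∀ᶠ y in 𝓝 x, radius y < δ :=
      continuous_radius.continuousAt.eventually (gt_mem_nhds (by rwa [hr0]))
    have e2 : ∀ᶠ y : Event in 𝓝 x, |y 0 - x 0| < δ := by
      have : Continuous fun y : Event => |y 0 - x 0| := by fun_prop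
      exact this.continuousAt.eventually (gt_mem_nhds (by simpa using hδ))
    refine ⟨max C 0, ?_⟩
    filter_upwards [e1, e2] with y hy1 hy2
    by_cases hy0 : spatial y = 0
    · rw [hy0, norm_zero, zero_mul]; exact le_max_right _ _
    set r := radius y with hr
    have hrpos : 0 < r := radius_pos_iff.2 hy0
    set n : Fin 3 → ℝ := fun i => y i.succ / r with hn
    have hn1 : ∑ i, n i ^ 2 = 1 := by
      have h1 : r ^ 2 = ∑ i : Fin 3, y i.succ ^ 2 :=
        Real.sq_sqrt (Finset.sum_nonneg fun i _ => sq_nonneg _)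
      simp only [hn, div_pow]
      rw [← Finset.sum_div, ← h1, div_self (by positivity)]
    have hyn : event (y 0) (r • n) = y := event_eq_self y hrpos.ne'
    obtain ⟨hF1, hF2⟩ := hF (y 0) hy2 n hn1
    set S : Set (ℝ × ℝ) := Ico 0 δ ×ˢ Ico 0 δ with hS
    have hu : UniqueDiffOn ℝ S := (uniqueDiffOn_Ico 0 δ).prod (uniqueDiffOn_Ico 0 δ)
    have hp : (r, (0 : ℝ)) ∈ S := ⟨⟨hrpos.le, hy1⟩, ⟨le_rfl, hδ⟩⟩
    have hd : HasFDerivWithinAt (F (y 0) n) (fderivWithin ℝ (F (y 0) n) S (r, 0)) S (r, 0 / r) := by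
      rw [zero_div]
      exact ((hF1.differentiableOn (by simp)) _ hp).hasFDerivWithinAt
    have hl : HasDerivAt (fun l : ℝ => (r, l / r)) ((0, 1 / r) : ℝ × ℝ) 0 :=
      (hasDerivAt_const _ _).prodMk ((hasDerivAt_id (0 : ℝ)).div_const r)
    have hmaps : MapsTo (fun l : ℝ => (r, l / r)) (Ico 0 (δ * r)) S := fun l hl =>
      ⟨⟨hrpos.le, hy1⟩, ⟨div_nonneg hl.1 hrpos.le, (div_lt_iff₀ hrpos).2 hl.2⟩⟩
    have h3 := HasFDerivWithinAt.comp_hasDerivWithinAt (0 : ℝ) hd (hl.hasDerivWithinAt) hmaps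
    have h4 : HasDerivWithinAt (fun l => ψ l y)
        (fderivWithin ℝ (F (y 0) n) S (r, 0) (0, 1 / r)) (Ico 0 (δ * r)) 0 := by
      refine h3.congr (fun l hl => ?_) ?_
      · rw [← hyn]
        exact (hF2 r l hrpos hy1 hl.1 hl.2).symm
      · rw [← hyn]
        exact (hF2 r 0 hrpos hy1 le_rfl (by positivity)).symm
    have h5 : HasDerivWithinAt (fun l => ψ l y)
        (fderivWithin ℝ (F (y 0) n) S (r, 0) (0, 1 / r)) (Ici 0) 0 :=
      h4.mono_of_mem_nhdsWithin (Ico_mem_nhdsGE (by positivity))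
    have h6 : perturbation ψ y = _ := h5.derivWithin (uniqueDiffOn_Ici 0 0 self_mem_Ici)
    have h7 := hC (y 0) hy2 n hn1 (r, 0) hp
    rw [norm_iteratedFDerivWithin_one _ (hu _ hp)] at h7
    have h8 : ‖((0, 1 / r) : ℝ × ℝ)‖ = 1 / r := by
      rw [Prod.norm_mk, norm_zero, Real.norm_of_nonneg (by positivity)]
      exact max_eq_right (by positivity)
    calc ‖spatial y‖ * ‖perturbation ψ y‖ ≤ r * (C * (1 / r)) := by
          have h9 := (fderivWithin ℝ (F (y 0) n) S (r, 0)).le_of_opNorm_le h7 (0, 1 / r)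
          rw [h8] at h9
          rw [h6]
          exact mul_le_mul (norm_spatial_le_radius y) h9 (norm_nonneg _) hrpos.le
      _ = C := by field_simp
      _ ≤ max C 0 := le_max_left _ _
  · have h1 : ContinuousAt (fun y => ‖spatial y‖ * ‖perturbation ψ y‖) x :=
      spatial.continuous.norm.continuousAt.mul (hsm x hx hx0).continuousAt.norm
    exact ⟨_, (h1.eventually (gt_mem_nhds (lt_add_one _))).mono fun y hy => le_of_lt hy⟩

end Family

/-! ### The source of the perturbation -/

section Source

variable {T : VectorTensorTheory} {U : Set Event} {ψ₀ φ : FieldConfig}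
  {w w' : Event → (FieldValue →L[ℝ] ℝ)}

/-- The coefficients of the operator `φ ↦ √(-g) w(E⁽¹⁾[φ])`. -/
def sourceForm (T : VectorTensorTheory) (ψ₀ : FieldConfig) (w : Event → (FieldValue →L[ℝ] ℝ))
    (x : Event) : Jet 2 →L[ℝ] ℝ :=
  volDensity (ψ₀ x) • (w x).comp (fderiv ℝ T.fieldEq (jet 2 ψ₀ x))

/-- The value of the distribution `E⁽¹⁾[φ]` on the test field `w`. -/
def source (T : VectorTensorTheory) (ψ₀ φ : FieldConfig) (w : Event → (FieldValue →L[ℝ] ℝ)) : ℝ :=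
  ∫ x, adjJet (sourceForm T ψ₀ w) x (φ x)

theorem sourceForm_jet (χ : FieldConfig) (x : Event) :
    sourceForm T ψ₀ w x (jet 2 χ x) = volDensity (ψ₀ x) * w x (linearizedFieldEq T ψ₀ χ x) := rfl

theorem isTest_sourceForm (hU : IsOpen U) (hψ₀ : IsSmoothConfig ψ₀ U) (hw : IsTest U w) :
    IsTest U (sourceForm T ψ₀ w) := by
  have h : IsTest U fun x => (w x).comp (fderiv ℝ T.fieldEq (jet 2 ψ₀ x)) := by
    refine hw.of_left (fun x hx => ?_) fun x hx => ?_
    · have hj : jet 2 ψ₀ x ∈ lorentzianJets 2 := hψ₀.2 x hx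
      have h1 : ContDiffAt ℝ ∞ T.fieldEq (jet 2 ψ₀ x) :=
        T.fieldEq_smooth.contDiffAt ((isOpen_lorentzianJets 2).mem_nhds hj)
      have h2 : ContDiffAt ℝ ∞ (fderiv ℝ T.fieldEq) (jet 2 ψ₀ x) :=
        h1.fderiv_right (m := ∞) le_rfl
      have h3 : ContDiffAt ℝ ∞ (fun y => fderiv ℝ T.fieldEq (jet 2 ψ₀ y)) x :=
        ContDiffAt.comp (g := fderiv ℝ T.fieldEq) (f := jet 2 ψ₀) x h2
          (contDiffAt_jet 2 (contDiffAt_of_isSmoothConfig hU hψ₀ hx))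
      exact (hw.contDiffAt x).clm_comp h3
    · rw [image_eq_zero_of_notMem_tsupport hx, ContinuousLinearMap.zero_comp]
  exact h.smul_left fun x hx =>
    (contDiffAt_volDensity (hψ₀.2 x hx)).comp x (contDiffAt_of_isSmoothConfig hU hψ₀ hx)

theorem source_add (hU : IsOpen U) (hψ₀ : IsSmoothConfig ψ₀ U) (hφ : IsSingularField U φ)
    (hw : IsTest U w) (hw' : IsTest U w') :
    source T ψ₀ φ (fun x => w x + w' x) = source T ψ₀ φ w + source T ψ₀ φ w' := by
  have h1 := isTest_sourceForm (T := T) hU hψ₀ hw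
  have h2 := isTest_sourceForm (T := T) hU hψ₀ hw'
  have h3 : sourceForm T ψ₀ (fun x => w x + w' x) =
      fun x => sourceForm T ψ₀ w x + sourceForm T ψ₀ w' x := by
    funext x
    simp only [sourceForm, ContinuousLinearMap.add_comp, smul_add]
  have h4 : ∀ x, adjJet (sourceForm T ψ₀ fun x => w x + w' x) x (φ x) =
      adjJet (sourceForm T ψ₀ w) x (φ x) + adjJet (sourceForm T ψ₀ w') x (φ x) := by
    intro x
    rw [h3, adjJet_add h1 h2]; rfl
  simp only [source, h4]
  exact integral_add (hφ.integrable hU h1.adjJet) (hφ.integrable hU h2.adjJet)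

/-- The source lives on the worldline. -/
theorem source_eq_zero_of_worldline (hU : IsOpen U) (hψ₀ : IsSmoothConfig ψ₀ U)
    (hφ : IsSingularField U φ)
    (hE : ∀ x ∈ U, spatial x ≠ 0 → linearizedFieldEq T ψ₀ φ x = 0) (hw : IsTest U w)
    (h0 : ∀ t, w (worldline t) = 0) : source T ψ₀ φ w = 0 := by
  refine hφ.integral_adjJet_eq_zero hU (isTest_sourceForm hU hψ₀ hw) (fun x hx => ?_)
    fun x hxU hx => ?_
  · rw [sourceForm, spatial_eq_zero_iff.1 hx, h0, ContinuousLinearMap.zero_comp, smul_zero]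
  · rw [sourceForm_jet, hE x hxU hx, map_zero, mul_zero]

theorem eq_zero_of_integral_test_eq_zero (hU : IsOpen U) {A : Event → (FieldValue →L[ℝ] ℝ)}
    (hA : IsTest U A) (h : ∀ χ : FieldConfig, IsTest U χ → ∫ x, A x (χ x) = 0) (x : Event) :
    A x = 0 := by
  by_cases hx : x ∈ U
  swap
  · exact image_eq_zero_of_notMem_tsupport fun h => hx (hA.subset h)
  refine ContinuousLinearMap.ext fun v => ?_
  have hc : Continuous fun y => A y v := hA.contDiff.continuous.clm_apply continuous_const
  have h1 : ∀ᵐ y, y ∈ U → A y v = 0 :=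
    hU.ae_eq_zero_of_integral_contDiff_smul_eq_zero (hc.locallyIntegrable.locallyIntegrableOn U)
      fun g hg hg1 hg2 => by
        have h2 := h (fun y => g y • v)
          (IsTest.smul_right ⟨hg, hg1, hg2⟩ fun y _ => contDiffAt_const)
        simpa only [map_smul] using h2
  by_contra hne
  have hd : Dense {y : Event | y ∈ U → A y v = 0} := Measure.dense_of_ae h1
  obtain ⟨y, ⟨hy1, hy2⟩, hy3⟩ := mem_closure_iff_nhds.1 (hd x) _
    ((hc.continuousAt.eventually_ne hne).and (hU.mem_nhds hx))
  exact hy1 (hy3 hy2)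

/-- Identities between the linearized field equations hold in the sense of distributions. -/
theorem source_eq_zero_of_identity (hU : IsOpen U) (hψ₀ : IsSmoothConfig ψ₀ U) (hw : IsTest U w)
    (h : ∀ χ : FieldConfig, IsTest U χ →
      ∫ x, volDensity (ψ₀ x) * w x (linearizedFieldEq T ψ₀ χ x) = 0) : source T ψ₀ φ w = 0 := by
  have h1 := isTest_sourceForm (T := T) hU hψ₀ hw
  -- The identity for all smooth test fields forces the adjoint coefficient itself to vanish
  -- pointwise, so its pairing with the singular field vanishes too.
  have h2 := eq_zero_of_integral_test_eq_zero hU h1.adjJet fun χ hχ => by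
    rw [integral_adjJet h1 hχ.contDiff]
    exact h χ hχ
  simp only [source, h2, _root_.zero_apply, integral_zero]

/-- `adjJet` is the adjoint for `d⁴x` of an operator that already contains the volume density.
Dividing it by that density gives the adjoint for the invariant volume element. -/
theorem distributionalEq_of_source (hU : IsOpen U) (hψ₀ : IsSmoothConfig ψ₀ U)
    (hφ : IsSingularField U φ) (e : FieldValue →L[ℝ] ℝ) {D : (Event → ℝ) → ℝ}
    (h : ∀ f, IsTest U f → source T ψ₀ φ (fun x => f x • e) = D f) :
    DistributionalEq U (fun x => volDensity (ψ₀ x)) (fun χ x => e (linearizedFieldEq T ψ₀ χ x)) φ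
      D := by
  intro f hf
  have hw : IsTest U fun x => f x • e := hf.smul_right fun _ _ => contDiffAt_const
  have hB := isTest_sourceForm (T := T) hU hψ₀ hw
  set A := adjJet (sourceForm T ψ₀ fun x => f x • e) with hA
  have hAt : IsTest U A := hB.adjJet
  have hv : ∀ x ∈ U, ContDiffAt ℝ ∞ (fun y => (volDensity (ψ₀ y))⁻¹) x := fun x hx =>
    ((contDiffAt_volDensity (hψ₀.2 x hx)).comp x (contDiffAt_of_isSmoothConfig hU hψ₀ hx)).inv
      (hψ₀.2 x hx).volDensity_pos.ne'
  have hF : IsTest U fun x => (volDensity (ψ₀ x))⁻¹ • A x := hAt.smul_left hv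
  have hFA : ∀ χ : FieldConfig, ∫ x in U, volDensity (ψ₀ x) *
      ((volDensity (ψ₀ x))⁻¹ • A x) (χ x) = ∫ x, A x (χ x) := by
    intro χ
    have h1 : ∫ x in U, A x (χ x) = ∫ x, A x (χ x) :=
      setIntegral_eq_integral_of_forall_compl_eq_zero fun x hx => by
        rw [image_eq_zero_of_notMem_tsupport fun h => hx (hAt.subset h)]; rfl
    rw [← h1]
    refine setIntegral_congr_fun hU.measurableSet fun x hx => ?_
    simp only [_root_.smul_apply, smul_eq_mul]
    exact mul_inv_cancel_left₀ (hψ₀.2 x hx).volDensity_pos.ne' _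
  refine ⟨fun x => (volDensity (ψ₀ x))⁻¹ • A x, ⟨hF.contDiff.continuous, hF.isCompact, hF.subset,
    fun χ hχ => ?_⟩, ?_, ?_⟩
  · rw [hFA χ, hA, integral_adjJet hB hχ.contDiff]
    exact setIntegral_eq_integral_of_forall_compl_eq_zero fun x hx => by
      rw [image_eq_zero_of_notMem_tsupport fun h => hx (hf.subset h), zero_mul, mul_zero]
  · refine (hφ.integrable hU hAt).integrableOn.congr_fun (fun x hx => ?_) hU.measurableSet
    simp only [_root_.smul_apply, smul_eq_mul]
    exact (mul_inv_cancel_left₀ (hψ₀.2 x hx).volDensity_pos.ne' _).symm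
  · rw [hFA φ]
    exact h f hf

end Source

/-! ### Test functions on the worldline -/

/-- `h` is a test function on the set `I` of times. -/
def IsLineTest (I : Set ℝ) (h : ℝ → ℝ) : Prop :=
  ContDiff ℝ ∞ h ∧ ∃ K, IsCompact K ∧ K ⊆ I ∧ ∀ t, t ∉ K → h t = 0

section LineTest

variable {I : Set ℝ} {h k : ℝ → ℝ}

theorem isLineTest_of_contDiffAt {K : Set ℝ} (hh : ∀ t ∈ I, ContDiffAt ℝ ∞ h t) (hK : IsCompact K)
    (hKI : K ⊆ I) (h0 : ∀ t, t ∉ K → h t = 0) : IsLineTest I h := by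
  refine ⟨contDiff_iff_contDiffAt.2 fun t => ?_, K, hK, hKI, h0⟩
  by_cases ht : t ∈ K
  · exact hh t (hKI ht)
  · exact (contDiffAt_const (c := (0 : ℝ))).congr_of_eventuallyEq
      (Filter.mem_of_superset (hK.isClosed.isOpen_compl.mem_nhds ht) fun s hs => h0 s hs)

theorem IsLineTest.differentiable (hh : IsLineTest I h) : Differentiable ℝ h :=
  hh.1.differentiable (by simp)

theorem IsLineTest.add (hh : IsLineTest I h) (hk : IsLineTest I k) :
    IsLineTest I fun t => h t + k t := by
  obtain ⟨hh, K, hK, hKI, h0⟩ := hh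
  obtain ⟨hk, K', hK', hKI', h0'⟩ := hk
  refine ⟨hh.add hk, K ∪ K', hK.union hK', union_subset hKI hKI', fun t ht => ?_⟩
  rw [mem_union, not_or] at ht
  simp only [h0 t ht.1, h0' t ht.2, add_zero]

theorem IsLineTest.mul_left (hh : IsLineTest I h) (hk : ∀ t ∈ I, ContDiffAt ℝ ∞ k t) :
    IsLineTest I fun t => k t * h t := by
  obtain ⟨hh, K, hK, hKI, h0⟩ := hh
  exact isLineTest_of_contDiffAt (fun t ht => (hk t ht).mul hh.contDiffAt) hK hKI fun t ht => by
    rw [h0 t ht, mul_zero]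

theorem IsLineTest.deriv (hh : IsLineTest I h) : IsLineTest I (deriv h) := by
  obtain ⟨hh, K, hK, hKI, h0⟩ := hh
  refine ⟨(contDiff_infty_iff_deriv.1 hh).2, K, hK, hKI, fun t ht => ?_⟩
  have h1 : h =ᶠ[𝓝 t] fun _ => (0 : ℝ) :=
    Filter.mem_of_superset (hK.isClosed.isOpen_compl.mem_nhds ht) fun s hs => h0 s hs
  rw [h1.deriv_eq, deriv_const]

theorem IsLineTest.integrable (hh : IsLineTest I h) : Integrable h := by
  obtain ⟨hh, K, hK, -, h0⟩ := hh
  exact hh.continuous.integrable_of_hasCompactSupport (HasCompactSupport.intro hK h0)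

theorem IsLineTest.setIntegral_eq (hh : IsLineTest I h) : ∫ t in I, h t = ∫ t, h t := by
  obtain ⟨-, K, -, hKI, h0⟩ := hh
  exact setIntegral_eq_integral_of_forall_compl_eq_zero fun t ht => h0 t fun h => ht (hKI h)

theorem IsLineTest.integral_deriv (hh : IsLineTest I h) : ∫ t, _root_.deriv h t = 0 :=
  integral_eq_zero_of_hasDerivAt_of_integrable (fun t => (hh.differentiable t).hasDerivAt)
    hh.deriv.integrable hh.integrable

/-- Zero mean makes the primitive vanish beyond the support of `h`, and order-connectedness keeps
the interval spanned by that support inside `I`. This is where connectedness of the worldline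
enters: it yields one constant along the whole curve. -/
theorem IsLineTest.exists_primitive (hI : I.OrdConnected) (hh : IsLineTest I h)
    (h0 : ∫ t, h t = 0) : ∃ H, IsLineTest I H ∧ _root_.deriv H = h := by
  obtain ⟨hc, K, hK, hKI, hK0⟩ := hh
  rcases K.eq_empty_or_nonempty with rfl | hne
  · refine ⟨fun _ => 0, ⟨contDiff_const, ∅, hK, hKI, fun _ _ => rfl⟩, funext fun t => ?_⟩
    rw [hK0 t (notMem_empty t), deriv_const]
  obtain ⟨a, haK, ha⟩ := hK.exists_isLeast hne
  obtain ⟨b, hbK, hb⟩ := hK.exists_isGreatest hne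
  have h0' : ∀ t, t ∉ Icc a b → h t = 0 := fun t ht => hK0 t fun h => ht ⟨ha h, hb h⟩
  have hd : ∀ t, HasDerivAt (fun t => ∫ s in (a - 1)..t, h s) (h t) t := fun t =>
    hc.continuous.integral_hasStrictDerivAt (a - 1) t |>.hasDerivAt
  have hde : _root_.deriv (fun t => ∫ s in (a - 1)..t, h s) = h := funext fun t => (hd t).deriv
  refine ⟨fun t => ∫ s in (a - 1)..t, h s, ⟨?_, Icc a b, isCompact_Icc,
    hI.out (hKI haK) (hKI hbK), fun t ht => ?_⟩, hde⟩
  · exact contDiff_infty_iff_deriv.2 ⟨fun t => (hd t).differentiableAt, by rwa [hde]⟩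
  · rcases lt_or_ge t a with hta | hta
    · refine (intervalIntegral.integral_congr (g := fun _ => (0 : ℝ)) fun s hs => ?_).trans
        intervalIntegral.integral_zero
      refine h0' s fun hs' => ?_
      have : s ≤ max (a - 1) t := hs.2
      rcases le_max_iff.1 this with h | h <;> linarith [hs'.1]
    · have hbt : b < t := by
        by_contra h
        exact ht ⟨hta, not_lt.1 h⟩
      change ∫ s in (a - 1)..t, h s = 0
      rw [intervalIntegral.integral_eq_integral_of_support_subset, h0]
      intro s hs
      by_contra hs'
      refine hs (h0' s fun h => hs' ⟨by linarith [h.1], by linarith [h.2]⟩)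

/-- The fundamental lemma of the calculus of variations. -/
theorem eq_zero_of_integral_lineTest_eq_zero (hI : IsOpen I) (hk : ContinuousOn k I)
    (h0 : ∀ h, IsLineTest I h → ∫ t in I, h t * k t = 0) {t : ℝ} (ht : t ∈ I) : k t = 0 := by
  have h1 : ∀ᵐ s, s ∈ I → k s = 0 :=
    hI.ae_eq_zero_of_integral_contDiff_smul_eq_zero (hk.locallyIntegrableOn hI.measurableSet)
      fun g hg hg1 hg2 => by
        have h3 := h0 g ⟨hg, tsupport g, hg1, hg2, fun s hs => image_eq_zero_of_notMem_tsupport hs⟩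
        rw [← h3]
        refine (setIntegral_eq_integral_of_forall_compl_eq_zero fun s hs => ?_).symm
        rw [image_eq_zero_of_notMem_tsupport fun h => hs (hg2 h), zero_smul]
  by_contra hne
  have hd : Dense {s : ℝ | s ∈ I → k s = 0} := Measure.dense_of_ae h1
  obtain ⟨s, ⟨hs1, hs2⟩, hs3⟩ := mem_closure_iff_nhds.1 (hd t) _
    (((hk.continuousAt (hI.mem_nhds ht)).eventually_ne hne).and (hI.mem_nhds ht))
  exact hs1 (hs3 hs2)

end LineTest

/-! ### Restriction of test functions to the worldline and extension from it -/

section Worldline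

variable {U : Set Event} {f : Event → ℝ}

theorem worldline_eq (t : ℝ) : worldline t = t • coordVec 0 := by
  funext μ
  refine Fin.cases ?_ (fun i => ?_) μ
  · simp [worldline, event, coordVec]
  · simp [worldline, event, coordVec]

theorem contDiff_worldline : ContDiff ℝ ∞ worldline := by
  rw [funext worldline_eq]
  fun_prop

theorem hasDerivAt_worldline (t : ℝ) : HasDerivAt worldline (coordVec 0) t := by
  rw [funext worldline_eq]
  simpa using (hasDerivAt_id t).smul_const (coordVec 0)

theorem hasDerivAt_comp_worldline {t : ℝ} (hf : ContDiffAt ℝ ∞ f (worldline t)) :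
    HasDerivAt (fun s => f (worldline s)) (partialDeriv 0 f (worldline t)) t :=
  ((hf.differentiableAt (by simp)).hasFDerivAt.comp_hasDerivAt t (hasDerivAt_worldline t))

theorem isOpen_lifetime (hU : IsOpen U) : IsOpen (lifetime U) :=
  hU.preimage contDiff_worldline.continuous

theorem worldline_succ (t : ℝ) (i : Fin 3) : worldline t i.succ = 0 := rfl

theorem IsTest.comp_worldline (hf : IsTest U f) : IsLineTest (lifetime U) fun t => f (worldline t) := by
  refine ⟨hf.contDiff.comp contDiff_worldline, worldline ⁻¹' tsupport f, ?_, fun t ht =>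
    hf.subset ht, fun t ht => image_eq_zero_of_notMem_tsupport ht⟩
  have h1 : IsCompact ((fun x : Event => x 0) '' tsupport f) :=
    hf.isCompact.image (continuous_apply 0)
  exact h1.of_isClosed_subset ((isClosed_tsupport f).preimage contDiff_worldline.continuous)
    fun t ht => ⟨worldline t, ht, rfl⟩

theorem IsLineTest.exists_extension (hU : IsOpen U) {h : ℝ → ℝ} (hh : IsLineTest (lifetime U) h) :
    ∃ f, IsTest U f ∧ ∀ t, f (worldline t) = h t := by
  obtain ⟨hh, K, hK, hKI, h0⟩ := hh
  obtain ⟨η, hη, hη1⟩ := exists_isTest_one_nhds hU (hK.image contDiff_worldline.continuous)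
    (image_subset_iff.2 hKI)
  refine ⟨fun x => h (x 0) * η x, hη.mul_left fun x _ => ?_, fun t => ?_⟩
  · exact hh.contDiffAt.comp x (contDiff_apply ℝ ℝ (0 : Fin 4)).contDiffAt
  · change h t * η (worldline t) = h t
    by_cases ht : t ∈ K
    · rw [(hη1 _ ⟨t, ht, rfl⟩).self_of_nhds, mul_one]
    · rw [h0 t ht, zero_mul]

/-- A functional of test functions that vanishes on derivatives along the worldline is a multiple of
the integral along the worldline. -/
theorem exists_eq_integral_worldline (hU : IsOpen U) (hI : (lifetime U).OrdConnected) {b : ℝ → ℝ}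
    (hb : ∀ t ∈ lifetime U, ContDiffAt ℝ ∞ b t) (hb0 : ∀ t ∈ lifetime U, b t ≠ 0)
    {S : (Event → ℝ) → ℝ}
    (hadd : ∀ f f', IsTest U f → IsTest U f' → S (fun x => f x + f' x) = S f + S f')
    (hsmul : ∀ c f, IsTest U f → S (fun x => c * f x) = c * S f)
    (h0 : ∀ f h, IsTest U f → IsLineTest (lifetime U) h →
      (∀ t ∈ lifetime U, f (worldline t) = b t * deriv h t) → S f = 0) :
    ∃ c, ∀ f, IsTest U f → S f = c * ∫ t in lifetime U, f (worldline t) / b t := by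
  -- If the worldline does not meet `U`, then `h0` with `h = 0` shows that the functional vanishes.
  rcases (lifetime U).eq_empty_or_nonempty with hemp | ⟨t₀, ht₀⟩
  · refine ⟨0, fun f hf => ?_⟩
    rw [zero_mul]
    refine h0 f (fun _ => 0) hf ⟨contDiff_const, ∅, isCompact_empty, empty_subset _,
      fun _ _ => rfl⟩ fun t ht => ?_
    rw [hemp] at ht
    exact ht.elim
  obtain ⟨p, hp1, hp2, hp3, hp4, hp5⟩ := exists_contDiff_tsupport_subset (n := ⊤)
    ((isOpen_lifetime hU).mem_nhds ht₀)
  have hp : IsLineTest (lifetime U) p :=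
    ⟨hp3, _, hp2, hp1, fun t ht => image_eq_zero_of_notMem_tsupport ht⟩
  have hpos : 0 < ∫ t, p t :=
    hp3.continuous.integral_pos_of_hasCompactSupport_nonneg_nonzero hp2
      (fun t => (hp4 ⟨t, rfl⟩).1) (x := t₀) (by rw [hp5]; exact one_ne_zero)
  obtain ⟨f₀, hf₀, hf₀p⟩ := (hp.mul_left hb).exists_extension hU
  refine ⟨S f₀ / ∫ t, p t, fun f hf => ?_⟩
  have hq : IsLineTest (lifetime U) fun t => (b t)⁻¹ * f (worldline t) :=
    hf.comp_worldline.mul_left fun t ht => (hb t ht).inv (hb0 t ht)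
  have hqe : ∫ t in lifetime U, f (worldline t) / b t = ∫ t, (b t)⁻¹ * f (worldline t) := by
    rw [← hq.setIntegral_eq]
    simp only [div_eq_inv_mul]
  rw [hqe]
  -- Subtracting `m` times the reference function `f₀`, which restricts to `b p`, leaves a function
  -- whose quotient by `b` has mean zero and so is a derivative; the functional vanishes on it.
  set m := (∫ t, (b t)⁻¹ * f (worldline t)) / ∫ t, p t with hm
  have hmp : IsLineTest (lifetime U) fun t => -m * p t := hp.mul_left fun t _ => contDiffAt_const
  obtain ⟨H, hH, hH'⟩ := (hq.add hmp).exists_primitive hI (by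
    rw [integral_add hq.integrable hmp.integrable, integral_const_mul, hm]
    field_simp
    ring)
  have hmf : IsTest U fun x => -m * f₀ x := hf₀.mul_left fun _ _ => contDiffAt_const
  have h1 : S (fun x => f x + -m * f₀ x) = 0 := by
    refine h0 _ H (hf.add hmf) hH fun t ht => ?_
    rw [hH', hf₀p]
    field_simp [hb0 t ht]
  rw [hadd _ _ hf hmf, hsmul _ _ hf₀] at h1
  have h2 : S f = m * S f₀ := by linarith
  rw [h2, hm]
  ring

end Worldline

/-! ### Linear functionals of test functions on the worldline -/

/-- A linear functional of test functions on `U` that depends on the values on the worldline only. -/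
structure IsLineFunctional (U : Set Event) (S : (Event → ℝ) → ℝ) : Prop where
  map_add : ∀ f f', IsTest U f → IsTest U f' → S (fun x => f x + f' x) = S f + S f'
  map_mul : ∀ c f, IsTest U f → S (fun x => c * f x) = c * S f
  congr : ∀ f f', IsTest U f → IsTest U f' →
    (∀ t ∈ lifetime U, f (worldline t) = f' (worldline t)) → S f = S f'

section LineFunctional

variable {U : Set Event} {S S' : (Event → ℝ) → ℝ}

theorem IsTest.mul_right {f c : Event → ℝ} (hf : IsTest U f) (hc : ∀ x ∈ U, ContDiffAt ℝ ∞ c x) :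
    IsTest U fun x => f x * c x :=
  hf.smul_right hc

theorem IsLineFunctional.map_zero (hS : IsLineFunctional U S) : S (fun _ => 0) = 0 := by
  simpa using hS.map_mul 0 (fun _ => 0) isTest_zero

theorem IsLineFunctional.map_sum (hS : IsLineFunctional U S) {ι : Type} (s : Finset ι)
    {f : ι → Event → ℝ} (hf : ∀ i, IsTest U (f i)) :
    S (fun x => ∑ i ∈ s, f i x) = ∑ i ∈ s, S (f i) := by
  classical
  induction s using Finset.induction_on with
  | empty => simpa using hS.map_zero
  | insert i s hi ih =>
    simp only [Finset.sum_insert hi]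
    rw [hS.map_add _ _ (hf i) (IsTest.sum s hf), ih]

theorem IsLineFunctional.mul_right (hS : IsLineFunctional U S) {c : Event → ℝ}
    (hc : ∀ x ∈ U, ContDiffAt ℝ ∞ c x) : IsLineFunctional U fun f => S fun x => f x * c x where
  map_add f f' hf hf' := by
    rw [← hS.map_add _ _ (hf.mul_right hc) (hf'.mul_right hc)]
    simp only [add_mul]
  map_mul a f hf := by
    rw [← hS.map_mul _ _ (hf.mul_right hc)]
    simp only [mul_assoc]
  congr f f' hf hf' h := hS.congr _ _ (hf.mul_right hc) (hf'.mul_right hc) fun t ht => by rw [h t ht]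

theorem IsLineFunctional.sum {ι : Type} (s : Finset ι) {Λ : ι → (Event → ℝ) → ℝ}
    (hS : ∀ i, IsLineFunctional U (Λ i)) : IsLineFunctional U fun f => ∑ i ∈ s, Λ i f where
  map_add f f' hf hf' := by
    rw [← Finset.sum_add_distrib]
    exact Finset.sum_congr rfl fun i _ => (hS i).map_add f f' hf hf'
  map_mul a f hf := by
    rw [Finset.mul_sum]
    exact Finset.sum_congr rfl fun i _ => (hS i).map_mul a f hf
  congr f f' hf hf' h := Finset.sum_congr rfl fun i _ => (hS i).congr f f' hf hf' h

end LineFunctional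

/-! ### Lie derivatives along multiples of coordinate vectors -/

section Lie

variable {U : Set Event} {ψ : FieldConfig} {k : Event → ℝ} {x : Event}

theorem partialDeriv_mul {f g : Event → ℝ} (hf : ContDiffAt ℝ ∞ f x) (hg : ContDiffAt ℝ ∞ g x)
    (μ : Fin 4) : partialDeriv μ (fun y => f y * g y) x =
      f x * partialDeriv μ g x + partialDeriv μ f x * g x := by
  rw [partialDeriv, fderiv_fun_mul (hf.differentiableAt (by simp)) (hg.differentiableAt (by simp))]
  simp only [_root_.add_apply, _root_.smul_apply, smul_eq_mul, partialDeriv]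
  ring

theorem partialDeriv_coord (μ ν : Fin 4) :
    partialDeriv μ (fun y => y ν) x = if μ = ν then 1 else 0 := by
  have h : HasFDerivAt (fun y : Event => y ν) (ContinuousLinearMap.proj (R := ℝ) ν) x :=
    hasFDerivAt_apply ν x
  rw [partialDeriv, h.fderiv]
  simp [coordVec, Pi.single_apply, eq_comm]

theorem fderiv_fst_apply (hψ : ContDiffAt ℝ ∞ ψ x) (v : Event) (μ ν : Fin 4) :
    (fderiv ℝ ψ x v).1 s(μ, ν) = fderiv ℝ (fun y => metric (ψ y) μ ν) x v := by
  have h := (tensorEv s(μ, ν)).hasFDerivAt.comp x (hψ.differentiableAt (by simp)).hasFDerivAt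
  exact (congrArg (fun L : Event →L[ℝ] ℝ => L v) h.fderiv).symm

theorem fderiv_snd_apply (hψ : ContDiffAt ℝ ∞ ψ x) (v : Event) (μ : Fin 4) :
    (fderiv ℝ ψ x v).2 μ = fderiv ℝ (fun y => (ψ y).2 μ) x v := by
  have h := (vectorEv μ).hasFDerivAt.comp x (hψ.differentiableAt (by simp)).hasFDerivAt
  exact (congrArg (fun L : Event →L[ℝ] ℝ => L v) h.fderiv).symm

theorem partialDeriv_smul_coordVec (hk : ContDiffAt ℝ ∞ k x) (μ ρ σ : Fin 4) :
    partialDeriv μ (fun y => (k y • coordVec ρ) σ) x =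
      if σ = ρ then partialDeriv μ k x else 0 := by
  have h : (fun y => (k y • coordVec ρ) σ) = fun y => k y * coordVec ρ σ := rfl
  rw [h, partialDeriv_mul hk contDiffAt_const]
  have h0 : partialDeriv μ (fun _ => coordVec ρ σ) x = 0 := by simp [partialDeriv]
  rw [h0]
  simp [coordVec, Pi.single_apply]

theorem lieDeriv_smul_coordVec_fst (hψ : ContDiffAt ℝ ∞ ψ x) (hk : ContDiffAt ℝ ∞ k x)
    (ρ μ ν : Fin 4) : (lieDeriv (fun y => k y • coordVec ρ) ψ x).1 s(μ, ν) =
      k x * partialDeriv ρ (fun y => metric (ψ y) μ ν) x +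
        (partialDeriv μ k x * metric (ψ x) ρ ν + partialDeriv ν k x * metric (ψ x) ρ μ) := by
  rw [lieDeriv_fst, fderiv_fst_apply hψ, map_smul, Finset.sum_add_distrib]
  simp only [partialDeriv_smul_coordVec hk, ite_mul, zero_mul, Finset.sum_ite_eq',
    Finset.mem_univ, if_true]
  rfl

theorem lieDeriv_smul_coordVec_snd (hψ : ContDiffAt ℝ ∞ ψ x) (hk : ContDiffAt ℝ ∞ k x)
    (ρ μ : Fin 4) : (lieDeriv (fun y => k y • coordVec ρ) ψ x).2 μ =
      k x * partialDeriv ρ (fun y => (ψ y).2 μ) x + partialDeriv μ k x * (ψ x).2 ρ := by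
  rw [lieDeriv_snd, fderiv_snd_apply hψ, map_smul]
  simp only [partialDeriv_smul_coordVec hk, ite_mul, zero_mul, Finset.sum_ite_eq',
    Finset.mem_univ, if_true]
  rfl

theorem sum_sum_comm {ι κ : Type} [Fintype ι] [Fintype κ] (F : ι → ι → κ → κ → ℝ) :
    ∑ μ, ∑ ν, ∑ α, ∑ β, F μ ν α β = ∑ α, ∑ β, ∑ μ, ∑ ν, F μ ν α β := by
  have h := Finset.sum_comm (s := (Finset.univ : Finset (ι × ι)))
    (t := (Finset.univ : Finset (κ × κ))) (f := fun p q => F p.1 p.2 q.1 q.2)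
  simpa only [Fintype.sum_prod_type] using h

/-- Lowering both indices of `δg^{μν}` returns `-δg_{μν}`. Contracted with a source of the form
`g_{μ0} g_{ν0} T^{00}`, a variation therefore enters only through `δg_{00}`. -/
theorem IsLorentzian.invMetricVariation_sum {v w : FieldValue} (hv : IsLorentzian v) :
    ∑ μ, ∑ ν, invMetricVariation v w μ ν * (metric v μ 0 * metric v ν 0) = -w.1 s(0, 0) := by
  have h1 : ∀ α, ∑ μ, invMetric v μ α * metric v μ 0 = if α = 0 then 1 else 0 := fun α => by
    rw [← hv.inv_mul_metric α 0]
    exact Finset.sum_congr rfl fun μ _ => by rw [invMetric_symm]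
  have h2 : ∀ μ ν, invMetricVariation v w μ ν * (metric v μ 0 * metric v ν 0) =
      -∑ α, ∑ β, (invMetric v μ α * metric v μ 0) * (invMetric v ν β * metric v ν 0) *
        w.1 s(α, β) := fun μ ν => by
    rw [invMetricVariation, neg_mul, Finset.sum_mul]
    congr 1
    refine Finset.sum_congr rfl fun α _ => ?_
    rw [Finset.sum_mul]
    exact Finset.sum_congr rfl fun β _ => by ring
  have h3 : ∑ μ, ∑ ν, ∑ α, ∑ β, (invMetric v μ α * metric v μ 0) *
      (invMetric v ν β * metric v ν 0) * w.1 s(α, β) =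
      ∑ α, ∑ β, (∑ μ, invMetric v μ α * metric v μ 0) * (∑ ν, invMetric v ν β * metric v ν 0) *
        w.1 s(α, β) := by
    rw [sum_sum_comm]
    refine Finset.sum_congr rfl fun α _ => Finset.sum_congr rfl fun β _ => ?_
    rw [Finset.sum_mul_sum, Finset.sum_mul]
    exact Finset.sum_congr rfl fun μ _ => (Finset.sum_mul _ _ _).symm
  simp only [h2, Finset.sum_neg_distrib, h3, h1]
  simp

/-- On the worldline this `w`, with `c = f`, is the Lie derivative of the metric along `x^i f ∂_ρ`,
where only the gradient of the coefficient survives. Raising its indices turns the factors `g_{ρβ}`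
into Kronecker deltas. -/
theorem IsLorentzian.invMetricVariation_of_single {v w : FieldValue} (hv : IsLorentzian v) {c : ℝ}
    {i ρ : Fin 4} (hw : ∀ α β, w.1 s(α, β) =
      (if α = i then c else 0) * metric v ρ β + (if β = i then c else 0) * metric v ρ α)
    (μ ν : Fin 4) : invMetricVariation v w μ ν =
      (if ν = ρ then -1 else 0) * (c * invMetric v i μ) +
        (if μ = ρ then -1 else 0) * (c * invMetric v i ν) := by
  have h1 : ∀ ν, ∑ β, invMetric v ν β * metric v ρ β = if ν = ρ then 1 else 0 := fun ν => by
    rw [← hv.inv_mul_metric ν ρ]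
    exact Finset.sum_congr rfl fun β _ => by rw [metric_symm]
  have h2 : ∑ α, ∑ β, invMetric v μ α * invMetric v ν β * w.1 s(α, β) =
      (∑ α, invMetric v μ α * if α = i then c else 0) * (∑ β, invMetric v ν β * metric v ρ β) +
      (∑ α, invMetric v μ α * metric v ρ α) * (∑ β, invMetric v ν β * if β = i then c else 0) := by
    simp only [Finset.sum_mul_sum, ← Finset.sum_add_distrib]
    refine Finset.sum_congr rfl fun α _ => Finset.sum_congr rfl fun β _ => ?_
    rw [hw]
    ring
  rw [invMetricVariation, h2, h1, h1]
  simp only [mul_ite, mul_zero, Finset.sum_ite_eq', Finset.mem_univ, if_true,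
    invMetric_symm v i]
  split_ifs <;> ring

end Lie

/-! ### Sources on the worldline that satisfy the Noether identities -/

/-- A source on the worldline with components `tensor μ ν`, `vector μ`, that satisfies the identities
of a linearized diffeomorphism-covariant and gauge-invariant theory. -/
structure IsConservedSource (U : Set Event) (ψ : FieldConfig)
    (tensor : Fin 4 → Fin 4 → (Event → ℝ) → ℝ) (vector : Fin 4 → (Event → ℝ) → ℝ) : Prop where
  tensor_functional : ∀ μ ν, IsLineFunctional U (tensor μ ν)
  vector_functional : ∀ μ, IsLineFunctional U (vector μ)
  symm : ∀ μ ν, tensor μ ν = tensor ν μ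
  gauge : ∀ χ, IsTest U χ → ∑ μ, vector μ (partialDeriv μ χ) = 0
  diffeo : ∀ ξ : Event → Event, IsTest U ξ →
    ∑ μ, ∑ ν, tensor μ ν (fun x => invMetricVariation (ψ x) (lieDeriv ξ ψ x) μ ν) =
      ∑ μ, vector μ (fun x => (lieDeriv ξ ψ x).2 μ)

section Conserved

variable {U : Set Event} {ψ : FieldConfig} {tensor : Fin 4 → Fin 4 → (Event → ℝ) → ℝ}
  {vector : Fin 4 → (Event → ℝ) → ℝ} {f k : Event → ℝ}

theorem contDiffAt_metric_comp (hU : IsOpen U) (hψ : IsSmoothConfig ψ U) (μ ν : Fin 4) :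
    ∀ x ∈ U, ContDiffAt ℝ ∞ (fun y => metric (ψ y) μ ν) x := fun x hx =>
  (contDiff_metric_apply μ ν).contDiffAt.comp x (contDiffAt_of_isSmoothConfig hU hψ hx)

theorem contDiffAt_invMetric_comp (hU : IsOpen U) (hψ : IsSmoothConfig ψ U) (μ ν : Fin 4) :
    ∀ x ∈ U, ContDiffAt ℝ ∞ (fun y => invMetric (ψ y) μ ν) x := fun x hx =>
  (contDiffAt_invMetric (hψ.2 x hx) μ ν).comp x (contDiffAt_of_isSmoothConfig hU hψ hx)

theorem contDiffAt_covector_comp (hU : IsOpen U) (hψ : IsSmoothConfig ψ U) (μ : Fin 4) :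
    ∀ x ∈ U, ContDiffAt ℝ ∞ (fun y => (ψ y).2 μ) x := fun x hx =>
  (vectorEv μ).contDiff.contDiffAt.comp x (contDiffAt_of_isSmoothConfig hU hψ hx)

theorem IsTest.partialDeriv (hf : IsTest U f) (μ : Fin 4) : IsTest U (partialDeriv μ f) :=
  hf.fderiv_apply _

theorem isTest_coord_mul (hf : IsTest U f) (μ : Fin 4) : IsTest U fun x => x μ * f x :=
  hf.mul_left fun _ _ => (contDiff_apply ℝ ℝ μ).contDiffAt

theorem partialDeriv_coord_mul (hf : IsTest U f) (i : Fin 3) (μ : Fin 4) (t : ℝ) :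
    partialDeriv μ (fun x => x i.succ * f x) (worldline t) =
      if μ = i.succ then f (worldline t) else 0 := by
  rw [partialDeriv_mul (contDiff_apply ℝ ℝ i.succ).contDiffAt (hf.contDiffAt _),
    worldline_succ, zero_mul, zero_add, partialDeriv_coord, ite_mul, one_mul, zero_mul]

/-- The gauge parameter `x^i f` has gradient `f dx^i` on the worldline, which isolates one spatial
component of the current. -/
theorem IsConservedSource.vector_succ (h : IsConservedSource U ψ tensor vector) (hf : IsTest U f)
    (i : Fin 3) : vector i.succ f = 0 := by
  have h1 := h.gauge _ (isTest_coord_mul hf i.succ)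
  have h2 : ∀ μ, vector μ (partialDeriv μ fun x => x i.succ * f x) =
      (if μ = i.succ then 1 else 0) * vector μ f := fun μ => by
    rw [← (h.vector_functional μ).map_mul _ _ hf]
    refine (h.vector_functional μ).congr _ _ ((isTest_coord_mul hf i.succ).partialDeriv μ)
      (hf.mul_left fun _ _ => contDiffAt_const) fun t _ => ?_
    rw [partialDeriv_coord_mul hf, ite_mul, one_mul, zero_mul]
  simpa [h2] using h1

theorem IsConservedSource.vector_zero_partialDeriv (h : IsConservedSource U ψ tensor vector)
    (hf : IsTest U f) : vector 0 (partialDeriv 0 f) = 0 := by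
  have h1 := h.gauge f hf
  rw [Fin.sum_univ_succ] at h1
  simpa [h.vector_succ (hf.partialDeriv _)] using h1

theorem isTest_invMetricVariation (hU : IsOpen U) (hψ : IsSmoothConfig ψ U) {w : FieldConfig}
    (hw : IsTest U w) (μ ν : Fin 4) :
    IsTest U fun x => invMetricVariation (ψ x) (w x) μ ν := by
  refine hw.of_left (fun x hx => ?_) fun x hx => ?_
  · refine ContDiffAt.neg (ContDiffAt.sum fun α _ => ContDiffAt.sum fun β _ => ?_)
    exact ((contDiffAt_invMetric_comp hU hψ μ α x hx).mul
      (contDiffAt_invMetric_comp hU hψ ν β x hx)).mul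
      ((tensorEv s(α, β)).contDiff.contDiffAt.comp x (hw.contDiffAt x))
  · simp [invMetricVariation, image_eq_zero_of_notMem_tsupport hx]

theorem isTest_tensor_component {w : FieldConfig} (hw : IsTest U w) (e : Sym2 (Fin 4)) :
    IsTest U fun x => (w x).1 e :=
  hw.of_left (fun x _ => (tensorEv e).contDiff.contDiffAt.comp x (hw.contDiffAt x)) fun x hx => by
    rw [image_eq_zero_of_notMem_tsupport hx]; rfl

theorem isTest_vector_component {w : FieldConfig} (hw : IsTest U w) (μ : Fin 4) :
    IsTest U fun x => (w x).2 μ :=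
  hw.of_left (fun x _ => (vectorEv μ).contDiff.contDiffAt.comp x (hw.contDiffAt x)) fun x hx => by
    rw [image_eq_zero_of_notMem_tsupport hx]; rfl

/-- The mixed spatial components of the source vanish. -/
theorem IsConservedSource.tensor_succ (h : IsConservedSource U ψ tensor vector) (hU : IsOpen U)
    (hψ : IsSmoothConfig ψ U) (hf : IsTest U f) (i : Fin 3) (ρ : Fin 4) :
    ∑ μ, tensor μ ρ (fun x => f x * invMetric (ψ x) i.succ μ) = 0 := by
  have hψ' : ∀ x ∈ U, ContDiffAt ℝ ∞ ψ x := fun x hx => contDiffAt_of_isSmoothConfig hU hψ hx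
  have hk := isTest_coord_mul hf i.succ
  have hξ : IsTest U fun x => (x i.succ * f x) • coordVec ρ :=
    hk.smul_right fun _ _ => contDiffAt_const
  have hw := isTest_lieDeriv hψ' hξ
  have hG : ∀ μ, IsTest U fun x => f x * invMetric (ψ x) i.succ μ := fun μ =>
    hf.mul_right (contDiffAt_invMetric_comp hU hψ i.succ μ)
  -- On the worldline the Lie derivative of `A` along `x^i f ∂_ρ` is `f A_ρ dx^i`, so it meets only
  -- a spatial component of the current, already known to vanish.
  have hR : ∑ μ, vector μ (fun x => (lieDeriv (fun x => (x i.succ * f x) • coordVec ρ) ψ x).2 μ)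
      = 0 := by
    refine Finset.sum_eq_zero fun μ _ => ?_
    have hA : IsTest U fun x => f x * (ψ x).2 ρ := hf.mul_right (contDiffAt_covector_comp hU hψ ρ)
    have h1 : vector μ (fun x => (lieDeriv (fun x => (x i.succ * f x) • coordVec ρ) ψ x).2 μ) =
        (if μ = i.succ then 1 else 0) * vector μ (fun x => f x * (ψ x).2 ρ) := by
      rw [← (h.vector_functional μ).map_mul _ _ hA]
      refine (h.vector_functional μ).congr _ _ (isTest_vector_component hw μ)
        (hA.mul_left fun _ _ => contDiffAt_const) fun t ht => ?_
      rw [lieDeriv_smul_coordVec_snd (hψ' _ ht) (hk.contDiffAt _), partialDeriv_coord_mul hf,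
        worldline_succ]
      split_ifs <;> ring
    rw [h1]
    split_ifs with hμ
    · rw [hμ, h.vector_succ hA, mul_zero]
    · rw [zero_mul]
  have hL : ∀ μ ν, tensor μ ν (fun x => invMetricVariation (ψ x)
      (lieDeriv (fun x => (x i.succ * f x) • coordVec ρ) ψ x) μ ν) =
      (if ν = ρ then -1 else 0) * tensor μ ν (fun x => f x * invMetric (ψ x) i.succ μ) +
        (if μ = ρ then -1 else 0) * tensor μ ν (fun x => f x * invMetric (ψ x) i.succ ν) := by
    intro μ ν
    have hT := h.tensor_functional μ ν
    rw [← hT.map_mul _ _ (hG μ), ← hT.map_mul _ _ (hG ν), ← hT.map_add]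
    · refine hT.congr _ _ (isTest_invMetricVariation hU hψ hw μ ν) (IsTest.add
        ((hG μ).mul_left fun _ _ => contDiffAt_const)
        ((hG ν).mul_left fun _ _ => contDiffAt_const)) fun t ht => ?_
      refine (hψ.2 _ ht).invMetricVariation_of_single (fun α β => ?_) μ ν
      rw [lieDeriv_smul_coordVec_fst (hψ' _ ht) (hk.contDiffAt _), partialDeriv_coord_mul hf,
        partialDeriv_coord_mul hf, worldline_succ, zero_mul, zero_mul, zero_add]
    · exact (hG μ).mul_left fun _ _ => contDiffAt_const
    · exact (hG ν).mul_left fun _ _ => contDiffAt_const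
  have h1 := h.diffeo _ hξ
  rw [hR] at h1
  simp only [hL, Finset.sum_add_distrib, ite_mul, zero_mul, Finset.sum_ite_eq', Finset.mem_univ,
    if_true] at h1
  -- The two terms of the variation give equal sums by symmetry of the source, so the identity says
  -- that twice the desired sum is zero.
  rw [Finset.sum_comm (f := fun μ ν => if μ = ρ then
    -1 * tensor μ ν (fun x => f x * invMetric (ψ x) i.succ ν) else 0)] at h1
  simp only [Finset.sum_ite_eq', Finset.mem_univ, if_true, h.symm ρ, neg_one_mul,
    Finset.sum_neg_distrib] at h1
  linarith

/-- The energy component of the source. -/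
def energySource (ψ : FieldConfig) (tensor : Fin 4 → Fin 4 → (Event → ℝ) → ℝ) (f : Event → ℝ) : ℝ :=
  ∑ κ, ∑ ρ, tensor ρ κ (fun x => f x * invMetric (ψ x) 0 κ * invMetric (ψ x) 0 ρ)

theorem IsConservedSource.isLineFunctional_energySource (h : IsConservedSource U ψ tensor vector)
    (hU : IsOpen U) (hψ : IsSmoothConfig ψ U) : IsLineFunctional U (energySource ψ tensor) :=
  IsLineFunctional.sum _ fun κ => IsLineFunctional.sum _ fun ρ =>
    ((h.tensor_functional ρ κ).mul_right (contDiffAt_invMetric_comp hU hψ 0 ρ)).mul_right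
      (contDiffAt_invMetric_comp hU hψ 0 κ)

/-- Insert `δ_μ^ρ = g_{μα} g^{αρ}`: the terms with spatial `α` vanish by `tensor_succ`, leaving `α =
0`. -/
theorem IsConservedSource.tensor_eq_sum (h : IsConservedSource U ψ tensor vector)
    (hU : IsOpen U) (hψ : IsSmoothConfig ψ U) (hf : IsTest U f) (μ ν : Fin 4) :
    tensor μ ν f = ∑ ρ, tensor ρ ν (fun x => f x * metric (ψ x) μ 0 * invMetric (ψ x) 0 ρ) := by
  have hg : ∀ α, IsTest U fun x => f x * metric (ψ x) μ α := fun α =>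
    hf.mul_right (contDiffAt_metric_comp hU hψ μ α)
  have hgG : ∀ ρ α, IsTest U fun x => f x * metric (ψ x) μ α * invMetric (ψ x) α ρ := fun ρ α =>
    (hg α).mul_right (contDiffAt_invMetric_comp hU hψ α ρ)
  have h1 : ∀ ρ, ∑ α, tensor ρ ν (fun x => f x * metric (ψ x) μ α * invMetric (ψ x) α ρ) =
      (if μ = ρ then 1 else 0) * tensor ρ ν f := by
    intro ρ
    have hT := h.tensor_functional ρ ν
    rw [← hT.map_mul _ _ hf, ← hT.map_sum _ (hgG ρ)]
    refine hT.congr _ _ (IsTest.sum _ (hgG ρ)) (hf.mul_left fun _ _ => contDiffAt_const)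
      fun t ht => ?_
    rw [← (hψ.2 _ ht).metric_mul_inv μ ρ, Finset.sum_mul]
    exact Finset.sum_congr rfl fun α _ => by ring
  have h2 : tensor μ ν f =
      ∑ ρ, ∑ α, tensor ρ ν (fun x => f x * metric (ψ x) μ α * invMetric (ψ x) α ρ) := by
    simp [h1]
  rw [h2, Finset.sum_comm, Fin.sum_univ_succ]
  rw [Finset.sum_eq_zero (s := (Finset.univ : Finset (Fin 3))), add_zero]
  exact fun i _ => h.tensor_succ hU hψ (hg i.succ) i ν

/-- The reduction `tensor_eq_sum` is applied to each of the two indices. It leaves a single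
functional, the energy component `T^{00}`, as the only freedom in the source. -/
theorem IsConservedSource.tensor_eq (h : IsConservedSource U ψ tensor vector)
    (hU : IsOpen U) (hψ : IsSmoothConfig ψ U) (hf : IsTest U f) (μ ν : Fin 4) :
    tensor μ ν f = energySource ψ tensor (fun x => f x * (metric (ψ x) μ 0 * metric (ψ x) ν 0)) := by
  rw [h.tensor_eq_sum hU hψ hf, energySource]
  refine Finset.sum_congr rfl fun κ _ => ?_
  rw [h.symm, h.tensor_eq_sum hU hψ ((hf.mul_right (contDiffAt_metric_comp hU hψ μ 0)).mul_right
    (contDiffAt_invMetric_comp hU hψ 0 κ))]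
  refine Finset.sum_congr rfl fun ρ _ => congrArg _ (funext fun x => ?_)
  ring

/-- Conservation of energy and momentum. -/
theorem IsConservedSource.energySource_add (h : IsConservedSource U ψ tensor vector)
    (hU : IsOpen U) (hψ : IsSmoothConfig ψ U) (hk : IsTest U k) (ρ : Fin 4) :
    energySource ψ tensor (fun x => (lieDeriv (fun y => k y • coordVec ρ) ψ x).1 s(0, 0)) +
      vector 0 (fun x => (lieDeriv (fun y => k y • coordVec ρ) ψ x).2 0) = 0 := by
  have hψ' : ∀ x ∈ U, ContDiffAt ℝ ∞ ψ x := fun x hx => contDiffAt_of_isSmoothConfig hU hψ hx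
  have hξ : IsTest U fun x => k x • coordVec ρ := hk.smul_right fun _ _ => contDiffAt_const
  have hw := isTest_lieDeriv hψ' hξ
  have h1 := h.diffeo _ hξ
  rw [Fin.sum_univ_succ (fun μ => vector μ _), Finset.sum_eq_zero
    (s := (Finset.univ : Finset (Fin 3))) fun i _ =>
      h.vector_succ (isTest_vector_component hw i.succ) i, add_zero] at h1
  have hQ := h.isLineFunctional_energySource hU hψ
  have hV := isTest_invMetricVariation hU hψ hw
  have hgg : ∀ μ ν, ∀ x ∈ U, ContDiffAt ℝ ∞ (fun x => metric (ψ x) μ 0 * metric (ψ x) ν 0) x :=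
    fun μ ν x hx => (contDiffAt_metric_comp hU hψ μ 0 x hx).mul
      (contDiffAt_metric_comp hU hψ ν 0 x hx)
  have hVg : ∀ μ ν, IsTest U _ := fun μ ν => (hV μ ν).mul_right (hgg μ ν)
  have h2 : -1 * energySource ψ tensor
      (fun x => (lieDeriv (fun y => k y • coordVec ρ) ψ x).1 s(0, 0)) =
      vector 0 (fun x => (lieDeriv (fun y => k y • coordVec ρ) ψ x).2 0) := by
    rw [← h1]
    simp only [h.tensor_eq hU hψ (hV _ _)]
    simp only [← hQ.map_sum _ (hVg _)]
    rw [← hQ.map_sum _ fun μ => IsTest.sum _ (hVg μ),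
      ← hQ.map_mul _ _ (isTest_tensor_component hw s(0, 0))]
    refine hQ.congr _ _ ((isTest_tensor_component hw s(0, 0)).mul_left fun _ _ => contDiffAt_const)
      (IsTest.sum _ fun μ => IsTest.sum _ (hVg μ)) fun t ht => ?_
    rw [(hψ.2 _ ht).invMetricVariation_sum, neg_one_mul]
  linarith

end Conserved

/-! ### The source of a linearized solution is conserved -/

section Source

variable {T : VectorTensorTheory} {U : Set Event} {ψ₀ φ : FieldConfig}
  {w w' : Event → (FieldValue →L[ℝ] ℝ)}

theorem pd_const_smul {Y : Type} [NormedAddCommGroup Y] [NormedSpace ℝ Y] {f : Event → Y}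
    (hf : ContDiff ℝ ∞ f) (c : ℝ) (μ : Fin 4) : pd μ (fun y => c • f y) = fun x => c • pd μ f x := by
  funext x
  rw [pd, fderiv_fun_const_smul (hf.contDiffAt.differentiableAt (by simp))]
  rfl

theorem adjJet_const_smul {B : Event → (Jet 2 →L[ℝ] ℝ)} (hB : IsTest U B) (c : ℝ) (x : Event) :
    adjJet (fun y => c • B y) x = c • adjJet B x := by
  have h1 : ∀ μ, pd μ (fun y => c • (B y).comp (jetOne μ)) = _ := fun μ =>
    pd_const_smul (hB.clm_comp (jetOne μ)).contDiff c μ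
  have h2 : ∀ μ ν, pd ν (pd μ fun y => c • (B y).comp (jetTwo μ ν)) =
      fun x => c • pd ν (pd μ fun y => (B y).comp (jetTwo μ ν)) x := fun μ ν => by
    rw [pd_const_smul (hB.clm_comp (jetTwo μ ν)).contDiff c μ,
      pd_const_smul ((hB.clm_comp (jetTwo μ ν)).pd μ).contDiff c ν]
  simp only [adjJet, ContinuousLinearMap.smul_comp, h1, h2, smul_add, smul_sub, Finset.smul_sum]

theorem source_const_smul (hU : IsOpen U) (hψ₀ : IsSmoothConfig ψ₀ U) (hw : IsTest U w) (c : ℝ) :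
    source T ψ₀ φ (fun x => c • w x) = c * source T ψ₀ φ w := by
  have h1 := isTest_sourceForm (T := T) hU hψ₀ hw
  have h3 : sourceForm T ψ₀ (fun x => c • w x) = fun x => c • sourceForm T ψ₀ w x := by
    funext x
    simp only [sourceForm, ContinuousLinearMap.smul_comp, smul_comm c]
  have h4 : ∀ x, adjJet (sourceForm T ψ₀ fun x => c • w x) x (φ x) =
      c * adjJet (sourceForm T ψ₀ w) x (φ x) := by
    intro x
    rw [h3, adjJet_const_smul h1]; rfl
  simp only [source, h4]
  exact integral_const_mul _ _

theorem source_sum (hU : IsOpen U) (hψ₀ : IsSmoothConfig ψ₀ U) (hφ : IsSingularField U φ) {ι : Type}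
    (s : Finset ι) {w : ι → Event → (FieldValue →L[ℝ] ℝ)} (hw : ∀ i, IsTest U (w i)) :
    source T ψ₀ φ (fun x => ∑ i ∈ s, w i x) = ∑ i ∈ s, source T ψ₀ φ (w i) := by
  classical
  induction s using Finset.induction_on with
  | empty =>
    simpa using source_const_smul (T := T) (φ := φ) hU hψ₀
      (isTest_zero (U := U) (Y := FieldValue →L[ℝ] ℝ)) 0
  | insert i s hi ih =>
    simp only [Finset.sum_insert hi]
    rw [source_add hU hψ₀ hφ (hw i) (IsTest.sum s hw), ih]

theorem source_congr (hU : IsOpen U) (hψ₀ : IsSmoothConfig ψ₀ U) (hφ : IsSingularField U φ)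
    (hE : ∀ x ∈ U, spatial x ≠ 0 → linearizedFieldEq T ψ₀ φ x = 0) (hw : IsTest U w)
    (hw' : IsTest U w') (h : ∀ t ∈ lifetime U, w (worldline t) = w' (worldline t)) :
    source T ψ₀ φ w = source T ψ₀ φ w' := by
  have h1 : IsTest U fun x => (-1 : ℝ) • w' x := hw'.smul_left fun _ _ => contDiffAt_const
  have h2 := source_add (T := T) hU hψ₀ hφ hw h1
  have h3 : source T ψ₀ φ (fun x => w x + (-1 : ℝ) • w' x) = 0 := by
    refine source_eq_zero_of_worldline hU hψ₀ hφ hE (hw.add h1) fun t => ?_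
    by_cases ht : t ∈ lifetime U
    · rw [h t ht]
      exact ContinuousLinearMap.ext fun v => by simp
    · have h3 : worldline t ∉ U := ht
      rw [image_eq_zero_of_notMem_tsupport fun h => h3 (hw.subset h),
        image_eq_zero_of_notMem_tsupport fun h => h3 (hw'.subset h), smul_zero, add_zero]
  rw [source_const_smul hU hψ₀ hw', h3] at h2
  linarith

theorem IsTest.smul_const {f : Event → ℝ} (hf : IsTest U f) (e : FieldValue →L[ℝ] ℝ) :
    IsTest U fun x => f x • e := hf.smul_right fun _ _ => contDiffAt_const

theorem isLineFunctional_source (hU : IsOpen U) (hψ₀ : IsSmoothConfig ψ₀ U)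
    (hφ : IsSingularField U φ)
    (hE : ∀ x ∈ U, spatial x ≠ 0 → linearizedFieldEq T ψ₀ φ x = 0) (e : FieldValue →L[ℝ] ℝ) :
    IsLineFunctional U fun f => source T ψ₀ φ fun x => f x • e where
  map_add f f' hf hf' := by
    rw [← source_add hU hψ₀ hφ (hf.smul_const e) (hf'.smul_const e)]
    simp only [add_smul]
  map_mul c f hf := by
    rw [← source_const_smul hU hψ₀ (hf.smul_const e)]
    simp only [smul_smul]
  congr f f' hf hf' h := source_congr hU hψ₀ hφ hE (hf.smul_const e) (hf'.smul_const e)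
    fun t ht => by rw [h t ht]

theorem isTest_pairing (hU : IsOpen U) (hψ₀ : IsSmoothConfig ψ₀ U) {v : FieldConfig}
    (hv : IsTest U v) : IsTest U fun x => pairing (ψ₀ x) (v x) :=
  hv.of_left (fun x hx => ContDiffAt.comp (g := fun p : FieldValue × FieldValue =>
    pairing p.1 p.2) (f := fun x => (ψ₀ x, v x)) x (contDiffAt_pairing (hψ₀.2 x hx) _)
    ((contDiffAt_of_isSmoothConfig hU hψ₀ hx).prodMk (hv.contDiffAt x))) fun x hx => by
      rw [image_eq_zero_of_notMem_tsupport hx, pairing_zero]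

theorem source_pairing (hU : IsOpen U) (hψ₀ : IsSmoothConfig ψ₀ U) (hφ : IsSingularField U φ)
    {v : FieldConfig} (hv : IsTest U v) : source T ψ₀ φ (fun x => pairing (ψ₀ x) (v x)) =
      ∑ μ, ∑ ν, source T ψ₀ φ (fun x => invMetricVariation (ψ₀ x) (v x) μ ν • tensorEv s(μ, ν)) -
        ∑ μ, source T ψ₀ φ (fun x => (v x).2 μ • vectorEv μ) := by
  have h1 : ∀ μ ν, IsTest U fun x => invMetricVariation (ψ₀ x) (v x) μ ν • tensorEv s(μ, ν) :=
    fun μ ν => (isTest_invMetricVariation hU hψ₀ hv μ ν).smul_const _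
  have h2 : ∀ μ, IsTest U fun x => (v x).2 μ • vectorEv μ :=
    fun μ => (isTest_vector_component hv μ).smul_const _
  have h3 := isTest_pairing hU hψ₀ hv
  have h4 := source_add (T := T) hU hψ₀ hφ h3 (IsTest.sum Finset.univ h2)
  simp only [pairing, sub_add_cancel] at h4
  rw [source_sum hU hψ₀ hφ _ h2, source_sum hU hψ₀ hφ _ fun μ => IsTest.sum _ (h1 μ)] at h4
  simp only [source_sum hU hψ₀ hφ _ (h1 _)] at h4
  exact eq_sub_of_add_eq h4.symm

/-- The pairing of the source with a gauge variation or a Lie derivative is a linearized Noether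
identity, so it vanishes; `source_pairing` expands this into components. -/
theorem isConservedSource_source (hT : T.HasMaxwellSymmetry) (hU : IsOpen U)
    (hψ₀ : IsSmoothConfig ψ₀ U) (h0 : ∀ x ∈ U, T.fieldEq (jet 2 ψ₀ x) = 0)
    (hφ : IsSingularField U φ)
    (hE : ∀ x ∈ U, spatial x ≠ 0 → linearizedFieldEq T ψ₀ φ x = 0) :
    IsConservedSource U ψ₀ (fun μ ν f => source T ψ₀ φ fun x => f x • tensorEv s(μ, ν))
      (fun μ f => source T ψ₀ φ fun x => f x • vectorEv μ) where
  tensor_functional μ ν := isLineFunctional_source hU hψ₀ hφ hE _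
  vector_functional μ := isLineFunctional_source hU hψ₀ hφ hE _
  symm μ ν := by simp only [Sym2.eq_swap]
  gauge χ hχ := by
    have h1 := source_pairing (T := T) hU hψ₀ hφ (isTest_gaugeVariation hχ)
    have h2 : source T ψ₀ φ (fun x => pairing (ψ₀ x) (0, fun μ => partialDeriv μ χ x)) = 0 :=
      source_eq_zero_of_identity hU hψ₀ (isTest_pairing hU hψ₀ (isTest_gaugeVariation hχ))
        fun χ' hχ' => T.linearized_gauge_identity hT hU hψ₀ h0 hχ' hχ
    have h3 : ∀ μ ν x, invMetricVariation (ψ₀ x) (0, fun μ => partialDeriv μ χ x) μ ν = 0 := by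
      simp [invMetricVariation]
    have h4 := source_const_smul (T := T) (φ := φ) hU hψ₀
      (isTest_zero (U := U) (Y := FieldValue →L[ℝ] ℝ)) 0
    simp only [smul_zero, zero_mul] at h4
    simp only [h2, h3, zero_smul, h4, Finset.sum_const_zero, zero_sub] at h1
    exact neg_eq_zero.1 h1.symm
  diffeo ξ hξ := by
    have hv := isTest_lieDeriv (fun x hx => contDiffAt_of_isSmoothConfig hU hψ₀ hx) hξ
    have h1 := source_pairing (T := T) hU hψ₀ hφ hv
    rw [source_eq_zero_of_identity hU hψ₀ (isTest_pairing hU hψ₀ hv) fun χ' hχ' =>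
      T.linearized_diffeo_identity hU hψ₀ h0 hχ' hξ] at h1
    exact sub_eq_zero.1 h1.symm

end Source

/-! ### Mass, charge and equation of motion -/

section Motion

variable {U : Set Event} {ψ : FieldConfig} {tensor : Fin 4 → Fin 4 → (Event → ℝ) → ℝ}
  {vector : Fin 4 → (Event → ℝ) → ℝ}

theorem properTimeRate_pos (hγ : ∀ t ∈ lifetime U, metric (ψ (worldline t)) 0 0 < 0) {t : ℝ}
    (ht : t ∈ lifetime U) : 0 < properTimeRate ψ t := Real.sqrt_pos.2 (neg_pos.2 (hγ t ht))

theorem properTimeRate_sq (hγ : ∀ t ∈ lifetime U, metric (ψ (worldline t)) 0 0 < 0) {t : ℝ}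
    (ht : t ∈ lifetime U) : properTimeRate ψ t ^ 2 = -metric (ψ (worldline t)) 0 0 :=
  Real.sq_sqrt (neg_pos.2 (hγ t ht)).le

theorem contDiffAt_properTimeRate (hU : IsOpen U) (hψ : IsSmoothConfig ψ U)
    (hγ : ∀ t ∈ lifetime U, metric (ψ (worldline t)) 0 0 < 0) :
    ∀ t ∈ lifetime U, ContDiffAt ℝ ∞ (properTimeRate ψ) t := fun t ht => by
  refine ContDiffAt.sqrt (ContDiffAt.neg ?_) (neg_pos.2 (hγ t ht)).ne'
  exact (contDiffAt_metric_comp hU hψ 0 0 _ ht).comp t contDiff_worldline.contDiffAt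

theorem hasDerivAt_metric_worldline (hU : IsOpen U) (hψ : IsSmoothConfig ψ U) (μ ν : Fin 4) {t : ℝ}
    (ht : t ∈ lifetime U) : HasDerivAt (fun s => metric (ψ (worldline s)) μ ν)
      (partialDeriv 0 (fun y => metric (ψ y) μ ν) (worldline t)) t :=
  hasDerivAt_comp_worldline (f := fun y => metric (ψ y) μ ν) (contDiffAt_metric_comp hU hψ μ ν _ ht)

theorem hasDerivAt_covector_worldline (hU : IsOpen U) (hψ : IsSmoothConfig ψ U) (μ : Fin 4) {t : ℝ}
    (ht : t ∈ lifetime U) : HasDerivAt (fun s => (ψ (worldline s)).2 μ)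
      (partialDeriv 0 (fun y => (ψ y).2 μ) (worldline t)) t :=
  hasDerivAt_comp_worldline (f := fun y => (ψ y).2 μ) (contDiffAt_covector_comp hU hψ μ _ ht)

theorem velocityLow_eq (t : ℝ) (μ : Fin 4) :
    velocityLow ψ t μ = metric (ψ (worldline t)) μ 0 / properTimeRate ψ t := by
  simp [velocityLow, velocity, coordVec, Pi.single_apply, div_eq_mul_inv]

/-- The weight is `b = 1`: a test function whose restriction is a derivative agrees on the worldline
with some `∂_t χ`, which the gauge identity annihilates. -/
theorem IsConservedSource.exists_charge (h : IsConservedSource U ψ tensor vector) (hU : IsOpen U)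
    (hI : (lifetime U).OrdConnected) :
    ∃ c, ∀ f, IsTest U f → vector 0 f = c * ∫ t in lifetime U, f (worldline t) := by
  obtain ⟨c, hc⟩ := exists_eq_integral_worldline (b := fun _ => 1) (S := vector 0) hU hI
    (fun _ _ => contDiffAt_const) (fun _ _ => one_ne_zero) (h.vector_functional 0).map_add
    (h.vector_functional 0).map_mul fun f k hf hk hfk => by
      obtain ⟨χ, hχ, hχk⟩ := hk.exists_extension hU
      rw [← h.vector_zero_partialDeriv hχ]
      refine (h.vector_functional 0).congr _ _ hf (hχ.partialDeriv 0) fun t ht => ?_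
      rw [hfk t ht, one_mul, ← (hasDerivAt_comp_worldline (hχ.contDiffAt _)).deriv, funext hχk]
  exact ⟨c, by simpa only [div_one] using hc⟩

/-- With `a = dτ/dt`, take `ξ = k ∂_t` with `k = p / a` on the worldline, that is `p` times the
four-velocity. Then the `00` component of the Lie derivative of the metric is `-2 a dp/dt`, while
that of `A` contributes the total derivative `∂_t (k A_0)`, which charge conservation removes: the
electromagnetic force does no work. -/
theorem IsConservedSource.exists_mass (h : IsConservedSource U ψ tensor vector) (hU : IsOpen U)
    (hI : (lifetime U).OrdConnected) (hψ : IsSmoothConfig ψ U)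
    (hγ : ∀ t ∈ lifetime U, metric (ψ (worldline t)) 0 0 < 0) :
    ∃ c, ∀ f, IsTest U f → energySource ψ tensor f =
      c * ∫ t in lifetime U, f (worldline t) / properTimeRate ψ t := by
  have hQ := h.isLineFunctional_energySource hU hψ
  have ha := contDiffAt_properTimeRate hU hψ hγ
  have ha0 : ∀ t ∈ lifetime U, properTimeRate ψ t ≠ 0 := fun t ht => (properTimeRate_pos hγ ht).ne'
  refine exists_eq_integral_worldline hU hI ha ha0 hQ.map_add hQ.map_mul fun f p hf hp hfp => ?_
  have hψ' : ∀ x ∈ U, ContDiffAt ℝ ∞ ψ x := fun x hx => contDiffAt_of_isSmoothConfig hU hψ hx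
  obtain ⟨k, hk, hkp⟩ := 
    (hp.mul_left (k := fun s => (properTimeRate ψ s)⁻¹) fun t ht =>
      (ha t ht).inv (ha0 t ht)).exists_extension hU
  have hξ : IsTest U fun x => k x • coordVec 0 := hk.smul_right fun _ _ => contDiffAt_const
  have hw := isTest_lieDeriv hψ' hξ
  have h1 := h.energySource_add hU hψ hk 0
  have h2 : vector 0 (fun x => (lieDeriv (fun y => k y • coordVec 0) ψ x).2 0) = 0 := by
    have hkA : IsTest U fun x => k x * (ψ x).2 0 := hk.mul_right (contDiffAt_covector_comp hU hψ 0)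
    rw [← h.vector_zero_partialDeriv hkA]
    refine (h.vector_functional 0).congr _ _ (isTest_vector_component hw 0) (hkA.partialDeriv 0)
      fun t ht => ?_
    rw [lieDeriv_smul_coordVec_snd (hψ' _ ht) (hk.contDiffAt _),
      partialDeriv_mul (hk.contDiffAt _) (contDiffAt_covector_comp hU hψ 0 _ ht)]
  have h3 : energySource ψ tensor (fun x => (lieDeriv (fun y => k y • coordVec 0) ψ x).1 s(0, 0)) =
      -2 * energySource ψ tensor f := by
    rw [← hQ.map_mul _ _ hf]
    refine hQ.congr _ _ (isTest_tensor_component hw s(0, 0))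
      (hf.mul_left fun _ _ => contDiffAt_const) fun t ht => ?_
    rw [lieDeriv_smul_coordVec_fst (hψ' _ ht) (hk.contDiffAt _), hfp t ht, hkp]
    have d1 := hasDerivAt_metric_worldline hU hψ 0 0 ht
    have d2 : HasDerivAt (properTimeRate ψ) (deriv (properTimeRate ψ) t) t :=
      ((ha t ht).differentiableAt (by simp)).hasDerivAt
    have d3 := hasDerivAt_comp_worldline (hk.contDiffAt (worldline t))
    have d4 : HasDerivAt (fun s => properTimeRate ψ s * k (worldline s)) (deriv p t) t := by
      refine (hp.differentiable t).hasDerivAt.congr_of_eventuallyEq ?_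
      filter_upwards [(isOpen_lifetime hU).mem_nhds ht] with s hs
      rw [hkp, mul_inv_cancel_left₀ (ha0 s hs)]
    have e1 := d4.unique (d2.mul d3)
    have e2 : partialDeriv 0 (fun y => metric (ψ y) 0 0) (worldline t) =
        -(2 * properTimeRate ψ t * deriv (properTimeRate ψ) t) := by
      have d5 : HasDerivAt (fun s => metric (ψ (worldline s)) 0 0)
          (-(2 * properTimeRate ψ t * deriv (properTimeRate ψ) t)) t := by
        have d6 := (d2.pow 2).neg
        refine (d6.congr_of_eventuallyEq ?_).congr_deriv (by simp)
        filter_upwards [(isOpen_lifetime hU).mem_nhds ht] with s hs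
        simp only [Pi.neg_apply, Pi.pow_apply, properTimeRate_sq hγ hs, neg_neg]
      exact d1.unique d5
    have e3 : metric (ψ (worldline t)) 0 0 = -properTimeRate ψ t ^ 2 := by
      rw [properTimeRate_sq hγ ht, neg_neg]
    have e4 : (properTimeRate ψ t)⁻¹ * p t = k (worldline t) := (hkp t).symm
    rw [e1, e2, e3, e4]
    ring
  rw [h2, h3] at h1
  linarith

/-- The balance of momentum along the worldline. -/
theorem IsConservedSource.force_law (h : IsConservedSource U ψ tensor vector) (hU : IsOpen U)
    (hψ : IsSmoothConfig ψ U) (hγ : ∀ t ∈ lifetime U, metric (ψ (worldline t)) 0 0 < 0) {m e : ℝ}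
    (hm : ∀ f, IsTest U f → energySource ψ tensor f =
      m * ∫ t in lifetime U, f (worldline t) / properTimeRate ψ t)
    (he : ∀ f, IsTest U f → vector 0 f = e * ∫ t in lifetime U, f (worldline t))
    {t : ℝ} (ht : t ∈ lifetime U) (μ : Fin 4) :
    m * (partialDeriv μ (fun y => metric (ψ y) 0 0) (worldline t) / properTimeRate ψ t -
        2 * deriv (fun s => velocityLow ψ s μ) t) +
      e * (partialDeriv μ (fun y => (ψ y).2 0) (worldline t) -
        partialDeriv 0 (fun y => (ψ y).2 μ) (worldline t)) = 0 := by
  have ha := contDiffAt_properTimeRate hU hψ hγ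
  have ha0 : ∀ t ∈ lifetime U, properTimeRate ψ t ≠ 0 := fun t ht => (properTimeRate_pos hγ ht).ne'
  have hψ' : ∀ x ∈ U, ContDiffAt ℝ ∞ ψ x := fun x hx => contDiffAt_of_isSmoothConfig hU hψ hx
  have hIo := isOpen_lifetime hU
  have hg : ∀ s ∈ lifetime U, ContDiffAt ℝ ∞ (fun s => velocityLow ψ s μ) s := fun s hs => by
    simp only [velocityLow_eq]
    exact ((contDiffAt_metric_comp hU hψ μ 0 _ hs).comp s contDiff_worldline.contDiffAt).div
      (ha s hs) (ha0 s hs)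
  have hA : ∀ s ∈ lifetime U, ContDiffAt ℝ ∞ (fun s => (ψ (worldline s)).2 μ) s := fun s hs =>
    (contDiffAt_covector_comp hU hψ μ _ hs).comp s contDiff_worldline.contDiffAt
  refine eq_zero_of_integral_lineTest_eq_zero (k := fun t =>
    m * (partialDeriv μ (fun y => metric (ψ y) 0 0) (worldline t) / properTimeRate ψ t -
        2 * deriv (fun s => velocityLow ψ s μ) t) +
      e * (partialDeriv μ (fun y => (ψ y).2 0) (worldline t) -
        partialDeriv 0 (fun y => (ψ y).2 μ) (worldline t))) hIo (fun s hs => ?_) (fun p hp => ?_) ht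
  · have c1 : ContDiffAt ℝ ∞ (deriv fun s => velocityLow ψ s μ) s :=
      ((hg s hs).fderiv_right (m := ∞) le_rfl).clm_apply contDiffAt_const
    have c2 : ∀ {f : Event → ℝ} (ν : Fin 4), ContDiffAt ℝ ∞ f (worldline s) →
        ContinuousAt (fun s => partialDeriv ν f (worldline s)) s := fun ν hf =>
      ((contDiffAt_partialDeriv hf ν).comp s contDiff_worldline.contDiffAt).continuousAt
    exact ((continuousAt_const.mul (((c2 μ (contDiffAt_metric_comp hU hψ 0 0 _ hs)).div
      (ha s hs).continuousAt (ha0 s hs)).sub (continuousAt_const.mul c1.continuousAt))).add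
      (continuousAt_const.mul ((c2 μ (contDiffAt_covector_comp hU hψ 0 _ hs)).sub
        (c2 0 (contDiffAt_covector_comp hU hψ μ _ hs))))).continuousWithinAt
  · obtain ⟨k, hk, hkp⟩ := hp.exists_extension hU
    have hξ : IsTest U fun x => k x • coordVec μ := hk.smul_right fun _ _ => contDiffAt_const
    have hw := isTest_lieDeriv hψ' hξ
    have h1 := h.energySource_add hU hψ hk μ
    rw [hm _ (isTest_tensor_component hw s(0, 0)), he _ (isTest_vector_component hw 0)] at h1
    have hw1 := (isTest_tensor_component hw s(0, 0)).comp_worldline.mul_left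
      (k := fun s => (properTimeRate ψ s)⁻¹) fun s hs => (ha s hs).inv (ha0 s hs)
    simp only [← div_eq_inv_mul] at hw1
    have hw2 := (isTest_vector_component hw 0).comp_worldline
    -- The boundary term of the integration by parts is `p` times the combination `2 m u_μ + e A_μ`.
    -- Subtracting its derivative, whose integral is zero, removes `dp/dt` from the integrand.
    have hB : IsLineTest (lifetime U) fun s => (m * (2 * velocityLow ψ s μ) +
        e * (ψ (worldline s)).2 μ) * p s := hp.mul_left fun s hs =>
      (contDiffAt_const.mul (contDiffAt_const.mul (hg s hs))).add (contDiffAt_const.mul (hA s hs))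
    have h2 : ∫ s in lifetime U, deriv (fun s => (m * (2 * velocityLow ψ s μ) +
        e * (ψ (worldline s)).2 μ) * p s) s = 0 := by
      rw [hB.deriv.setIntegral_eq, hB.integral_deriv]
    rw [← sub_zero (_ + _), ← h2, ← integral_const_mul, ← integral_const_mul,
      ← integral_add, ← integral_sub] at h1
    · refine Eq.trans ?_ (h1.trans h2)
      refine setIntegral_congr_fun hIo.measurableSet fun s hs => ?_
      have d1 := ((hg s hs).differentiableAt (by simp)).hasDerivAt
      have d2 := (((d1.const_mul 2).const_mul m).add
        ((hasDerivAt_covector_worldline hU hψ μ hs).const_mul e)).mul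
        (hp.differentiable s).hasDerivAt
      have d3 : partialDeriv 0 k (worldline s) = deriv p s := by
        rw [← (hasDerivAt_comp_worldline (hk.contDiffAt _)).deriv, funext hkp]
      have d4 : metric (ψ (worldline s)) μ 0 = velocityLow ψ s μ * properTimeRate ψ s := by
        rw [velocityLow_eq, div_mul_cancel₀ _ (ha0 s hs)]
      simp only [lieDeriv_smul_coordVec_fst (hψ' _ hs) (hk.contDiffAt _),
        lieDeriv_smul_coordVec_snd (hψ' _ hs) (hk.contDiffAt _), d3, d4, hkp]
      have d5 : deriv (fun s => (m * (2 * velocityLow ψ s μ) + e * (ψ (worldline s)).2 μ) * p s) s =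
          (m * (2 * deriv (fun s => velocityLow ψ s μ) s) +
            e * partialDeriv 0 (fun y => (ψ y).2 μ) (worldline s)) * p s +
          (m * (2 * velocityLow ψ s μ) + e * (ψ (worldline s)).2 μ) * deriv p s := d2.deriv
      rw [d5]
      have := ha0 s hs
      field_simp
      ring
    · exact ((hw1.integrable.const_mul m).add (hw2.integrable.const_mul e)).integrableOn
    · exact hB.deriv.integrable.integrableOn
    · exact (hw1.integrable.const_mul m).integrableOn
    · exact (hw2.integrable.const_mul e).integrableOn

end Motion

/-! ### Coordinate form of the acceleration and of the field strength -/

section Geometry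

variable {ψ : FieldConfig}

/-- Lowering the upper index with the zeroth row of the metric leaves three derivatives of the
metric, two of which cancel by symmetry. -/
theorem IsLorentzian.sum_christoffel_mul_metric {x : Event} (hx : IsLorentzian (ψ x)) (μ : Fin 4) :
    ∑ ρ, christoffel ψ x ρ 0 μ * metric (ψ x) ρ 0 =
      1 / 2 * partialDeriv μ (fun y => metric (ψ y) 0 0) x := by
  have h1 : ∀ σ, ∑ ρ, metric (ψ x) ρ 0 * invMetric (ψ x) ρ σ = if 0 = σ then 1 else 0 := fun σ => by
    rw [← hx.metric_mul_inv 0 σ]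
    exact Finset.sum_congr rfl fun ρ _ => by rw [metric_symm]
  have h2 : ∑ ρ, christoffel ψ x ρ 0 μ * metric (ψ x) ρ 0 =
      1 / 2 * ∑ σ, (∑ ρ, metric (ψ x) ρ 0 * invMetric (ψ x) ρ σ) *
        (partialDeriv 0 (fun y => metric (ψ y) μ σ) x + partialDeriv μ (fun y => metric (ψ y) 0 σ) x -
          partialDeriv σ (fun y => metric (ψ y) 0 μ) x) := by
    simp only [christoffel, Finset.sum_mul, Finset.mul_sum]
    rw [Finset.sum_comm]
    exact Finset.sum_congr rfl fun σ _ => Finset.sum_congr rfl fun ρ _ => by ring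
  have h3 : (fun y => metric (ψ y) μ 0) = fun y => metric (ψ y) 0 μ :=
    funext fun y => metric_symm _ _ _
  simp only [h2, h1, ite_mul, one_mul, zero_mul, Finset.sum_ite_eq, Finset.mem_univ, if_true, h3]
  ring

theorem accelerationLow_eq {t : ℝ} (ht : IsLorentzian (ψ (worldline t))) (μ : Fin 4) :
    accelerationLow ψ t μ = (properTimeRate ψ t)⁻¹ * deriv (fun s => velocityLow ψ s μ) t -
      (properTimeRate ψ t)⁻¹ ^ 2 *
        (1 / 2 * partialDeriv μ (fun y => metric (ψ y) 0 0) (worldline t)) := by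
  rw [accelerationLow, ← ht.sum_christoffel_mul_metric μ]
  congr 1
  have h1 : ∀ ν, ∑ ρ, christoffel ψ (worldline t) ρ ν μ * velocity ψ t ν * velocityLow ψ t ρ =
      if ν = 0 then (properTimeRate ψ t)⁻¹ ^ 2 *
        ∑ ρ, christoffel ψ (worldline t) ρ 0 μ * metric (ψ (worldline t)) ρ 0 else 0 := by
    intro ν
    split_ifs with hν
    · rw [hν, Finset.mul_sum]
      refine Finset.sum_congr rfl fun ρ _ => ?_
      rw [velocityLow_eq, velocity, coordVec, Pi.single_eq_same]
      ring
    · refine Finset.sum_eq_zero fun ρ _ => ?_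
      rw [velocity, coordVec, Pi.single_eq_of_ne hν]
      ring
  simp only [h1, Finset.sum_ite_eq', Finset.mem_univ, if_true]

theorem christoffel_symm (x : Event) (ρ μ ν : Fin 4) :
    christoffel ψ x ρ μ ν = christoffel ψ x ρ ν μ := by
  have h : (fun y => metric (ψ y) μ ν) = fun y => metric (ψ y) ν μ :=
    funext fun y => metric_symm _ _ _
  rw [christoffel, christoffel, h]
  congr 1
  exact Finset.sum_congr rfl fun σ _ => by ring

theorem antisymCovDerivA_eq (x : Event) (μ ν : Fin 4) : antisymCovDerivA ψ x μ ν =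
    1 / 2 * (partialDeriv μ (fun y => (ψ y).2 ν) x - partialDeriv ν (fun y => (ψ y).2 μ) x) := by
  simp only [antisymCovDerivA, covDerivA, christoffel_symm x _ ν μ]
  ring

theorem sum_velocity_mul (t : ℝ) (F : Fin 4 → ℝ) :
    ∑ ν, velocity ψ t ν * F ν = (properTimeRate ψ t)⁻¹ * F 0 := by
  simp [velocity, coordVec, Pi.single_apply]

end Geometry

end SmallBody

/-! ### Assembly of the theorem -/

open SmallBody

theorem mainTheorem3 (T : SmallBody.VectorTensorTheory) (hT : T.HasMaxwellSymmetry)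
    (U : Set SmallBody.Event) (ψ : ℝ → SmallBody.FieldConfig) (l₀ R : ℝ)
    (hψ : SmallBody.IsSmallBodyFamily T U ψ l₀ R) :
    ∃ M q : ℝ,
      (∀ μ ν : Fin 4, SmallBody.DistributionalEq U (fun x => SmallBody.volDensity (ψ 0 x))
        (fun φ x => (SmallBody.linearizedFieldEq T (ψ 0) φ x).1 s(μ, ν)) (SmallBody.perturbation ψ)
        (SmallBody.worldlineSource U (ψ 0) (fun t => 8 * Real.pi * M *
          (SmallBody.velocityLow (ψ 0) t μ * SmallBody.velocityLow (ψ 0) t ν)))) ∧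
      (∀ μ : Fin 4, SmallBody.DistributionalEq U (fun x => SmallBody.volDensity (ψ 0 x))
        (fun φ x => (SmallBody.linearizedFieldEq T (ψ 0) φ x).2 μ) (SmallBody.perturbation ψ)
        (SmallBody.worldlineSource U (ψ 0) (fun t => 16 * Real.pi * q *
          SmallBody.velocity (ψ 0) t μ))) ∧
      ∀ t : ℝ, SmallBody.worldline t ∈ U → ∀ μ : Fin 4,
        M * SmallBody.accelerationLow (ψ 0) t μ =
          2 * q * ∑ ν, SmallBody.velocity (ψ 0) t ν *
            SmallBody.antisymCovDerivA (ψ 0) (SmallBody.worldline t) μ ν := by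
  have hU := hψ.isOpen
  have hψ₀ := hψ.background
  have hφ := hψ.isSingularField
  have hE : ∀ x ∈ U, spatial x ≠ 0 → linearizedFieldEq T (ψ 0) (perturbation ψ) x = 0 :=
    fun x hx hx0 => hψ.linearizedFieldEq_perturbation hx hx0
  have hγ : ∀ t ∈ lifetime U, metric (ψ 0 (worldline t)) 0 0 < 0 := hψ.timelike
  have hIo := isOpen_lifetime hU
  have hS := isConservedSource_source hT hU hψ₀ (fun x hx => hψ.background_solves hx) hφ hE
  obtain ⟨m, hm⟩ := hS.exists_mass hU hψ.connected hψ₀ hγ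
  obtain ⟨e, he⟩ := hS.exists_charge hU hψ.connected
  have hπ : Real.pi ≠ 0 := Real.pi_ne_zero
  have ha0 : ∀ t ∈ lifetime U, properTimeRate (ψ 0) t ≠ 0 := fun t ht =>
    (properTimeRate_pos hγ ht).ne'
  -- The constants `m` and `e` multiply integrals over coordinate time. In proper time, `g_{μ0}
  -- g_{ν0} / a` becomes `u_μ u_ν dτ/dt` and `1` becomes `u^0 dτ/dt`, with `a = dτ/dt`, so only the
  -- factors `8π` and `16π` remain to be divided out.
  refine ⟨m / (8 * Real.pi), e / (16 * Real.pi), fun μ ν => ?_, fun μ => ?_, fun t ht μ => ?_⟩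
  · refine distributionalEq_of_source hU hψ₀ hφ (tensorEv s(μ, ν)) fun f hf => ?_
    have h1 := hS.tensor_eq hU hψ₀ hf μ ν
    rw [hm _ (hf.mul_right fun x hx => (contDiffAt_metric_comp hU hψ₀ μ 0 x hx).mul
      (contDiffAt_metric_comp hU hψ₀ ν 0 x hx)), ← integral_const_mul] at h1
    refine h1.trans (setIntegral_congr_fun hIo.measurableSet fun t ht => ?_)
    have := ha0 t ht
    simp only [velocityLow_eq]
    field_simp
  · refine distributionalEq_of_source hU hψ₀ hφ (vectorEv μ) fun f hf => ?_
    refine Fin.cases ?_ (fun i => ?_) μ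
    · refine ((he f hf).trans (integral_const_mul _ _).symm).trans
        (setIntegral_congr_fun hIo.measurableSet fun t ht => ?_)
      have := ha0 t ht
      simp only [velocity, coordVec, Pi.single_eq_same]
      field_simp
    · refine (hS.vector_succ hf i).trans ?_
      simp [worldlineSource, velocity, coordVec]
  · have h1 := hS.force_law hU hψ₀ hγ hm he ht μ
    have := ha0 t ht
    rw [accelerationLow_eq (hψ₀.2 _ ht), sum_velocity_mul, antisymCovDerivA_eq]
    field_simp at h1 ⊢
    linarith

end
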